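/- **Setting.** Let $p$ be an odd prime, $L$ a finite extension of $\mathbb{Q}_p$ with absolute ramification degree $e'$ and residue field $k$ of order $p^f$, and $k_E$ a finite field with embeddings $\sigma_i:k\hookrightarrow k_E$ ($i\in\mathbb{Z}/f\mathbb{Z}$) such that $\sigma_{i+1}^p=\sigma_i$. Let $I_L$ be the inertia subgroup of $G_L$. Fix $\pi\in\overline{\mathbb{Q}}_p$ such that $\pi^{p^f-1}$ is a uniformiser of $L$, and let $\omega_i:I_L\to k_E^\times$ be the fundamental character $g\mapsto\sigma_i\big(\overline{g(\pi)/\pi}\big)$. Let $\tilde\omega_i$ be the Teichmüller lift of $\omega_i$. Via the Artin map (uniformisers corresponding to geometric Frobenius elements), characters of $I_L$ that factor through $k^\times$ are identified with characters of $k^\times$; thus $\omega_i$ corresponds to $\sigma_i$. Let $\overline\rho:G_L\to \mathrm{GL}_2(k_E)$ be continuous and reducible, $\overline\rho\simeq\begin{pmatrix}\chi_2&*\\0&\chi_1\end{pmatrix}$, with the ordered pair $(\chi_1,\chi_2)$ fixed. Assume that $\overline\rho$ is *generic*: $\chi_1^{-1}\chi_2|_{I_L}=\prod_i\omega_i^{b_i+e'}$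 for integers $b_i$ with $e'\le b_i+e'\le p-1-e'$. Write $\chi_1|_{I_L}=\prod_i\omega_i^{c_i}$ with integers $c_i$. **Weights.** For $m\in\mathbb{Z}^f$ and $n\in\{0,\dots,p-1\}^f$ let $\mu_{m,n}$ be the (isomorphism class of the) representation $\bigotimes_{i}(\det^{m_i}\otimes\mathrm{Sym}^{n_i}k^2)\otimes_{k,\sigma_i}k_E$ of $\mathrm{GL}_2(k)$. Call $(J,d)$, with $J\subseteq\mathbb{Z}/f\mathbb{Z}$ and $d\in\mathbb{Z}^f$, *admissible* if $0\le d_i\le e'-1$ for $i\in J$ and $1\le d_i\le e'$ for $i\notin J$. Let $W'=W_{\mathrm{expl}}(\overline\rho^{\mathrm{ss}})$ be the set of all $\mu_{m,n}$ for which there is an admissible $(J,d)$ with $$\chi_2|_{I_L}=\prod_{i\in J}\omega_i^{m_i+n_i+e'-d_i}\prod_{i\notin J}\omega_i^{m_i+e'-d_i},\qquad \chi_1|_{I_L}=\prod_{i\in J}\omega_i^{m_i+d_i}\prod_{i\notin J}\omega_i^{m_i+n_i+d_i}.$$ For $(J,d)$ admissible let $\mu(J,d)=\mu_{m,n}$,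 where $$(m_i,n_i)=\begin{cases}(c_i+p-1-d_i,\ b_i+2d_i)& i\in J,\ i+1\in J,\\ (c_i+p-1-d_i,\ b_i+2d_i+1)& i\in J,\ i+1\notin J,\\ (c_i+b_i+d_i-1,\ p-b_i-2d_i)& i\notin J,\ i+1\in J,\\ (c_i+b_i+d_i,\ p-1-b_i-2d_i)& i\notin J,\ i+1\notin J,\end{cases}$$ and let $W$ be the set of all these $\mu(J,d)$. In two exceptional cases there is a further weight $\mu'(J,d)=\mu_{m,n}$ with all $n_i=p-1$: if $b=d=(0,\dots,0)$ and $J=\mathbb{Z}/f\mathbb{Z}$, take $m_i=c_i$; if $b=(p-1-2e',\dots,p-1-2e')$, $d=(e',\dots,e')$ and $J=\varnothing$, take $m_i=c_i-e'$. **Types.** Let $A=\{0,\dots,e'\}^f$. For $a\in A$ put $\psi_1=\prod_i\tilde\omega_i^{c_i+b_i+a_i}$ and $\psi_2=\prod_i\tilde\omega_i^{c_i-a_i}$. If $\psi_1\ne\psi_2$, let $\theta_a=\theta_a'=\mathrm{Ind}_B^{\mathrm{GL}_2(k)}(\psi_1\otimes\psi_2)$, where $B$ is the group of upper triangular matrices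 in $\mathrm{GL}_2(k)$ and $\psi_1\otimes\psi_2$ sends $\begin{pmatrix}x&*\\0&y\end{pmatrix}$ to $\psi_1(x)\psi_2(y)$. If $\psi_1=\psi_2$, let $\theta_a=\psi_1\circ\det$ and $\theta_a'=\theta_a\otimes\mathrm{Ind}_B^{\mathrm{GL}_2(k)}\mathbf 1$. Let $W_a$ (resp. $W'_a$) be the set of $\mu\in W'$ that are Jordan–Hölder constituents of the reduction modulo $p$ of $\theta_a$ (resp. $\theta'_a$). **Proposition.** 1. $W$ (resp. $W'$) is the disjoint union of the $W_a$ (resp. $W'_a$) for $a\in A$. 2. $|W_a|=2^{f-\delta_a}$ for $a\in A$, where $\delta_a=|\{\,i : a_i=0\text{ or }a_i=e'\,\}|$. 3. For $a\in A$: if $\mu(J,d)\in W'_a$ ($(J,d)$ admissible), or $\mu'(J,d)\in W'_a$ ($(J,d)$ exceptional), then $\sum_i a_i=\sum_i d_i$. -/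

import Mathlib

open scoped NNReal TensorProduct

noncomputable section

namespace SerreWeights

/-! ### Local fields, inertia, and the tame characters

A finite extension `L` of `ℚ_p` is a subfield of the fixed algebraic closure `PadicAlgCl p` of
`ℚ_p`, which carries the unique norm extending the `p`-adic one. -/

section LocalField

variable {p : ℕ} [Fact p.Prime]

/-- The ring of integers of `L`, i.e. the elements of norm at most one. -/
abbrev ringOfIntegers (L : IntermediateField ℚ_[p] (PadicAlgCl p)) : ValuationSubring L :=
  ((Valued.v : Valuation (PadicAlgCl p) ℝ≥0).comap
    (algebraMap L (PadicAlgCl p))).valuationSubring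

/-- The residue field of `L`. -/
abbrev residueField (L : IntermediateField ℚ_[p] (PadicAlgCl p)) : Type :=
  IsLocalRing.ResidueField (ringOfIntegers L)

/-- The absolute Galois group of `L`, a topological group for the Krull topology. -/
abbrev absGal (L : IntermediateField ℚ_[p] (PadicAlgCl p)) : Type :=
  Gal(PadicAlgCl p/L)

theorem mem_ringOfIntegers (L : IntermediateField ℚ_[p] (PadicAlgCl p)) (x : L) :
    x ∈ ringOfIntegers L ↔ ‖(x : PadicAlgCl p)‖ ≤ 1 := by
  rw [← PadicAlgCl.valuation_coe]
  exact Iff.rfl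

theorem norm_absGal {L : IntermediateField ℚ_[p] (PadicAlgCl p)} (g : absGal L)
    (x : PadicAlgCl p) : ‖g x‖ = ‖x‖ :=
  (spectralNorm_eq_of_equiv (K := ℚ_[p]) (g.restrictScalars ℚ_[p]) x).symm

/-- The inertia subgroup: the automorphisms acting trivially on the residue field of the
algebraic closure. -/
def inertia (L : IntermediateField ℚ_[p] (PadicAlgCl p)) : Subgroup (absGal L) where
  carrier := {g | ∀ x : PadicAlgCl p, ‖x‖ ≤ 1 → ‖g x - x‖ < 1}
  one_mem' := fun x _ => by simp
  mul_mem' := fun {a b} ha hb x hx => by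
    have h1 := ha (b x) (by rwa [norm_absGal])
    have h2 := hb x hx
    have h3 : (a * b) x - x = (a (b x) - b x) + (b x - x) := by
      rw [AlgEquiv.mul_apply]; ring
    rw [h3]
    exact (IsUltrametricDist.norm_add_le_max _ _).trans_lt (max_lt h1 h2)
  inv_mem' := fun {a} ha x hx => by
    have h1 := ha (a⁻¹ x) (by rwa [norm_absGal])
    have h2 : a (a⁻¹ x) = x := AlgEquiv.apply_symm_apply a x
    rw [h2] at h1
    rwa [norm_sub_rev]

/-- `L` has residue field with `p ^ f` elements and absolute ramification degree `e`, and `π` is a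
`(p ^ f - 1)`-st root of a uniformiser of `L` (so that `L(π)` is a totally tamely ramified
extension of `L` of degree `p ^ f - 1`). -/
structure IsLocalSetting (L : IntermediateField ℚ_[p] (PadicAlgCl p)) (f e : ℕ)
    (π : PadicAlgCl p) : Prop where
  card_residueField : Nat.card (residueField L) = p ^ f
  ne_zero : π ≠ 0
  pow_mem : π ^ (p ^ f - 1) ∈ L
  norm_pow_lt_one : ‖π ^ (p ^ f - 1)‖ < 1
  norm_le : ∀ x ∈ L, ‖x‖ < 1 → ‖x‖ ≤ ‖π ^ (p ^ f - 1)‖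
  ramification : ‖π ^ (p ^ f - 1)‖ ^ e = ‖(p : PadicAlgCl p)‖

open Classical in
/-- The function `g ↦ g(π)/π` on `G_L`, reduced to an element of the residue field of `L`. On
inertia this is the fundamental character `I_L → 𝒪_L^× → k^×` given by the Artin map (normalised
so that uniformisers correspond to geometric Frobenius elements). The second branch is never
taken, see `IsLocalSetting.exists_residue`. -/
def tameCharacter (L : IntermediateField ℚ_[p] (PadicAlgCl p)) (π : PadicAlgCl p)
    (g : absGal L) : residueField L :=
  if h : ∃ u : ringOfIntegers L, ‖g π / π - ((u : L) : PadicAlgCl p)‖ < 1 then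
    IsLocalRing.residue (ringOfIntegers L) h.choose
  else 0

theorem IsLocalSetting.exists_residue {L : IntermediateField ℚ_[p] (PadicAlgCl p)} {f e : ℕ}
    {π : PadicAlgCl p} (h : IsLocalSetting L f e π) (g : absGal L) :
    ∃ u : ringOfIntegers L, ‖g π / π - ((u : L) : PadicAlgCl p)‖ < 1 := by
  classical
  have hp : p.Prime := Fact.out
  have hfin : Finite (residueField L) := Nat.finite_of_card_ne_zero (by
    rw [h.card_residueField]
    exact pow_ne_zero _ hp.ne_zero)
  have hft : Fintype (residueField L) := Fintype.ofFinite _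
  set q := p ^ f with hq
  have hcard : Fintype.card (residueField L) = q := by
    rw [← Nat.card_eq_fintype_card, h.card_residueField]
  have hq1 : 1 < q := by
    rw [← hcard]
    exact Fintype.one_lt_card
  let OC : ValuationSubring (PadicAlgCl p) :=
    (Valued.v : Valuation (PadicAlgCl p) ℝ≥0).valuationSubring
  have hunit : ∀ y : OC, ‖(y : PadicAlgCl p)‖ < 1 ↔ IsLocalRing.residue OC y = 0 := fun y => by
    rw [IsLocalRing.residue_eq_zero_iff, ValuationSubring.valuation_lt_one_iff]
    exact Valuation.isEquiv_iff_val_lt_one.1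
      (Valuation.isEquiv_valuation_valuationSubring
        (Valued.v : Valuation (PadicAlgCl p) ℝ≥0))
  let φ : ringOfIntegers L →+* OC :=
    ((algebraMap L (PadicAlgCl p)).comp (ringOfIntegers L).subtype).codRestrict OC fun x => x.2
  have hφ : ∀ x, ((φ x : OC) : PadicAlgCl p) = ((x : L) : PadicAlgCl p) := fun _ => rfl
  have hker : ∀ x ∈ IsLocalRing.maximalIdeal (ringOfIntegers L),
      (IsLocalRing.residue OC).comp φ x = 0 := fun x hx => by
    rw [RingHom.comp_apply, ← hunit, hφ]
    rw [ValuationSubring.valuation_lt_one_iff] at hx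
    exact (Valuation.isEquiv_iff_val_lt_one.1
      (Valuation.isEquiv_valuation_valuationSubring
        ((Valued.v : Valuation (PadicAlgCl p) ℝ≥0).comap (algebraMap L (PadicAlgCl p))))).2 hx
  let ι : residueField L →+* IsLocalRing.ResidueField OC := Ideal.Quotient.lift _ _ hker
  have hι : ∀ x, ι (IsLocalRing.residue _ x) = IsLocalRing.residue OC (φ x) := fun x =>
    Ideal.Quotient.lift_mk _ _ _
  have hgπ : (g π) ^ (q - 1) = π ^ (q - 1) := by
    rw [← map_pow]
    exact g.commutes ⟨_, h.pow_mem⟩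
  have hz : (g π / π) ^ q = g π / π := by
    have h1 : (g π / π) ^ (q - 1) = 1 := by
      rw [div_pow, hgπ, div_self (pow_ne_zero _ h.ne_zero)]
    conv_lhs => rw [← Nat.sub_add_cancel hq1.le, pow_succ, h1, one_mul]
  have hzn : ‖g π / π‖ = 1 := by
    rw [norm_div, norm_absGal, div_self (norm_ne_zero_iff.2 h.ne_zero)]
  let z : OC := ⟨g π / π, by
    rw [Valuation.mem_valuationSubring_iff]
    exact hzn.le⟩
  have hzq : (IsLocalRing.residue OC z) ^ q = IsLocalRing.residue OC z := by
    rw [← map_pow]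
    congr 1
    exact Subtype.ext hz
  have hroots := FiniteField.roots_X_pow_card_sub_X (residueField L)
  rw [hcard] at hroots
  have hmap : ((Polynomial.X ^ q - Polynomial.X : Polynomial (residueField L)).map ι).roots =
      (Polynomial.X ^ q - Polynomial.X : Polynomial (residueField L)).roots.map ι := by
    refine Polynomial.Splits.roots_map (Polynomial.splits_iff_card_roots.2 ?_) ι
    rw [hroots, FiniteField.X_pow_card_sub_X_natDegree_eq _ hq1, ← hcard]
    rfl
  have hmem : IsLocalRing.residue OC z ∈
      (Polynomial.X ^ q - Polynomial.X : Polynomial (residueField L)).roots.map ι := by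
    rw [← hmap, Polynomial.map_sub, Polynomial.map_pow, Polynomial.map_X,
      Polynomial.mem_roots (FiniteField.X_pow_card_sub_X_ne_zero _ hq1)]
    simp [hzq]
  obtain ⟨x, -, hx⟩ := Multiset.mem_map.1 hmem
  obtain ⟨u, rfl⟩ := IsLocalRing.residue_surjective x
  refine ⟨u, (hunit (z - φ u)).2 ?_⟩
  rw [map_sub, ← hι, hx, sub_self]

end LocalField

/-! ### Representations of `GL₂` of a finite field -/

section Representations

variable {R G V : Type*} [CommRing R] [Group G] [AddCommGroup V] [Module R V]

/-- The twist of a representation by a character. -/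
def twist (χ : G →* Rˣ) (ρ : Representation R G V) : Representation R G V where
  toFun g := (χ g : R) • ρ g
  map_one' := by simp
  map_mul' g h := by
    refine LinearMap.ext fun v => ?_
    simp only [map_mul, Units.val_mul, LinearMap.smul_apply, Module.End.mul_apply, map_smul]
    rw [mul_comm, mul_smul]

/-- The one-dimensional representation given by a character. -/
def charRep (χ : G →* Rˣ) : Representation R G R :=
  twist χ (Representation.trivial R G R)

/-- Tensor product over `R` of a family of representations of `G`. -/
def piTensor {ι : Type*} {U : ι → Type*} [∀ i, AddCommGroup (U i)] [∀ i, Module R (U i)]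
    (ρ : ∀ i, Representation R G (U i)) :
    Representation R G (PiTensorProduct R U) :=
  PiTensorProduct.mapMonoidHom.comp (MonoidHom.pi ρ)

/-- Isomorphism of representations. -/
def IsoRep {U W : Type*} [AddCommMonoid U] [Module R U] [AddCommMonoid W] [Module R W]
    (ρ : Representation R G U) (ρ' : Representation R G W) : Prop :=
  Nonempty (ρ.Equiv ρ')

theorem IsoRep.trans {U W X : Type*} [AddCommMonoid U] [Module R U] [AddCommMonoid W] [Module R W]
    [AddCommMonoid X] [Module R X] {ρ : Representation R G U} {ρ' : Representation R G W}
    {ρ'' : Representation R G X} (h : IsoRep ρ ρ') (h' : IsoRep ρ' ρ'') : IsoRep ρ ρ'' := by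
  obtain ⟨φ⟩ := h
  obtain ⟨ψ⟩ := h'
  exact ⟨Representation.Equiv.trans φ ψ⟩

/-- `σ` is a Jordan–Hölder constituent of the finite-dimensional representation `ρ`: it is
irreducible and isomorphic to a subquotient `M / N` of `ρ`. -/
def IsJHConstituent {F U W : Type*} [Field F] [AddCommGroup U] [Module F U]
    [AddCommGroup W] [Module F W]
    (σ : Representation F G U) (ρ : Representation F G W) : Prop :=
  σ.IsIrreducible ∧
    ∃ N M : Submodule (MonoidAlgebra F G) ρ.asModule, N ≤ M ∧
      Nonempty ((M ⧸ N.submoduleOf M) ≃ₗ[MonoidAlgebra F G] σ.asModule)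

/-- The substitution `X j ↦ ∑ i, g i j • X i`, by which `g` acts on the symmetric algebra of the
standard representation `F²` with basis vectors `X 0`, `X 1`. -/
def symSubst {F : Type*} [Field F] (g : GL (Fin 2) F) :
    MvPolynomial (Fin 2) F →ₐ[F] MvPolynomial (Fin 2) F :=
  MvPolynomial.aeval fun j => ∑ i : Fin 2, MvPolynomial.C (g.1 i j) * MvPolynomial.X i

theorem symSubst_one {F : Type*} [Field F] :
    symSubst (1 : GL (Fin 2) F) = AlgHom.id F (MvPolynomial (Fin 2) F) := by
  refine MvPolynomial.algHom_ext fun j => ?_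
  fin_cases j <;> simp [symSubst]

theorem symSubst_mul {F : Type*} [Field F] (g h : GL (Fin 2) F) :
    symSubst (g * h) = (symSubst g).comp (symSubst h) := by
  refine MvPolynomial.algHom_ext fun j => ?_
  simp only [symSubst, MvPolynomial.aeval_X, AlgHom.comp_apply, map_mul,
    Fin.sum_univ_two, Units.val_mul, Matrix.mul_apply, map_add, MvPolynomial.aeval_C,
    MvPolynomial.algebraMap_eq]
  ring

theorem symSubst_mem {F : Type*} [Field F] (g : GL (Fin 2) F) {n : ℕ}
    (P : MvPolynomial (Fin 2) F) (hP : P ∈ MvPolynomial.homogeneousSubmodule (Fin 2) F n) :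
    (symSubst g).toLinearMap P ∈ MvPolynomial.homogeneousSubmodule (Fin 2) F n := by
  have hX : ∀ j : Fin 2, (∑ i : Fin 2, MvPolynomial.C (g.1 i j) *
      (MvPolynomial.X i : MvPolynomial (Fin 2) F)).IsHomogeneous 1 := fun j =>
    MvPolynomial.IsHomogeneous.sum _ _ _ fun i _ => by
      simpa using (MvPolynomial.isHomogeneous_C (Fin 2) (g.1 i j)).mul
        (MvPolynomial.isHomogeneous_X F i)
  have h := MvPolynomial.IsHomogeneous.aeval hP _ hX
  rw [one_mul] at h
  exact h

/-- `Sym^n` of the standard representation of `GL₂(F)` on `F²`, realised on the homogeneous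
polynomials of degree `n` in the basis vectors of `F²`. -/
def symRep (F : Type*) [Field F] (n : ℕ) :
    Representation F (GL (Fin 2) F) (MvPolynomial.homogeneousSubmodule (Fin 2) F n) where
  toFun g := (symSubst g).toLinearMap.restrict (symSubst_mem g)
  map_one' := by
    refine LinearMap.ext fun P => Subtype.ext ?_
    simp [symSubst_one]
  map_mul' g h := by
    refine LinearMap.ext fun P => Subtype.ext ?_
    simp [symSubst_mul]

variable {k : Type*} [Field k]

/-- The subgroup `B` of upper triangular matrices in `GL₂(k)`. -/
def borel (k : Type*) [Field k] : Subgroup (GL (Fin 2) k) where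
  carrier := {g | g.1 1 0 = 0}
  one_mem' := by simp
  mul_mem' := fun {a b} ha hb => by
    simp only [Set.mem_ofPred_eq] at ha hb ⊢
    simp [Matrix.mul_apply, Fin.sum_univ_two, ha, hb]
  inv_mem' := fun {a} ha => by
    simp only [Set.mem_ofPred_eq] at ha ⊢
    rw [Matrix.coe_units_inv, Matrix.inv_def, Matrix.adjugate_fin_two]
    simp [ha]

/-- The homomorphism from `B` to `k^×` sending a matrix to its `i`-th diagonal entry. -/
def borelDiag (i : Fin 2) : borel k →* kˣ where
  toFun g := Units.mk0 (g.1.1 i i) (by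
    have hd : g.1.1.det ≠ 0 := (Matrix.isUnit_iff_isUnit_det _).1 g.1.isUnit |>.ne_zero
    have h0 : g.1.1 1 0 = 0 := g.2
    rw [Matrix.det_fin_two, h0, mul_zero, sub_zero] at hd
    fin_cases i
    · exact left_ne_zero_of_mul hd
    · exact right_ne_zero_of_mul hd)
  map_one' := by
    ext
    simp
  map_mul' g h := by
    have hg : g.1.1 1 0 = 0 := g.2
    have hh : h.1.1 1 0 = 0 := h.2
    ext
    fin_cases i <;> simp [Matrix.mul_apply, Fin.sum_univ_two, hg, hh]

/-- The character `ψ₁ ⊗ ψ₂` of `B`, sending `(x, *; 0, y)` to `ψ₁(x) ψ₂(y)`. -/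
def borelChar (ψ₁ ψ₂ : kˣ →* Rˣ) : borel k →* Rˣ :=
  ψ₁.comp (borelDiag 0) * ψ₂.comp (borelDiag 1)

/-- The principal series `Ind_B^{GL₂(k)}(ψ₁ ⊗ ψ₂)` with coefficients in `R`: right translation on
the functions `φ : GL₂(k) → R` such that `φ(bg) = (ψ₁ ⊗ ψ₂)(b) φ(g)` for all `b ∈ B`. -/
def principalSeries (ψ₁ ψ₂ : kˣ →* Rˣ) :
    Representation R (GL (Fin 2) k)
      (Representation.coindV (borel k).subtype (charRep (borelChar ψ₁ ψ₂))) :=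
  Representation.coind (borel k).subtype (charRep (borelChar ψ₁ ψ₂))

/-- The character `ψ ∘ det` of `GL₂(k)`. -/
def detChar (ψ : kˣ →* Rˣ) : GL (Fin 2) k →* Rˣ :=
  ψ.comp Matrix.GeneralLinearGroup.det

end Representations

/-! ### Reduction modulo `p`

For a perfect field `F` of characteristic `p` the Witt vectors `W(F)` are the ring of integers of
the unramified field `W(F)[1/p]`, with residue field `F`. -/

section Reduction

variable {p : ℕ} [Fact p.Prime] {F : Type*} [Field F]

/-- `F` as the residue field of `W(F)`. -/
instance residueAlgebra : Algebra (WittVector p F) F :=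
  (WittVector.constantCoeff : WittVector p F →+* F).toAlgebra

/-- The reduction `F ⊗_{W(F)} Λ` of a representation on a `W(F)`-lattice `Λ`. -/
def reduction {G V : Type*} [Group G] [AddCommGroup V] [Module (WittVector p F) V]
    (ρ : Representation (WittVector p F) G V) :
    Representation F G (F ⊗[WittVector p F] V) where
  toFun g := (ρ g).baseChange F
  map_one' := by
    rw [map_one]
    exact LinearMap.baseChange_id
  map_mul' g h := by
    rw [map_mul]
    exact LinearMap.baseChange_comp _ _

/-- The character `∏ i, ω̃_i ^ s_i` of `k^×`, where `ω̃_i` is the Teichmüller lift of the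
embedding `σ i : k → F`. -/
def teichmullerChar {k : Type*} [Field k] {f : ℕ} [NeZero f] (p : ℕ) [Fact p.Prime]
    (σ : ZMod f → k →+* F) (s : ZMod f → ℤ) : kˣ →* (WittVector p F)ˣ :=
  ∏ i, (Units.map ((WittVector.teichmuller p).comp (σ i : k →* F))) ^ s i

end Reduction

/-! ### Serre weights -/

section Weights

variable {k F : Type*} [Field k] [Field F] {f : ℕ} [NeZero f]

/-- The representation
`μ_{m,n} = ⨂ i, (det ^ m_i ⊗ Sym ^ n_i k²) ⊗_{k, σ_i} F` of `GL₂(k)` over `F`. -/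
def mu (σ : ZMod f → k →+* F) (m : ZMod f → ℤ) (n : ZMod f → ℕ) :
    Representation F (GL (Fin 2) k)
      (PiTensorProduct F fun i => MvPolynomial.homogeneousSubmodule (Fin 2) F (n i)) :=
  piTensor fun i => MonoidHom.comp
    (twist (Matrix.GeneralLinearGroup.det ^ m i) (symRep F (n i)))
    (Matrix.GeneralLinearGroup.map (σ i))

/-- The equivalence relation `μ_{m,n} ≅ μ_{m',n'}` on pairs `(m, n)`. -/
def weightSetoid (σ : ZMod f → k →+* F) : Setoid ((ZMod f → ℤ) × (ZMod f → ℕ)) where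
  r x y := IsoRep (mu σ x.1 x.2) (mu σ y.1 y.2)
  iseqv :=
    { refl := fun _ => ⟨Representation.Equiv.refl _⟩
      symm := fun h => h.elim fun φ => ⟨φ.symm⟩
      trans := fun h h' => IsoRep.trans h h' }

/-- The isomorphism classes of the representations `μ_{m,n}`. The Serre weights are the classes
of those with `0 ≤ n_i ≤ p - 1` for all `i`. -/
def Weight (σ : ZMod f → k →+* F) : Type :=
  Quotient (weightSetoid σ)

/-- The isomorphism class of `μ_{m,n}`. -/
def Weight.mk (σ : ZMod f → k →+* F) (m : ZMod f → ℤ) (n : ZMod f → ℕ) : Weight σ :=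
  Quotient.mk (weightSetoid σ) (m, n)

/-- The pairs `(J, d)` with `0 ≤ d_i ≤ e - 1` if `i ∈ J` and `1 ≤ d_i ≤ e` if `i ∉ J`. -/
def Admissible (e : ℕ) (J : Finset (ZMod f)) (d : ZMod f → ℤ) : Prop :=
  ∀ i, (i ∈ J → 0 ≤ d i ∧ d i ≤ e - 1) ∧ (i ∉ J → 1 ≤ d i ∧ d i ≤ e)

/-- The exponents `m` of the weight `μ(J, d)`. -/
def muM (p : ℕ) (b c : ZMod f → ℤ) (J : Finset (ZMod f)) (d : ZMod f → ℤ) : ZMod f → ℤ :=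
  fun i =>
    if i ∈ J then c i + p - 1 - d i
    else if i + 1 ∈ J then c i + b i + d i - 1
    else c i + b i + d i

/-- The exponents `n` of the weight `μ(J, d)`. -/
def muN (p : ℕ) (b : ZMod f → ℤ) (J : Finset (ZMod f)) (d : ZMod f → ℤ) : ZMod f → ℤ :=
  fun i =>
    if i ∈ J then
      if i + 1 ∈ J then b i + 2 * d i else b i + 2 * d i + 1
    else
      if i + 1 ∈ J then p - b i - 2 * d i else p - 1 - b i - 2 * d i

/-- The integers `n_i` lie in `[0, p - 2]` for the pairs `(J, d)` that occur, so passing to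
natural numbers loses nothing. -/
theorem muN_mem {p e f : ℕ} {b : ZMod f → ℤ} (hb : ∀ i, (e : ℤ) ≤ b i + e ∧ b i + e ≤ p - 1 - e)
    {J : Finset (ZMod f)} {d : ZMod f → ℤ} (h : Admissible e J d) (i : ZMod f) :
    0 ≤ muN p b J d i ∧ muN p b J d i ≤ p - 2 := by
  have h1 := hb i
  have h2 := h i
  unfold muN
  split_ifs with hi hi' hi'
  · have := h2.1 hi
    omega
  · have := h2.1 hi
    omega
  · have := h2.2 hi
    omega
  · have := h2.2 hi
    omega

/-- The weight `μ(J, d)`. -/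
def muJd (σ : ZMod f → k →+* F) (p : ℕ) (b c : ZMod f → ℤ) (J : Finset (ZMod f))
    (d : ZMod f → ℤ) : Weight σ :=
  Weight.mk σ (muM p b c J d) fun i => (muN p b J d i).toNat

/-- The two exceptional cases, in which there is a second weight `μ'(J, d)`: either `b = d = 0`
and `J` is everything, or `b_i = p - 1 - 2e` and `d_i = e` for all `i` and `J` is empty. -/
def Exceptional (p e : ℕ) (b : ZMod f → ℤ) (J : Finset (ZMod f)) (d : ZMod f → ℤ) : Prop :=
  (J = Finset.univ ∧ ∀ i, b i = 0 ∧ d i = 0) ∨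
    (J = ∅ ∧ ∀ i, b i = p - 1 - 2 * e ∧ d i = e)

/-- The additional weight `μ'(J, d)` in the exceptional cases: `n_i = p - 1` for all `i`, and
`m_i = c_i` if `J` is everything, `m_i = c_i - e` if `J` is empty. -/
def muPrimeJd (σ : ZMod f → k →+* F) (p e : ℕ) (c : ZMod f → ℤ) (J : Finset (ZMod f)) :
    Weight σ :=
  Weight.mk σ (fun i => if i ∈ J then c i else c i - e) fun _ => p - 1

/-- The set `W` of the weights `μ(J, d)`. -/
def setW (σ : ZMod f → k →+* F) (p e : ℕ) (b c : ZMod f → ℤ) : Set (Weight σ) :=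
  {w | ∃ J d, Admissible e J d ∧ w = muJd σ p b c J d}

/-- The set `A` of the tuples `a` with `0 ≤ a_i ≤ e` for all `i`. -/
def setA (f e : ℕ) : Set (ZMod f → ℤ) :=
  {a | ∀ i, 0 ≤ a i ∧ a i ≤ e}

/-- `δ_a`, the number of `i` with `a_i = 0` or `a_i = e`. -/
def delta (e : ℕ) (a : ZMod f → ℤ) : ℕ :=
  (Finset.univ.filter fun i => a i = 0 ∨ a i = e).card

/-- The first character `∏ i, ω̃_i ^ (c_i + b_i + a_i)` of the type `τ_a`; characters of inertia
that factor through `k^×` are identified with characters of `k^×`. -/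
def typeChar₁ (p : ℕ) [Fact p.Prime] (σ : ZMod f → k →+* F) (b c a : ZMod f → ℤ) :
    kˣ →* (WittVector p F)ˣ :=
  teichmullerChar p σ fun i => c i + b i + a i

/-- The second character `∏ i, ω̃_i ^ (c_i - a_i)` of the type `τ_a`. -/
def typeChar₂ (p : ℕ) [Fact p.Prime] (σ : ZMod f → k →+* F) (c a : ZMod f → ℤ) :
    kˣ →* (WittVector p F)ˣ :=
  teichmullerChar p σ fun i => c i - a i

/-- `μ` is a Jordan–Hölder constituent of the reduction of `θ_a`, where `θ_a` is the principal
series of the two characters of `τ_a` if they differ, and is `ψ ∘ det` if they are both `ψ`. -/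
def IsConstituentTheta {U : Type*} [AddCommGroup U] [Module F U] (p : ℕ) [Fact p.Prime]
    (σ : ZMod f → k →+* F) (b c a : ZMod f → ℤ) (μ : Representation F (GL (Fin 2) k) U) : Prop :=
  (typeChar₁ p σ b c a ≠ typeChar₂ p σ c a ∧ IsJHConstituent μ
    (reduction (principalSeries (typeChar₁ p σ b c a) (typeChar₂ p σ c a)))) ∨
  (typeChar₁ p σ b c a = typeChar₂ p σ c a ∧ IsJHConstituent μ
    (reduction (charRep (detChar (k := k) (typeChar₁ p σ b c a)))))

/-- `μ` is a Jordan–Hölder constituent of the reduction of `θ'_a`, where `θ'_a = θ_a` if `τ_a` is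
not scalar, and `θ'_a = θ_a ⊗ Ind_B 1` if it is. -/
def IsConstituentTheta' {U : Type*} [AddCommGroup U] [Module F U] (p : ℕ) [Fact p.Prime]
    (σ : ZMod f → k →+* F) (b c a : ZMod f → ℤ) (μ : Representation F (GL (Fin 2) k) U) : Prop :=
  (typeChar₁ p σ b c a ≠ typeChar₂ p σ c a ∧ IsJHConstituent μ
    (reduction (principalSeries (typeChar₁ p σ b c a) (typeChar₂ p σ c a)))) ∨
  (typeChar₁ p σ b c a = typeChar₂ p σ c a ∧ IsJHConstituent μ
    (reduction (twist (detChar (typeChar₁ p σ b c a))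
      (principalSeries (k := k) (R := WittVector p F) 1 1))))

end Weights

/-! ### The weights predicted for a reducible local representation -/

section Predicted

variable {p : ℕ} [Fact p.Prime] {L : IntermediateField ℚ_[p] (PadicAlgCl p)} {F : Type*} [Field F]
  {f : ℕ} [NeZero f]

/-- `χ|_{I_L} = ∏ i, ω_i ^ s_i`, where `ω_i` is the fundamental character attached to the
embedding `σ i` of the residue field of `L` into `F`. -/
def EqOnInertia (σ : ZMod f → residueField L →+* F) (π : PadicAlgCl p) (χ : absGal L →* Fˣ)
    (s : ZMod f → ℤ) : Prop :=
  ∀ g ∈ inertia L, (χ g : F) = ∏ i, (σ i (tameCharacter L π g)) ^ s i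

/-- The set `W' = W_expl(ρ^ss)` of explicitly predicted Serre weights of a representation `ρ` with
semisimplification `χ₂ ⊕ χ₁`: the classes of the `μ_{m,n}` with `n_i ≤ p - 1` such that, for some
`J` and `d` as in `Admissible`, the character `χ₂` is on inertia the product of the
`ω_i ^ (m_i + n_i + e - d_i)` for `i ∈ J` and the `ω_i ^ (m_i + e - d_i)` for `i ∉ J`, and `χ₁` is
the product of the `ω_i ^ (m_i + d_i)` for `i ∈ J` and the `ω_i ^ (m_i + n_i + d_i)` for
`i ∉ J`. -/
def setW' (σ : ZMod f → residueField L →+* F) (e : ℕ) (π : PadicAlgCl p)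
    (χ₁ χ₂ : absGal L →* Fˣ) : Set (Weight σ) :=
  {w | ∃ (m : ZMod f → ℤ) (n : ZMod f → ℕ), (∀ i, n i ≤ p - 1) ∧ w = Weight.mk σ m n ∧
    ∃ (J : Finset (ZMod f)) (d : ZMod f → ℤ), Admissible e J d ∧
      EqOnInertia σ π χ₂ (fun i => if i ∈ J then m i + n i + e - d i else m i + e - d i) ∧
      EqOnInertia σ π χ₁ (fun i => if i ∈ J then m i + d i else m i + n i + d i)}

/-- `W_a`: the weights in `W'` that are constituents of the reduction of `θ_a`. -/
def setWa (σ : ZMod f → residueField L →+* F) (e : ℕ) (π : PadicAlgCl p)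
    (χ₁ χ₂ : absGal L →* Fˣ) (b c a : ZMod f → ℤ) : Set (Weight σ) :=
  {w | w ∈ setW' σ e π χ₁ χ₂ ∧ ∃ m n, w = Weight.mk σ m n ∧
    IsConstituentTheta
      (U := PiTensorProduct F fun i => MvPolynomial.homogeneousSubmodule (Fin 2) F (n i))
      p σ b c a (mu σ m n)}

/-- `W'_a`: the weights in `W'` that are constituents of the reduction of `θ'_a`. -/
def setWa' (σ : ZMod f → residueField L →+* F) (e : ℕ) (π : PadicAlgCl p)
    (χ₁ χ₂ : absGal L →* Fˣ) (b c a : ZMod f → ℤ) : Set (Weight σ) :=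
  {w | w ∈ setW' σ e π χ₁ χ₂ ∧ ∃ m n, w = Weight.mk σ m n ∧
    IsConstituentTheta'
      (U := PiTensorProduct F fun i => MvPolynomial.homogeneousSubmodule (Fin 2) F (n i))
      p σ b c a (mu σ m n)}

end Predicted

end SerreWeights

end

/-! The argument has three layers.

Arithmetic. The tame character maps inertia onto k^×, which is cyclic of order p^f - 1, and σ_{-j} =
σ_0^{p^j}. Hence ∏ ω_i^{s_i} on inertia is governed exactly by the digit sum ∑_j s_{-j} p^j modulo
p^f - 1, and every condition on χ₁ and χ₂ becomes a congruence `ExpCong`. The only distinct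
congruent points of the box [0, p-1]^f are its corners (0,…,0) and (p-1,…,p-1). The μ_{m,n} with all
n_i ≤ p - 1 are absolutely irreducible and are classified by n and by m up to congruence
(`isoRep_mu_iff`).

Representations. Put r_i = b_i + 2a_i, which lies in [0, p-1]. Each J ⊆ ℤ/f gives a candidate
constituent of θ'_a whose exponents at i depend only on r_i and on whether i and i+1 lie in J. The
sum over J of the traces of the candidates is therefore the trace of a cyclic product of 2×2
matrices. Factoring each matrix through the two eigenvalues and regrouping the factors cyclically
makes the product diagonal, and the result is the trace of the principal series. Traces with values
in F see multiplicities only modulo p, but this suffices: the candidates are pairwise non-isomorphic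
and absolutely simple, so equality of traces forces each of them to occur, and their dimensions
already add up to p^f + 1, which leaves room for nothing else (`isSubquotient_iff_of_trace_eq`).

Combinatorics. Put a_i = d_i + [i ∈ J] - [i+1 ∈ J]. Then μ(J,d) is the constituent of θ'_a indexed
by the same J, and (J,d) is admissible exactly when 0 ≤ a_i ≤ e-1 for i+1 ∈ J and 1 ≤ a_i ≤ e for
i+1 ∉ J. Thus ∑ a_i = ∑ d_i by telescoping, and for fixed a the membership of i+1 in J is free
precisely when 0 < a_i < e, which gives the count 2^(f-δ_a). Since p is odd, the weight determines
(a,J) (`typeN_typeM_injective`), whence disjointness. Finally W' exceeds W only through the corner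
ambiguity of the box; the extra weights have all n_i = p - 1 and are the Steinberg constituents of
scalar types, present in θ'_a but not in θ_a. -/

noncomputable section
namespace SerreWeights

/-! ### Constituents of modules of finite length -/

section Subquotients

universe u

variable {A : Type*} [Ring A]

/-- `S` is a quotient of a submodule of `V`. -/
def IsSubquotient (A : Type*) [Ring A] (S V : Type*) [AddCommGroup S] [Module A S]
    [AddCommGroup V] [Module A V] : Prop :=
  ∃ (M : Submodule A V) (φ : M →ₗ[A] S), Function.Surjective φ

section

variable {S V : Type*} [AddCommGroup S] [Module A S] [AddCommGroup V] [Module A V]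

theorem IsSubquotient.of_submodule {N : Submodule A V} (h : IsSubquotient A S N) :
    IsSubquotient A S V := by
  obtain ⟨M, φ, hφ⟩ := h
  refine ⟨M.map N.subtype,
    φ ∘ₗ (Submodule.equivMapOfInjective _ N.injective_subtype M).symm.toLinearMap, ?_⟩
  exact hφ.comp (Submodule.equivMapOfInjective _ N.injective_subtype M).symm.surjective

theorem IsSubquotient.of_quotient {N : Submodule A V} (h : IsSubquotient A S (V ⧸ N)) :
    IsSubquotient A S V := by
  obtain ⟨M, φ, hφ⟩ := h
  refine ⟨M.comap N.mkQ, φ ∘ₗ (N.mkQ.restrict fun x hx => hx), hφ.comp ?_⟩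
  rintro ⟨y, hy⟩
  obtain ⟨x, rfl⟩ := N.mkQ_surjective y
  exact ⟨⟨x, hy⟩, rfl⟩

/-- A map from M onto a simple module is either onto or zero on M ∩ N; in the second case it factors
through the image of M in V/N. -/
theorem IsSubquotient.submodule_or_quotient [IsSimpleModule A S] (N : Submodule A V)
    (h : IsSubquotient A S V) : IsSubquotient A S N ∨ IsSubquotient A S (V ⧸ N) := by
  obtain ⟨M, φ, hφ⟩ := h
  let j : M.comap N.subtype →ₗ[A] M := N.subtype.restrict fun x hx => hx
  rcases LinearMap.surjective_or_eq_zero (φ ∘ₗ j) with h1 | h1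
  · exact Or.inl ⟨_, _, h1⟩
  · right
    let q : M →ₗ[A] V ⧸ N := N.mkQ ∘ₗ M.subtype
    have hq : LinearMap.ker q ≤ LinearMap.ker φ := fun x hx => by
      have hx' : (x : V) ∈ N := by
        rw [LinearMap.mem_ker, LinearMap.comp_apply] at hx
        exact (Submodule.Quotient.mk_eq_zero N).1 hx
      exact LinearMap.congr_fun h1 (⟨⟨x, hx'⟩, x.2⟩ : M.comap N.subtype)
    refine ⟨LinearMap.range q,
      (LinearMap.ker q).liftQ φ hq ∘ₗ q.quotKerEquivRange.symm.toLinearMap, ?_⟩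
    intro s
    obtain ⟨x, rfl⟩ := hφ s
    refine ⟨q.quotKerEquivRange (Submodule.Quotient.mk x), ?_⟩
    rw [LinearMap.comp_apply, LinearEquiv.coe_coe, LinearEquiv.symm_apply_apply]
    rfl

theorem IsSubquotient.nonempty_equiv [IsSimpleModule A S] [IsSimpleModule A V]
    (h : IsSubquotient A S V) : Nonempty (V ≃ₗ[A] S) := by
  obtain ⟨M, φ, hφ⟩ := h
  have hS : Nontrivial S := IsSimpleModule.nontrivial A S
  rcases eq_bot_or_eq_top M with rfl | rfl
  · obtain ⟨s, hs⟩ := exists_ne (0 : S)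
    obtain ⟨x, rfl⟩ := hφ s
    rw [Subsingleton.elim x 0, map_zero] at hs
    exact absurd rfl hs
  · let ψ : V →ₗ[A] S := φ ∘ₗ Submodule.topEquiv.symm.toLinearMap
    have hψ : Function.Surjective ψ := hφ.comp (LinearEquiv.surjective _)
    rcases LinearMap.bijective_or_eq_zero ψ with h1 | h1
    · exact ⟨LinearEquiv.ofBijective ψ h1⟩
    · obtain ⟨s, hs⟩ := exists_ne (0 : S)
      obtain ⟨x, rfl⟩ := hψ s
      rw [h1] at hs
      exact absurd rfl hs

theorem IsSubquotient.of_equiv {S' V' : Type*} [AddCommGroup S'] [Module A S'] [AddCommGroup V']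
    [Module A V'] (h : IsSubquotient A S V) (e : S ≃ₗ[A] S') (e' : V ≃ₗ[A] V') :
    IsSubquotient A S' V' := by
  obtain ⟨M, φ, hφ⟩ := h
  refine ⟨M.map e'.toLinearMap, e.toLinearMap ∘ₗ φ ∘ₗ (e'.submoduleMap M).symm.toLinearMap, ?_⟩
  exact e.surjective.comp (hφ.comp (LinearEquiv.surjective _))

end

variable {F : Type*} [Field F] [Algebra F A]

/-- If T and S were not isomorphic, the projection of T ⊕ S to S would commute with all
endomorphisms. Jacobson density, applied to a finite basis of T and one nonzero vector of S, would
then give a ring element killing T but fixing that vector. -/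
theorem nonempty_equiv_of_annihilator_le {T S : Type*} [AddCommGroup T] [Module A T]
    [AddCommGroup S] [Module A S] [Module F T] [IsScalarTower F A T] [FiniteDimensional F T]
    [IsSimpleModule A T] [IsSimpleModule A S]
    (h : ∀ a : A, (∀ t : T, a • t = 0) → ∀ s : S, a • s = 0) : Nonempty (T ≃ₗ[A] S) := by
  by_contra hne
  have hTS : ∀ φ : T →ₗ[A] S, φ = 0 := fun φ =>
    (LinearMap.bijective_or_eq_zero φ).resolve_left fun hb =>
      hne ⟨LinearEquiv.ofBijective φ hb⟩
  have hST : ∀ φ : S →ₗ[A] T, φ = 0 := fun φ =>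
    (LinearMap.bijective_or_eq_zero φ).resolve_left fun hb =>
      hne ⟨(LinearEquiv.ofBijective φ hb).symm⟩
  have : IsSemisimpleModule A (T × S) := by
    have h1 : IsSemisimpleModule A
        ↥(LinearMap.range (LinearMap.inl A T S) ⊔ LinearMap.range (LinearMap.inr A T S)) :=
      IsSemisimpleModule.sup (IsSemisimpleModule.range _) (IsSemisimpleModule.range _)
    rw [LinearMap.sup_range_inl_inr] at h1
    exact IsSemisimpleModule.congr Submodule.topEquiv.symm
  -- The projection to S; it is linear over the endomorphism ring because there are no nonzero maps
  -- between T and S in either direction.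
  let f : Module.End (Module.End A (T × S)) (T × S) :=
    { toFun := fun x => (0, x.2)
      map_add' := fun x y => by simp
      map_smul' := fun φ x => by
        simp only [Module.End.smul_def, RingHom.id_apply]
        have h1 : φ x = φ (x.1, 0) + φ (0, x.2) := by
          rw [← map_add]; simp
        have h2 : (φ (x.1, 0)).2 = 0 :=
          LinearMap.congr_fun (hTS (LinearMap.snd A T S ∘ₗ φ ∘ₗ LinearMap.inl A T S)) x.1
        have h3 : (φ (0, x.2)).1 = 0 :=
          LinearMap.congr_fun (hST (LinearMap.fst A T S ∘ₗ φ ∘ₗ LinearMap.inr A T S)) x.2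
        refine Prod.ext ?_ ?_
        · exact h3.symm
        · rw [h1, Prod.snd_add, h2, zero_add] }
  have hS : Nontrivial S := IsSimpleModule.nontrivial A S
  obtain ⟨s₀, hs₀⟩ := exists_ne (0 : S)
  classical
  let b := Module.finBasis F T
  obtain ⟨a, ha⟩ := jacobson_density f
    (insert (0, s₀) (Finset.univ.image fun i => (b i, (0 : S))))
  have h1 : ∀ i, a • b i = 0 := fun i => by
    have := ha (b i, 0) (Finset.mem_insert_of_mem (Finset.mem_image_of_mem _ (Finset.mem_univ i)))
    exact (congrArg Prod.fst this).symm
  have h2 : a • s₀ = s₀ := by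
    have := ha (0, s₀) (Finset.mem_insert_self _ _)
    exact (congrArg Prod.snd this).symm
  have h3 : ∀ t : T, a • t = 0 := fun t => by
    have : Algebra.lsmul F F T a = 0 := b.ext fun i => by simpa using h1 i
    simpa using LinearMap.congr_fun this t
  exact hs₀ (by rw [← h2, h a h3])

/-- Density again: an F-endomorphism of S j, extended by zero to the product, lies in the
bicommutant, because the only endomorphisms of S j are scalars and there are no maps between
different factors. -/
theorem exists_smul_eq_endomorphism {ι : Type*} [Fintype ι] [DecidableEq ι] (S : ι → Type*)
    [∀ i, AddCommGroup (S i)] [∀ i, Module A (S i)] [∀ i, Module F (S i)]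
    [∀ i, IsScalarTower F A (S i)] [∀ i, FiniteDimensional F (S i)] [∀ i, IsSimpleModule A (S i)]
    (hS : ∀ i j, Nonempty (S i ≃ₗ[A] S j) → i = j) (j : ι)
    (hend : ∀ φ : S j →ₗ[A] S j, ∃ c : F, ∀ x, φ x = c • x) (y : S j →ₗ[F] S j) :
    ∃ a : A, (∀ x : S j, a • x = y x) ∧ ∀ i, i ≠ j → ∀ x : S i, a • x = 0 := by
  have hz : ∀ i, i ≠ j → ∀ φ : S i →ₗ[A] S j, φ = 0 := fun i hi φ =>
    (LinearMap.bijective_or_eq_zero φ).resolve_left fun hb =>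
      hi (hS i j ⟨LinearEquiv.ofBijective φ hb⟩)
  have hz' : ∀ i, i ≠ j → ∀ φ : S j →ₗ[A] S i, φ = 0 := fun i hi φ =>
    (LinearMap.bijective_or_eq_zero φ).resolve_left fun hb =>
      hi (hS j i ⟨LinearEquiv.ofBijective φ hb⟩).symm
  let f : Module.End (Module.End A (∀ i, S i)) (∀ i, S i) :=
    { toFun := fun x => Pi.single j (y (x j))
      map_add' := fun x x' => by simp [Pi.single_add]
      map_smul' := fun φ x => by
        simp only [Module.End.smul_def, RingHom.id_apply]
        obtain ⟨c, hc⟩ := hend (LinearMap.proj j ∘ₗ φ ∘ₗ LinearMap.single A S j)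
        have hc' : ∀ w : S j, φ (Pi.single j w) j = c • w := hc
        have h1 : φ x j = c • x j := by
          conv_lhs => rw [← Finset.univ_sum_single x, map_sum, Finset.sum_apply]
          rw [Finset.sum_eq_single j, hc']
          · intro i _ hi
            exact LinearMap.congr_fun (hz i hi (LinearMap.proj j ∘ₗ φ ∘ₗ LinearMap.single A S i))
              (x i)
          · simp
        rw [h1, map_smul]
        ext i
        by_cases hi : i = j
        · subst hi
          rw [Pi.single_eq_same, hc']
        · rw [Pi.single_eq_of_ne hi]
          exact (LinearMap.congr_fun
            (hz' i hi (LinearMap.proj i ∘ₗ φ ∘ₗ LinearMap.single A S j)) _).symm }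
  let b := fun i => Module.finBasis F (S i)
  classical
  obtain ⟨a, ha⟩ := jacobson_density f
    (Finset.univ.biUnion fun i => Finset.univ.image fun l => Pi.single i (b i l))
  have ha' : ∀ i l, Pi.single j (y ((Pi.single i (b i l) : ∀ i, S i) j)) =
      a • (Pi.single i (b i l) : ∀ i, S i) := fun i l =>
    ha _ (Finset.mem_biUnion.2 ⟨i, Finset.mem_univ i,
      Finset.mem_image_of_mem _ (Finset.mem_univ l)⟩)
  refine ⟨a, fun x => ?_, fun i hi x => ?_⟩
  · have : Algebra.lsmul F F (S j) a = y := (b j).ext fun l => by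
      have := congrFun (ha' j l) j
      rw [Pi.single_eq_same, Pi.single_eq_same, Pi.smul_apply, Pi.single_eq_same] at this
      exact this.symm
    exact LinearMap.congr_fun this x
  · have : Algebra.lsmul F F (S i) a = 0 := (b i).ext fun l => by
      have := congrFun (ha' i l) i
      rw [Pi.single_eq_of_ne hi, Pi.smul_apply, Pi.single_eq_same] at this
      exact this.symm
    exact LinearMap.congr_fun this x

/-- Induction on the length, with V/N simple. If Ann(V/N) annihilates S, then S ≅ V/N. Otherwise
some b in Ann(V/N) moves a vector of S, and bV ⊆ N lets the hypothesis on annihilators descend from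
V to N. -/
theorem IsFiniteLength.isSubquotient_of_annihilator_le {V : Type*} [AddCommGroup V] [Module A V]
    (hV : IsFiniteLength A V) [i1 : Module F V] [i2 : IsScalarTower F A V]
    [i3 : FiniteDimensional F V] {S : Type*} [AddCommGroup S] [Module A S] [IsSimpleModule A S]
    (h : ∀ a : A, (∀ v : V, a • v = 0) → ∀ s : S, a • s = 0) : IsSubquotient A S V := by
  revert i1 i2 i3
  induction hV with
  | @of_subsingleton V _ _ _ =>
    intro i1 i2 i3
    have hS : Nontrivial S := IsSimpleModule.nontrivial A S
    obtain ⟨s₀, hs₀⟩ := exists_ne (0 : S)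
    exact absurd (by simpa using h 1 (fun v => Subsingleton.elim _ _) s₀) hs₀
  | @of_simple_quotient V _ _ N _ _ ih =>
    intro i1 i2 i3
    have : FiniteDimensional F N :=
      inferInstanceAs (FiniteDimensional F (N.restrictScalars F))
    have : FiniteDimensional F (V ⧸ N) :=
      inferInstanceAs (FiniteDimensional F (V ⧸ N.restrictScalars F))
    by_cases hQ : ∀ b : A, (∀ v : V ⧸ N, b • v = 0) → ∀ s : S, b • s = 0
    · obtain ⟨e⟩ := nonempty_equiv_of_annihilator_le (F := F) hQ
      exact IsSubquotient.of_quotient (N := N)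
        ⟨⊤, e.toLinearMap ∘ₗ Submodule.topEquiv.toLinearMap,
          e.surjective.comp (LinearEquiv.surjective _)⟩
    · push Not at hQ
      obtain ⟨b, hb, s₀, hs₀⟩ := hQ
      refine (ih fun a ha s => ?_).of_submodule
      -- Every vector of S has the form c b s₀. The element a c b kills V, since b sends V into N, c
      -- preserves N and a kills N.
      obtain ⟨c, rfl⟩ := Submodule.mem_span_singleton.1
        ((IsSimpleModule.span_singleton_eq_top A hs₀).ge (Submodule.mem_top : s ∈ ⊤))
      rw [← mul_smul, ← mul_smul]
      refine h _ (fun v => ?_) s₀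
      have hv : b • v ∈ N := (Submodule.Quotient.mk_eq_zero N).1 (hb (Submodule.Quotient.mk v))
      rw [mul_assoc, mul_smul, mul_smul]
      exact congrArg Subtype.val (ha (c • ⟨b • v, hv⟩))

/-- Each simple layer V/N accounts for at most one of the pairwise non-isomorphic S i, so their
dimensions fit into that of V. The second half records that a further simple subquotient T needs a
layer of its own. -/
theorem IsFiniteLength.sum_finrank_le {V : Type*} [AddCommGroup V] [Module A V]
    (hV : IsFiniteLength A V) [i1 : Module F V] [i2 : IsScalarTower F A V]
    [i3 : FiniteDimensional F V] {ι : Type*} (S : ι → Type*)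
    [∀ i, AddCommGroup (S i)] [∀ i, Module A (S i)] [∀ i, Module F (S i)]
    [∀ i, IsScalarTower F A (S i)] [∀ i, IsSimpleModule A (S i)] (s : Finset ι)
    (hS : ∀ i ∈ s, ∀ j ∈ s, Nonempty (S i ≃ₗ[A] S j) → i = j)
    (h : ∀ i ∈ s, IsSubquotient A (S i) V) :
    ∑ i ∈ s, Module.finrank F (S i) ≤ Module.finrank F V ∧
      ∀ (T : Type*) [AddCommGroup T] [Module A T] [IsSimpleModule A T], IsSubquotient A T V →
        (∀ i ∈ s, IsEmpty (S i ≃ₗ[A] T)) →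
        ∑ i ∈ s, Module.finrank F (S i) < Module.finrank F V := by
  classical
  revert i1 i2 i3
  induction hV generalizing s with
  | @of_subsingleton V _ _ _ =>
    intro i1 i2 i3
    have hno : ∀ (T : Type _) [AddCommGroup T] [Module A T] [IsSimpleModule A T],
        ¬ IsSubquotient A T V := by
      rintro T _ _ _ ⟨M, φ, hφ⟩
      have := IsSimpleModule.nontrivial A T
      exact absurd hφ.subsingleton (not_subsingleton _)
    refine ⟨?_, fun T _ _ _ ⟨M, φ, hφ⟩ => ?_⟩
    · rcases Finset.eq_empty_or_nonempty s with hs | ⟨i, hi⟩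
      · simp [hs]
      · exact absurd (h i hi) (hno _)
    · have := IsSimpleModule.nontrivial A T
      exact absurd hφ.subsingleton (not_subsingleton _)
  | @of_simple_quotient V _ _ N _ _ ih =>
    intro i1 i2 i3
    have : FiniteDimensional F N :=
      inferInstanceAs (FiniteDimensional F (N.restrictScalars F))
    have : FiniteDimensional F (V ⧸ N) :=
      inferInstanceAs (FiniteDimensional F (V ⧸ N.restrictScalars F))
    have hdim : Module.finrank F (V ⧸ N) + Module.finrank F N = Module.finrank F V :=
      Submodule.finrank_quotient_add_finrank (N.restrictScalars F)
    have hpos : 0 < Module.finrank F (V ⧸ N) := by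
      have := IsSimpleModule.nontrivial A (V ⧸ N)
      exact Module.finrank_pos
    by_cases hi : ∃ i ∈ s, IsSubquotient A (S i) (V ⧸ N)
    · obtain ⟨i, hi, hiQ⟩ := hi
      obtain ⟨e⟩ := hiQ.nonempty_equiv
      have hei : Module.finrank F (S i) = Module.finrank F (V ⧸ N) :=
        (e.restrictScalars F).finrank_eq.symm
      have h1 := ih (s.erase i)
        (fun i hi j hj => hS i (Finset.mem_of_mem_erase hi) j (Finset.mem_of_mem_erase hj))
        (fun j hj => ((h j (Finset.mem_of_mem_erase hj)).submodule_or_quotient N).resolve_right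
          fun hjQ => by
            obtain ⟨e'⟩ := hjQ.nonempty_equiv
            exact Finset.ne_of_mem_erase hj
              (hS j (Finset.mem_of_mem_erase hj) i hi ⟨e'.symm.trans e⟩))
      rw [← Finset.add_sum_erase _ _ hi, hei, ← hdim]
      refine ⟨by omega, fun T _ _ _ hT hne => ?_⟩
      have h2 := h1.2 T ((hT.submodule_or_quotient N).resolve_right fun hTQ => by
          obtain ⟨e'⟩ := hTQ.nonempty_equiv
          exact (hne i hi).false (e.symm.trans e'))
        fun j hj => hne j (Finset.mem_of_mem_erase hj)
      omega
    · push Not at hi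
      have h1 := ih s hS fun j hj => ((h j hj).submodule_or_quotient N).resolve_right (hi j hj)
      exact ⟨by omega, fun _ _ _ _ _ _ => by omega⟩

/-- If the trace function and the dimension of `V` are the sums of those of pairwise
non-isomorphic absolutely simple modules `S i`, then the `S i` are the constituents of `V`. -/
theorem isSubquotient_iff_of_trace_eq {V : Type u} [AddCommGroup V] [Module A V]
    [Module F V] [IsScalarTower F A V] [FiniteDimensional F V]
    {ι : Type} [Fintype ι] (S : ι → Type u)
    [∀ i, AddCommGroup (S i)] [∀ i, Module A (S i)] [∀ i, Module F (S i)]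
    [∀ i, IsScalarTower F A (S i)] [∀ i, FiniteDimensional F (S i)] [∀ i, IsSimpleModule A (S i)]
    (hS : ∀ i j, Nonempty (S i ≃ₗ[A] S j) → i = j)
    (hend : ∀ i, ∀ φ : S i →ₗ[A] S i, ∃ c : F, ∀ x, φ x = c • x)
    (htr : ∀ a : A, LinearMap.trace F V (Algebra.lsmul F F V a) =
      ∑ i, LinearMap.trace F (S i) (Algebra.lsmul F F (S i) a))
    (hdim : Module.finrank F V = ∑ i, Module.finrank F (S i))
    (T : Type u) [AddCommGroup T] [Module A T] [IsSimpleModule A T] :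
    IsSubquotient A T V ↔ ∃ i, Nonempty (S i ≃ₗ[A] T) := by
  classical
  have hV : IsFiniteLength A V := isFiniteLength_iff_isNoetherian_isArtinian.2
    ⟨isNoetherian_of_tower F inferInstance, isArtinian_of_tower F inferInstance⟩
  have hmem : ∀ i, IsSubquotient A (S i) V := fun i => by
    refine IsFiniteLength.isSubquotient_of_annihilator_le (F := F) hV fun a ha w => ?_
    rw [← Module.forall_dual_apply_eq_zero_iff F]
    intro ℓ
    -- Here b acts on S i as the rank-one map x ↦ ℓ(x) w and on the other S j as zero. If a kills V,
    -- the trace of ab on V is zero, but by hypothesis it equals ℓ(a w). As ℓ is arbitrary, a kills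
    -- S i.
    obtain ⟨b, hb, hb'⟩ := exists_smul_eq_endomorphism S hS i (hend i) (ℓ.smulRight w)
    have h1 : LinearMap.trace F V (Algebra.lsmul F F V (a * b)) = 0 := by
      have : Algebra.lsmul F F V (a * b) = 0 := LinearMap.ext fun v => by
        simp [ha]
      rw [this, map_zero]
    rw [htr, Finset.sum_eq_single i] at h1
    · have h2 : Algebra.lsmul F F (S i) (a * b) = ℓ.smulRight (a • w) :=
        LinearMap.ext fun x => by
          simp [hb]
      rwa [h2, LinearMap.trace_smulRight] at h1
    · intro j _ hj
      have : Algebra.lsmul F F (S j) (a * b) = 0 := LinearMap.ext fun v => by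
        simp [hb' j hj]
      rw [this, map_zero]
    · simp
  constructor
  · intro hT
    by_contra hne
    push Not at hne
    -- A constituent outside the list would make the sum of dimensions strictly smaller than dim V.
    exact ((IsFiniteLength.sum_finrank_le (F := F) hV S Finset.univ (fun i _ j _ => hS i j)
      fun i _ => hmem i).2 T hT fun i _ => hne i).ne' hdim
  · rintro ⟨i, ⟨e⟩⟩
    exact (hmem i).of_equiv e (LinearEquiv.refl A V)

end Subquotients

end SerreWeights
end

noncomputable section
namespace SerreWeights

/-! ### Jordan–Hölder constituents of representations -/

section Constituents

universe u

variable {F G : Type*} [Field F] [Group G]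

theorem isJHConstituent_iff {U W : Type*} [AddCommGroup U] [Module F U] [AddCommGroup W]
    [Module F W] (σ : Representation F G U) (ρ : Representation F G W) :
    IsJHConstituent σ ρ ↔
      σ.IsIrreducible ∧ IsSubquotient (MonoidAlgebra F G) σ.asModule ρ.asModule := by
  refine and_congr_right fun _ => ⟨?_, ?_⟩
  · rintro ⟨N, M, -, ⟨e⟩⟩
    exact ⟨M, e.toLinearMap ∘ₗ (N.submoduleOf M).mkQ,
      e.surjective.comp (Submodule.mkQ_surjective _)⟩
  · rintro ⟨M, φ, hφ⟩
    refine ⟨(LinearMap.ker φ).map M.subtype, M, Submodule.map_subtype_le _ _, ⟨?_⟩⟩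
    exact (Submodule.quotEquivOfEq _ _
      (Submodule.comap_map_eq_of_injective M.injective_subtype _)).trans
        (φ.quotKerEquivOfSurjective hφ)

theorem isoRep_iff {U W : Type*} [AddCommGroup U] [Module F U] [AddCommGroup W]
    [Module F W] (σ : Representation F G U) (ρ : Representation F G W) :
    IsoRep σ ρ ↔ Nonempty (σ.asModule ≃ₗ[MonoidAlgebra F G] ρ.asModule) := by
  constructor
  · rintro ⟨φ⟩
    exact ⟨LinearEquiv.ofBijective
      (Representation.IntertwiningMap.equivLinearMapAsModule σ ρ φ.toIntertwiningMap)
      φ.toLinearEquiv.bijective⟩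
  · rintro ⟨e⟩
    exact ⟨Representation.IntertwiningMap.ofBijective
      ((Representation.IntertwiningMap.equivLinearMapAsModule σ ρ).symm e.toLinearMap)
      e.bijective⟩

/-- If the trace function and the dimension of `ρ` are the sums of those of pairwise
non-isomorphic absolutely irreducible representations `τ i`, then the `τ i` are the constituents
of `ρ`. -/
theorem isJHConstituent_iff_of_trace_eq {V : Type u} [AddCommGroup V] [Module F V]
    [FiniteDimensional F V] (ρ : Representation F G V) {ι : Type} [Fintype ι] {S : ι → Type u}
    [∀ i, AddCommGroup (S i)] [∀ i, Module F (S i)] [∀ i, FiniteDimensional F (S i)]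
    (τ : ∀ i, Representation F G (S i)) (hτ : ∀ i, (τ i).IsIrreducible)
    (hne : ∀ i j, IsoRep (τ i) (τ j) → i = j)
    (hend : ∀ i, ∀ φ : S i →ₗ[F] S i, (∀ g x, φ (τ i g x) = τ i g (φ x)) →
      ∃ c : F, ∀ x, φ x = c • x)
    (htr : ∀ g, LinearMap.trace F V (ρ g) = ∑ i, LinearMap.trace F (S i) (τ i g))
    (hdim : Module.finrank F V = ∑ i, Module.finrank F (S i))
    {T : Type u} [AddCommGroup T] [Module F T] (σ : Representation F G T) :
    IsJHConstituent σ ρ ↔ ∃ i, IsoRep (τ i) σ := by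
  have hs : ∀ i, IsSimpleModule (MonoidAlgebra F G) (τ i).asModule := fun i =>
    (Representation.irreducible_iff_isSimpleModule_asModule _).1 (hτ i)
  have hkey : ∀ (T : Type u) [AddCommGroup T] [Module F T] (σ : Representation F G T),
      σ.IsIrreducible → (IsSubquotient (MonoidAlgebra F G) σ.asModule ρ.asModule ↔
        ∃ i, IsoRep (τ i) σ) := fun T _ _ σ hσ => by
    have := (Representation.irreducible_iff_isSimpleModule_asModule _).1 hσ
    simp only [isoRep_iff]
    refine isSubquotient_iff_of_trace_eq (F := F) (V := ρ.asModule) (fun i => (τ i).asModule)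
      (fun i j h => hne i j ((isoRep_iff _ _).2 h)) (fun i φ => ?_) (fun a => ?_) ?_ _
    · refine hend i (φ.restrictScalars F) fun g x => ?_
      have h1 : ∀ y : (τ i).asModule, MonoidAlgebra.single g (1 : F) • y = τ i g y := fun y =>
        (Representation.single_smul (τ i) 1 g y).trans (one_smul F _)
      exact (congrArg φ (h1 x).symm).trans ((φ.map_smul _ _).trans (h1 _))
    -- Both sides are linear in the element of the group algebra, so equality on group elements is
    -- enough.
    · induction a using MonoidAlgebra.induction_linear with
      | zero => simp
      | add a b ha hb => simp only [map_add, ha, hb, Finset.sum_add_distrib]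
      | single g r =>
        have h1 : ∀ (U : Type u) [AddCommGroup U] [Module F U] (ρ : Representation F G U),
            LinearMap.trace F ρ.asModule (Algebra.lsmul F F ρ.asModule (MonoidAlgebra.single g r)) =
              r * LinearMap.trace F U (ρ g) := fun U _ _ ρ => by
          rw [← smul_eq_mul, ← map_smul]
          congr 1
          refine LinearMap.ext fun x => ?_
          exact Representation.single_smul ρ r g x
        rw [h1 V ρ, htr, Finset.mul_sum]
        exact Finset.sum_congr rfl fun i _ => (h1 _ (τ i)).symm
    · exact hdim
  rw [isJHConstituent_iff]
  constructor
  · rintro ⟨h1, h2⟩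
    exact (hkey T σ h1).1 h2
  · rintro ⟨i, hi⟩
    have h1 : σ.IsIrreducible := by
      obtain ⟨e⟩ := (isoRep_iff _ _).1 hi
      exact (Representation.irreducible_iff_isSimpleModule_asModule _).2
        (IsSimpleModule.congr e.symm)
    exact ⟨h1, (hkey T σ h1).2 ⟨i, hi⟩⟩

end Constituents

end SerreWeights
end

noncomputable section
namespace SerreWeights

/-! ### The monomial basis and the trace of the symmetric powers -/

section SymmetricPowers

open MvPolynomial

variable (F : Type*) [Field F] (n : ℕ)

/-- The exponent of the monomial `X 0 ^ (n - i) * X 1 ^ i`. -/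
def symExponent (n i : ℕ) : Fin 2 →₀ ℕ := Finsupp.equivFunOnFinite.symm ![n - i, i]

theorem monomial_symExponent (i : ℕ) :
    (monomial (symExponent n i) 1 : MvPolynomial (Fin 2) F) = X 0 ^ (n - i) * X 1 ^ i := by
  rw [monomial_eq, Finsupp.prod_fintype _ _ (by simp)]
  simp [symExponent]

theorem monomial_symExponent_mem {i : ℕ} (hi : i ≤ n) :
    (X 0 ^ (n - i) * X 1 ^ i : MvPolynomial (Fin 2) F) ∈ homogeneousSubmodule (Fin 2) F n := by
  have := ((isHomogeneous_X F (0 : Fin 2)).pow (n - i)).mul ((isHomogeneous_X F (1 : Fin 2)).pow i)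
  rw [mem_homogeneousSubmodule]
  convert this using 1
  omega

theorem symExponent_injective {n i j : ℕ} (h : symExponent n i = symExponent n j) : i = j := by
  simpa [symExponent] using DFunLike.congr_fun h 1

theorem eq_symExponent {n : ℕ} {d : Fin 2 →₀ ℕ} (hd : d.degree = n) : d = symExponent n (d 1) := by
  rw [Finsupp.degree_eq_sum, Fin.sum_univ_two] at hd
  ext i
  fin_cases i
  · simp [symExponent]; omega
  · simp [symExponent]

/-- The basis `X 0 ^ (n - i) * X 1 ^ i` of the homogeneous polynomials of degree `n`. -/
def symBasis : Module.Basis (Fin (n + 1)) F (homogeneousSubmodule (Fin 2) F n) :=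
  Module.Basis.ofEquivFun
    { toFun := fun P i => coeff (symExponent n i) P.1
      map_add' := fun P Q => by ext; simp
      map_smul' := fun c P => by ext; simp
      invFun := fun c => ∑ i, c i • ⟨X 0 ^ (n - i.1) * X 1 ^ i.1,
        monomial_symExponent_mem F n (Nat.lt_succ_iff.1 i.2)⟩
      left_inv := fun P => by
        refine Subtype.ext (MvPolynomial.ext _ _ fun d => ?_)
        simp only [AddSubmonoidClass.coe_finsetSum, Submodule.coe_smul, ← monomial_symExponent,
          coeff_sum, coeff_smul, coeff_monomial, smul_eq_mul, mul_ite, mul_one, mul_zero]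
        by_cases hd : d.degree = n
        · have h1 : d 1 < n + 1 := by
            rw [Finsupp.degree_eq_sum, Fin.sum_univ_two] at hd
            omega
          rw [Finset.sum_eq_single ⟨d 1, h1⟩]
          · rw [if_pos (eq_symExponent hd).symm, ← eq_symExponent hd]
          · intro i _ hi
            rw [if_neg]
            intro h
            refine hi (Fin.ext ?_)
            simp [← h, symExponent]
          · simp
        · rw [IsHomogeneous.coeff_eq_zero ((mem_homogeneousSubmodule _ _).1 P.2) hd]
          refine Finset.sum_eq_zero fun i _ => ?_
          rw [if_neg]
          rintro rfl
          refine hd ?_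
          rw [Finsupp.degree_eq_sum, Fin.sum_univ_two]
          have := i.2
          simp [symExponent]
          omega
      right_inv := fun c => by
        ext j
        simp only [AddSubmonoidClass.coe_finsetSum, Submodule.coe_smul, ← monomial_symExponent,
          coeff_sum, coeff_smul, coeff_monomial, smul_eq_mul, mul_ite, mul_one, mul_zero]
        rw [Finset.sum_eq_single j]
        · simp
        · intro i _ hi
          rw [if_neg]
          exact fun h => hi (Fin.ext (symExponent_injective h))
        · simp }

theorem coe_symBasis (i : Fin (n + 1)) :
    (symBasis F n i : MvPolynomial (Fin 2) F) = X 0 ^ (n - i.1) * X 1 ^ i.1 := by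
  rw [symBasis, Module.Basis.coe_ofEquivFun]
  simp [Pi.single_apply]

/-- Dehomogenisation `X 0 ↦ 1`, `X 1 ↦ X`. -/
def dehomogenize : MvPolynomial (Fin 2) F →ₐ[F] Polynomial F :=
  aeval ![1, Polynomial.X]

/-- Turns coordinates in the monomial basis into coefficients of one-variable polynomials, where
matrix entries of `symRep` can be read off from products of powers of linear polynomials. -/
theorem symBasis_repr (P : homogeneousSubmodule (Fin 2) F n) (j : Fin (n + 1)) :
    (symBasis F n).repr P j = (dehomogenize F P.1).coeff j := by
  have : (symBasis F n).coord j =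
      Polynomial.lcoeff F j ∘ₗ (dehomogenize F).toLinearMap ∘ₗ Submodule.subtype _ :=
    (symBasis F n).ext fun i => by
      simp [coe_symBasis, dehomogenize, Polynomial.coeff_X_pow, Finsupp.single_apply, Fin.ext_iff,
        eq_comm]
  exact LinearMap.congr_fun this P

variable {F}

theorem symRep_coe (g : GL (Fin 2) F) (P : homogeneousSubmodule (Fin 2) F n) :
    (symRep F n g P : MvPolynomial (Fin 2) F) = symSubst g P.1 := rfl

theorem dehomogenize_symRep (g : GL (Fin 2) F) (i : Fin (n + 1)) :
    dehomogenize F (symRep F n g (symBasis F n i)).1 =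
      (Polynomial.C (g.1 0 0) + Polynomial.C (g.1 1 0) * Polynomial.X) ^ (n - i.1) *
        (Polynomial.C (g.1 0 1) + Polynomial.C (g.1 1 1) * Polynomial.X) ^ i.1 := by
  rw [symRep_coe, coe_symBasis]
  simp [symSubst, dehomogenize, Fin.sum_univ_two]

/-- The trace of the action of a matrix on `Sym ^ n`. -/
def symTrace (n : ℕ) (g : Matrix (Fin 2) (Fin 2) F) : F :=
  ∑ i : Fin (n + 1), ((Polynomial.C (g 0 0) + Polynomial.C (g 1 0) * Polynomial.X) ^ (n - i.1) *
    (Polynomial.C (g 0 1) + Polynomial.C (g 1 1) * Polynomial.X) ^ i.1).coeff i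

theorem trace_eq_sum_repr {R ι V : Type*} [CommRing R] [Fintype ι] [AddCommMonoid V] [Module R V]
    (b : Module.Basis ι R V) (φ : V →ₗ[R] V) :
    LinearMap.trace R V φ = ∑ i, b.repr (φ (b i)) i := by
  classical
  rw [LinearMap.trace_eq_matrix_trace R b, Matrix.trace]
  simp [LinearMap.toMatrix_apply]

theorem trace_symRep (g : GL (Fin 2) F) :
    LinearMap.trace F _ (symRep F n g) = symTrace n g.1 := by
  rw [trace_eq_sum_repr (symBasis F n)]
  simp only [symBasis_repr, dehomogenize_symRep, symTrace]

theorem map_symTrace {K : Type*} [Field K] (φ : F →+* K) (g : Matrix (Fin 2) (Fin 2) F) :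
    φ (symTrace n g) = symTrace n (g.map φ) := by
  simp only [symTrace, map_sum, Matrix.map_apply]
  refine Finset.sum_congr rfl fun i _ => ?_
  rw [← Polynomial.coeff_map]
  simp [Polynomial.map_mul]

/-- A matrix whose eigenvalues lie in the field is conjugate to a triangular one. -/
theorem exists_conj_upperTriangular (g : GL (Fin 2) F) {α β : F} (htr : g.1.trace = α + β)
    (hdet : g.1.det = α * β) : ∃ (P : GL (Fin 2) F) (u : F), (P⁻¹ * g * P).1 = !![α, u; 0, β] := by
  have hd0 : g.1.det ≠ 0 := ((Matrix.isUnit_iff_isUnit_det _).1 g.isUnit).ne_zero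
  have hα : α ≠ 0 := by
    rintro rfl
    exact hd0 (by rw [hdet, zero_mul])
  obtain ⟨v, hv, hgv⟩ := (Matrix.exists_mulVec_eq_zero_iff (M := g.1 - Matrix.scalar _ α)).2 (by
    rw [Matrix.trace_fin_two] at htr
    rw [Matrix.det_fin_two] at hdet ⊢
    simp
    linear_combination hdet - α * htr)
  have hgv' : g.1.mulVec v = α • v := by
    rw [Matrix.sub_mulVec, sub_eq_zero] at hgv
    rw [hgv]
    ext i
    fin_cases i <;> simp [Matrix.mulVec, dotProduct, Matrix.diagonal_apply]
  -- An invertible matrix with the eigenvector v as first column; the second column depends on which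
  -- coordinate of v is nonzero.
  obtain ⟨P, hP⟩ : ∃ P : GL (Fin 2) F, ∀ i, P.1 i 0 = v i := by
    by_cases h0 : v 0 = 0
    · have h1 : v 1 ≠ 0 := fun h1 => hv (by ext i; fin_cases i <;> simp [h0, h1])
      exact ⟨Matrix.GeneralLinearGroup.mkOfDetNeZero !![0, 1; v 1, 0] (by simpa using h1),
        fun i => by fin_cases i <;> simp [Matrix.GeneralLinearGroup.mkOfDetNeZero, h0]⟩
    · exact ⟨Matrix.GeneralLinearGroup.mkOfDetNeZero !![v 0, 0; v 1, 1] (by simpa using h0),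
        fun i => by fin_cases i <;> simp [Matrix.GeneralLinearGroup.mkOfDetNeZero]⟩
  set U := P⁻¹ * g * P with hU
  have hPv : P.1.mulVec (Pi.single 0 1) = v := by
    ext i
    rw [Matrix.mulVec_single_one]
    exact hP i
  have hcol : U.1.mulVec (Pi.single 0 1) = Pi.single 0 α := by
    rw [hU, Units.val_mul, Units.val_mul, ← Matrix.mulVec_mulVec, ← Matrix.mulVec_mulVec, hPv,
      hgv', Matrix.mulVec_smul, ← hPv, Matrix.mulVec_mulVec, ← Units.val_mul, inv_mul_cancel,
      Units.val_one, Matrix.one_mulVec]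
    ext i
    fin_cases i <;> simp
  rw [Matrix.mulVec_single_one] at hcol
  have h00 : U.1 0 0 = α := by simpa using congrFun hcol 0
  have h10 : U.1 1 0 = 0 := by simpa using congrFun hcol 1
  have hUdet : U.1.det = α * β := by
    have h2 : P⁻¹.1.det * P.1.det = 1 := by
      rw [← Matrix.det_mul, ← Units.val_mul, inv_mul_cancel, Units.val_one, Matrix.det_one]
    rw [hU, Units.val_mul, Units.val_mul, Matrix.det_mul, Matrix.det_mul, hdet]
    linear_combination α * β * h2
  have h11 : U.1 1 1 = β := by
    rw [Matrix.det_fin_two, h00, h10, mul_zero, sub_zero] at hUdet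
    exact mul_left_cancel₀ hα hUdet
  refine ⟨P, U.1 0 1, ?_⟩
  rw [← hU, Matrix.eta_fin_two U.1, h00, h10, h11]
  rfl

/-- The trace is invariant under conjugation, and a triangular matrix acts triangularly on the
monomials, with diagonal entries α^(n-i) β^i. -/
theorem symTrace_eq (g : GL (Fin 2) F) {α β : F} (htr : g.1.trace = α + β)
    (hdet : g.1.det = α * β) :
    symTrace n g.1 = ∑ i ∈ Finset.range (n + 1), α ^ (n - i) * β ^ i := by
  obtain ⟨P, u, hU⟩ := exists_conj_upperTriangular g htr hdet
  have h1 : symTrace n (P⁻¹ * g * P).1 = symTrace n g.1 := by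
    rw [← trace_symRep, ← trace_symRep, map_mul, LinearMap.trace_mul_comm, ← map_mul,
      mul_inv_cancel_left]
  rw [← h1, hU, symTrace, Finset.sum_range]
  refine Finset.sum_congr rfl fun i _ => ?_
  simp only [Matrix.of_apply, Matrix.cons_val', Matrix.cons_val_zero, Matrix.cons_val_one,
    Matrix.cons_val_fin_one, Matrix.empty_val', map_zero, zero_mul, add_zero]
  rw [← map_pow, Polynomial.coeff_C_mul]
  congr 1
  have h2 : (Polynomial.C u + Polynomial.C β * Polynomial.X) ^ i.1 =
      (Polynomial.C β * Polynomial.X + Polynomial.C u) ^ i.1 := by rw [add_comm]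
  by_cases hβ : β = 0
  · exfalso
    rw [hβ, mul_zero] at hdet
    exact ((Matrix.isUnit_iff_isUnit_det _).1 g.isUnit).ne_zero hdet
  · have hdeg : (Polynomial.C β * Polynomial.X + Polynomial.C u).natDegree = 1 :=
      Polynomial.natDegree_linear hβ
    have := Polynomial.coeff_pow_mul_natDegree (Polynomial.C β * Polynomial.X + Polynomial.C u) i.1
    rw [hdeg, mul_one, Polynomial.leadingCoeff_linear hβ] at this
    rw [h2, this]

end SymmetricPowers

end SerreWeights
end

noncomputable section
namespace SerreWeights

/-! ### Characters of the multiplicative group and base `p` expansions -/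

section Digits

variable {f : ℕ} [NeZero f]

/-- The indexing of the embeddings for which `j` corresponds to `σ 0 ^ (p ^ j)`. -/
def embIndex (f : ℕ) [NeZero f] : Fin f ≃ ZMod f :=
  Equiv.ofBijective (fun j => -((j : ℕ) : ZMod f)) (by
    refine (Fintype.bijective_iff_injective_and_card _).2 ⟨fun i j h => ?_, by simp⟩
    have h1 : ((i : ℕ) : ZMod f) = ((j : ℕ) : ZMod f) := neg_injective h
    rw [ZMod.natCast_eq_natCast_iff', Nat.mod_eq_of_lt i.2, Nat.mod_eq_of_lt j.2] at h1
    exact Fin.ext h1)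

theorem embIndex_apply (j : Fin f) : embIndex f j = -((j : ℕ) : ZMod f) := rfl

/-- The integer `∑ j, s (-j) * p ^ j`, so that `∏ i, σ i ^ s i = σ 0 ^ digitSum p s`. -/
def digitSum (p : ℕ) (s : ZMod f → ℤ) : ℤ := ∑ j : Fin f, s (embIndex f j) * (p : ℤ) ^ (j : ℕ)

/-- The version of `digitSum` for natural numbers. -/
def natDigitSum (p : ℕ) (s : ZMod f → ℕ) : ℕ := ∑ j : Fin f, s (embIndex f j) * p ^ (j : ℕ)

theorem digitSum_natCast (p : ℕ) (s : ZMod f → ℕ) :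
    digitSum p (fun i => (s i : ℤ)) = natDigitSum p s := by
  simp [digitSum, natDigitSum]

theorem digitSum_add (p : ℕ) (s t : ZMod f → ℤ) :
    digitSum p (fun i => s i + t i) = digitSum p s + digitSum p t := by
  simp [digitSum, add_mul, Finset.sum_add_distrib]

theorem digitSum_sub (p : ℕ) (s t : ZMod f → ℤ) :
    digitSum p (fun i => s i - t i) = digitSum p s - digitSum p t := by
  simp [digitSum, sub_mul, Finset.sum_sub_distrib]

theorem digitSum_mul_left (p : ℕ) (c : ℤ) (s : ZMod f → ℤ) :
    digitSum p (fun i => c * s i) = c * digitSum p s := by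
  simp only [digitSum, Finset.mul_sum, mul_assoc]

/-- Shifting the index multiplies by p, except that the top digit, at index -(f-1) = 1, wraps round
to the units place. -/
theorem digitSum_shift (p : ℕ) (s : ZMod f → ℤ) :
    digitSum p (fun i => s (i + 1)) = p * digitSum p s - ((p : ℤ) ^ f - 1) * s 1 := by
  obtain ⟨g, rfl⟩ : ∃ g, f = g + 1 := ⟨f - 1, (Nat.sub_add_cancel (NeZero.one_le)).symm⟩
  unfold digitSum
  rw [Fin.sum_univ_succ, Fin.sum_univ_castSucc (fun j : Fin (g + 1) => s (embIndex (g + 1) j) * _)]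
  have h0 : embIndex (g + 1) 0 + 1 = 1 := by simp [embIndex_apply]
  have h1 : embIndex (g + 1) (Fin.last g) = 1 := by
    have : ((g + 1 : ℕ) : ZMod (g + 1)) = 0 := ZMod.natCast_self _
    rw [embIndex_apply, Fin.val_last, neg_eq_iff_add_eq_zero]
    exact_mod_cast this
  have h2 : ∀ j : Fin g, embIndex (g + 1) j.succ + 1 = embIndex (g + 1) j.castSucc := fun j => by
    rw [embIndex_apply, embIndex_apply, Fin.val_succ, Fin.val_castSucc]
    push_cast
    ring
  simp only [h0, h1, h2, Fin.val_zero, Fin.val_succ, Fin.val_castSucc, Fin.val_last]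
  rw [mul_add, Finset.mul_sum]
  have : ∀ j : Fin g, s (embIndex (g + 1) j.castSucc) * (p : ℤ) ^ ((j : ℕ) + 1) =
      p * (s (embIndex (g + 1) j.castSucc) * (p : ℤ) ^ (j : ℕ)) := fun j => by ring
  simp only [this]
  ring

theorem natDigitSum_eq {p : ℕ} (s : ZMod f → Fin p) :
    natDigitSum p (fun i => s i) = finFunctionFinEquiv (fun j => s (embIndex f j)) := by
  rw [finFunctionFinEquiv_apply]
  rfl

theorem natDigitSum_lt {p : ℕ} {s : ZMod f → ℕ} (hs : ∀ i, s i < p) :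
    natDigitSum p s < p ^ f := by
  rw [natDigitSum_eq fun i => ⟨s i, hs i⟩]
  exact Fin.is_lt _

theorem natDigitSum_injOn {p : ℕ} {s t : ZMod f → ℕ} (hs : ∀ i, s i < p) (ht : ∀ i, t i < p)
    (h : natDigitSum p s = natDigitSum p t) : s = t := by
  rw [natDigitSum_eq fun i => ⟨s i, hs i⟩, natDigitSum_eq fun i => ⟨t i, ht i⟩] at h
  have := finFunctionFinEquiv.injective (Fin.ext h)
  ext i
  simpa using congrFun this ((embIndex f).symm i)

theorem natDigitSum_const (p : ℕ) (hp : 0 < p) :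
    natDigitSum p (fun _ : ZMod f => p - 1) = p ^ f - 1 := by
  unfold natDigitSum
  rw [← Finset.mul_sum, Finset.sum_range (fun i => p ^ i) |>.symm, mul_comm]
  have h := geom_sum_mul_add (p - 1) f
  rw [Nat.sub_add_cancel (show 1 ≤ p from hp)] at h
  omega

end Digits

section Characters

variable {p : ℕ} [Fact p.Prime] {f : ℕ} [NeZero f] {k F : Type*} [Field k] [Field F]
  {σ : ZMod f → k →+* F} (hσ : ∀ i x, σ (i + 1) x ^ p = σ i x)

include hσ

theorem embedding_embIndex (j : Fin f) (x : k) : σ (embIndex f j) x = σ 0 x ^ p ^ (j : ℕ) := by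
  have : ∀ l : ℕ, σ (-(l : ZMod f)) x = σ 0 x ^ p ^ l := fun l => by
    induction l with
    | zero => simp
    | succ l ih =>
      rw [← hσ, pow_succ, pow_mul, ← ih]
      congr 3
      push_cast
      ring
  exact this j

theorem prod_embedding_pow (s : ZMod f → ℕ) (x : k) :
    ∏ i, σ i x ^ s i = σ 0 x ^ natDigitSum p s := by
  rw [← (embIndex f).prod_comp, natDigitSum, ← Finset.prod_pow_eq_pow_sum]
  refine Finset.prod_congr rfl fun j _ => ?_
  rw [embedding_embIndex hσ, ← pow_mul, mul_comm]

theorem prod_embedding_zpow (s : ZMod f → ℤ) {x : k} (hx : x ≠ 0) :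
    ∏ i, σ i x ^ s i = σ 0 x ^ digitSum p s := by
  have hx' : σ 0 x ≠ 0 := (map_ne_zero _).2 hx
  have hsum : ∀ (S : Finset (Fin f)) (t : Fin f → ℤ),
      σ 0 x ^ (∑ j ∈ S, t j) = ∏ j ∈ S, σ 0 x ^ t j := fun S t => by
    classical
    induction S using Finset.induction_on with
    | empty => simp
    | insert j S hj ih => rw [Finset.sum_insert hj, Finset.prod_insert hj, zpow_add₀ hx', ih]
  rw [← (embIndex f).prod_comp, digitSum, hsum]
  refine Finset.prod_congr rfl fun j _ => ?_
  rw [embedding_embIndex hσ, ← zpow_natCast, ← zpow_mul, mul_comm]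
  push_cast
  rfl

/-- Two products of powers of the embeddings agree on `k^×` if and only if the exponents agree
modulo `p ^ f - 1`. -/
theorem prod_embedding_eq_iff (hk : Nat.card k = p ^ f) (s t : ZMod f → ℤ) :
    (∀ x : k, x ≠ 0 → ∏ i, σ i x ^ s i = ∏ i, σ i x ^ t i) ↔
      (p : ℤ) ^ f - 1 ∣ digitSum p s - digitSum p t := by
  have hp : p.Prime := Fact.out
  have hfin : Finite k := Nat.finite_of_card_ne_zero (by rw [hk]; exact pow_ne_zero _ hp.ne_zero)
  have hcard : Nat.card kˣ = p ^ f - 1 := by rw [Nat.card_units, hk]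
  have hcast : ((p ^ f - 1 : ℕ) : ℤ) = (p : ℤ) ^ f - 1 := by
    rw [Nat.cast_sub (Nat.one_le_pow _ _ hp.pos)]
    push_cast
    rfl
  constructor
  · intro h
    obtain ⟨g, hg⟩ := IsCyclic.exists_generator (α := kˣ)
    have h1 := h g g.ne_zero
    rw [prod_embedding_zpow hσ _ g.ne_zero, prod_embedding_zpow hσ _ g.ne_zero, ← map_zpow₀,
      ← map_zpow₀] at h1
    have h2 : g ^ digitSum p s = g ^ digitSum p t := Units.ext (by
      push_cast
      exact (σ 0).injective h1)
    rw [zpow_eq_zpow_iff_modEq, orderOf_eq_card_of_forall_mem_zpowers hg, hcard, hcast] at h2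
    exact h2.symm.dvd
  · intro h x hx
    rw [prod_embedding_zpow hσ _ hx, prod_embedding_zpow hσ _ hx, ← map_zpow₀, ← map_zpow₀]
    congr 1
    have h2 : (Units.mk0 x hx) ^ digitSum p s = (Units.mk0 x hx) ^ digitSum p t := by
      rw [zpow_eq_zpow_iff_modEq]
      refine Int.ModEq.symm ((Int.modEq_iff_dvd).2 (dvd_trans ?_ h))
      rw [← hcast, ← hcard]
      exact Int.natCast_dvd_natCast.2 (orderOf_dvd_natCard _)
    simpa using congrArg Units.val h2

/-- The functions `∏ i, σ i ^ e i` with `0 ≤ e i ≤ p - 1` on `k` are linearly independent. -/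
theorem eq_zero_of_sum_prod_embedding_eq_zero (hk : Nat.card k = p ^ f) {ι : Type*} [Fintype ι]
    (e : ι → ZMod f → ℕ) (he : ∀ a i, e a i < p) (hinj : Function.Injective e) (c : ι → F)
    (h : ∀ x : k, ∑ a, c a * ∏ i, σ i x ^ e a i = 0) (a : ι) : c a = 0 := by
  classical
  have hp : p.Prime := Fact.out
  have hfin : Finite k := Nat.finite_of_card_ne_zero (by rw [hk]; exact pow_ne_zero _ hp.ne_zero)
  have : Fintype k := Fintype.ofFinite k
  simp only [prod_embedding_pow hσ] at h
  -- The given function of x is the value at σ 0 x of a polynomial of degree below p^f, and it has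
  -- p^f zeros. Uniqueness of base p expansions keeps its monomials apart.
  let Q : Polynomial F := ∑ a, Polynomial.C (c a) * Polynomial.X ^ natDigitSum p (e a)
  have hQ : Q = 0 := by
    refine Polynomial.eq_zero_of_degree_lt_of_eval_finset_eq_zero (Finset.univ.image (σ 0)) ?_ ?_
    · rw [Finset.card_image_of_injective _ (σ 0).injective, Finset.card_univ,
        ← Nat.card_eq_fintype_card, hk]
      refine (Polynomial.degree_sum_le _ _).trans_lt ?_
      rw [Finset.sup_lt_iff (WithBot.bot_lt_coe _)]
      exact fun a _ => (Polynomial.degree_C_mul_X_pow_le _ _).trans_lt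
        (WithBot.coe_lt_coe.2 (natDigitSum_lt (he a)))
    · intro y hy
      obtain ⟨x, -, rfl⟩ := Finset.mem_image.1 hy
      simpa [Q, Polynomial.eval_finsetSum] using h x
  have h1 : Q.coeff (natDigitSum p (e a)) = c a := by
    simp only [Q, Polynomial.finsetSum_coeff, Polynomial.coeff_C_mul, Polynomial.coeff_X_pow]
    rw [Finset.sum_eq_single a]
    · simp
    · intro b _ hb
      rw [if_neg, mul_zero]
      exact fun h => hb (hinj (natDigitSum_injOn (he b) (he a) h.symm))
    · simp
  rw [← h1, hQ, Polynomial.coeff_zero]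

end Characters

end SerreWeights
end

noncomputable section
namespace SerreWeights

/-! ### The representations `μ_{m,n}` -/

section Mu

theorem dvd_natCard_submodule {F V : Type*} [Field F] [Finite F] [AddCommGroup V] [Module F V]
    [FiniteDimensional F V] (p : ℕ) [CharP F p] (W : Submodule F V) (hW : W ≠ ⊥) :
    p ∣ Nat.card W := by
  have : Nontrivial W := Submodule.nontrivial_iff_ne_bot.2 hW
  have h1 : Nat.card W = Nat.card F ^ Module.finrank F W := Module.natCard_eq_pow_finrank
  rw [h1]
  refine dvd_pow ?_ Module.finrank_pos.ne'
  have : Fintype F := Fintype.ofFinite F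
  rw [Nat.card_eq_fintype_card]
  obtain ⟨r, -, hr⟩ := FiniteField.card F p
  rw [hr]
  exact dvd_pow_self _ r.ne_zero

/-- The underlying space of `μ_{m,n}`. -/
abbrev MuSpace (F : Type*) [Field F] {f : ℕ} (n : ZMod f → ℕ) : Type _ :=
  PiTensorProduct F fun i => MvPolynomial.homogeneousSubmodule (Fin 2) F (n i)

variable {k F : Type*} [Field k] [Field F] {f : ℕ} [NeZero f] (σ : ZMod f → k →+* F)
  (m : ZMod f → ℤ) (n : ZMod f → ℕ)

/-- The basis of monomials of `μ_{m,n}`. -/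
def muBasis (F : Type*) [Field F] (n : ZMod f → ℕ) :
    Module.Basis (∀ i, Fin (n i + 1)) F (MuSpace F n) :=
  Basis.piTensorProduct fun i => symBasis F (n i)

theorem mu_tprod (g : GL (Fin 2) k)
    (x : ∀ i, MvPolynomial.homogeneousSubmodule (Fin 2) F (n i)) :
    mu σ m n g (PiTensorProduct.tprod F x) = PiTensorProduct.tprod F fun i =>
      (σ i g.1.det) ^ m i •
        symRep F (n i) (Matrix.GeneralLinearGroup.map (σ i) g) (x i) := by
  refine (PiTensorProduct.map_tprod _ _).trans ?_
  congr 1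
  funext i
  change (((Matrix.GeneralLinearGroup.det ^ m i) (Matrix.GeneralLinearGroup.map (σ i) g) : Fˣ) : F) •
    symRep F (n i) (Matrix.GeneralLinearGroup.map (σ i) g) (x i) = _
  rw [MonoidHom.zpow_apply, Matrix.GeneralLinearGroup.map_det]
  congr 1
  simp

/-- The coefficients of the action of a matrix on the monomial basis of `Sym ^ n`. -/
def symCoeff (n : ℕ) (g : Matrix (Fin 2) (Fin 2) F) (a b : ℕ) : F :=
  ((Polynomial.C (g 0 0) + Polynomial.C (g 1 0) * Polynomial.X) ^ (n - a) *
    (Polynomial.C (g 0 1) + Polynomial.C (g 1 1) * Polynomial.X) ^ a).coeff b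

theorem symTrace_eq_sum_symCoeff (n : ℕ) (g : Matrix (Fin 2) (Fin 2) F) :
    symTrace n g = ∑ a : Fin (n + 1), symCoeff n g a a := rfl

theorem muBasis_repr_mu (g : GL (Fin 2) k) (a b : ∀ i, Fin (n i + 1)) :
    (muBasis F n).repr (mu σ m n g (muBasis F n a)) b =
      ∏ i, (σ i g.1.det) ^ m i * symCoeff (n i) (g.1.map (σ i)) (a i) (b i) := by
  rw [muBasis, Basis.piTensorProduct_apply, mu_tprod, Basis.piTensorProduct_repr_tprod_apply]
  refine Finset.prod_congr rfl fun i _ => ?_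
  rw [map_smul, Finsupp.smul_apply, smul_eq_mul, symBasis_repr, dehomogenize_symRep]
  rfl

theorem trace_mu (g : GL (Fin 2) k) :
    LinearMap.trace F _ (mu σ m n g) =
      ∏ i, (σ i g.1.det) ^ m i * symTrace (n i) (g.1.map (σ i)) := by
  rw [trace_eq_sum_repr (muBasis F n)]
  simp only [muBasis_repr_mu, symTrace_eq_sum_symCoeff, Finset.mul_sum]
  rw [Finset.prod_univ_sum, Fintype.piFinset_univ]

instance finiteDimensional_mu : FiniteDimensional F (MuSpace F n) :=
  Module.Basis.finiteDimensional_of_finite (muBasis F n)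

theorem finrank_mu : Module.finrank F (MuSpace F n) = ∏ i, (n i + 1) := by
  rw [Module.finrank_eq_card_basis (muBasis F n)]
  simp

theorem mu_congr {m m' : ZMod f → ℤ}
    (h : ∀ x : k, x ≠ 0 → ∏ i, σ i x ^ m i = ∏ i, σ i x ^ m' i) : mu σ m n = mu σ m' n := by
  ext1 g
  refine (muBasis F n).ext fun a => (muBasis F n).ext_elem fun b => ?_
  rw [muBasis_repr_mu, muBasis_repr_mu, Finset.prod_mul_distrib, Finset.prod_mul_distrib, h]
  exact ((Matrix.isUnit_iff_isUnit_det _).1 g.isUnit).ne_zero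

/-- The unipotent upper triangular matrices. -/
def upperUnipotent (t : k) : GL (Fin 2) k :=
  Matrix.GeneralLinearGroup.mkOfDetNeZero !![1, t; 0, 1] (by simp)

/-- The unipotent lower triangular matrices. -/
def lowerUnipotent (t : k) : GL (Fin 2) k :=
  Matrix.GeneralLinearGroup.mkOfDetNeZero !![1, 0; t, 1] (by simp)

theorem coe_upperUnipotent (t : k) : (upperUnipotent t).1 = !![1, t; 0, 1] := rfl

theorem coe_lowerUnipotent (t : k) : (lowerUnipotent t).1 = !![1, 0; t, 1] := rfl

theorem upperUnipotent_add (s t : k) :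
    upperUnipotent (s + t) = upperUnipotent s * upperUnipotent t := by
  refine Units.ext ?_
  rw [Units.val_mul, coe_upperUnipotent, coe_upperUnipotent, coe_upperUnipotent]
  simp [add_comm]

theorem upperUnipotent_zero : upperUnipotent (0 : k) = 1 := by
  refine Units.ext ?_
  rw [coe_upperUnipotent, Units.val_one, Matrix.one_fin_two]

/-- The substitution sends X 1 to t X 0 + X 1 at each place. As a varies, the resulting functions of
t are those of `eq_zero_of_sum_prod_embedding_eq_zero`. -/
theorem repr_mu_upperUnipotent (t : k) (a : ∀ i, Fin (n i + 1)) :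
    (muBasis F n).repr (mu σ m n (upperUnipotent t) (muBasis F n a)) 0 =
      ∏ i, σ i t ^ (a i : ℕ) := by
  rw [muBasis_repr_mu]
  refine Finset.prod_congr rfl fun i _ => ?_
  simp [coe_upperUnipotent, symCoeff, Polynomial.coeff_zero_eq_eval_zero]

/-- The substitution sends X 0 to X 0 + t X 1 and fixes X 1, so the binomial theorem gives the
coordinates of the image of the highest weight vector. -/
theorem repr_mu_lowerUnipotent (t : k) (b : ∀ i, Fin (n i + 1)) :
    (muBasis F n).repr (mu σ m n (lowerUnipotent t) (muBasis F n 0)) b =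
      (∏ i, ((n i).choose (b i) : F)) * ∏ i, σ i t ^ (b i : ℕ) := by
  rw [muBasis_repr_mu, ← Finset.prod_mul_distrib]
  refine Finset.prod_congr rfl fun i _ => ?_
  simp only [coe_lowerUnipotent, symCoeff, Matrix.det_fin_two_of, Matrix.map_apply, Matrix.of_apply,
    Matrix.cons_val', Matrix.cons_val_zero, Matrix.cons_val_one, Matrix.cons_val_fin_one,
    Pi.zero_apply, Fin.val_zero, pow_zero, mul_one, Nat.sub_zero, zero_mul, sub_zero, map_one,
    one_zpow, one_mul]
  rw [add_comm, ← mul_one (Polynomial.C (σ i t) * Polynomial.X + 1) ]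
  have h1 : (Polynomial.C (σ i t) * Polynomial.X + 1 : Polynomial F) ^ n i =
      ((1 + Polynomial.X) ^ n i : Polynomial F).comp (Polynomial.C (σ i t) * Polynomial.X) := by
    simp [add_comm]
  rw [mul_one, h1, Polynomial.comp_C_mul_X_coeff, Polynomial.coeff_one_add_X_pow]

/-- Triangular matrices act on the highest weight vector by a character. -/
theorem mu_upperTriangular (g : GL (Fin 2) k) (hg : g.1 1 0 = 0) :
    mu σ m n g (muBasis F n 0) =
      (∏ i, σ i g.1.det ^ m i * σ i (g.1 0 0) ^ n i) • muBasis F n 0 := by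
  classical
  refine (muBasis F n).ext_elem fun b => ?_
  rw [muBasis_repr_mu, map_smul, Finsupp.smul_apply, Module.Basis.repr_self,
    Finsupp.single_apply, smul_eq_mul]
  simp only [symCoeff, Matrix.map_apply, Pi.zero_apply, Fin.val_zero, pow_zero, mul_one,
    Nat.sub_zero, zero_mul, map_zero, add_zero, hg]
  split_ifs with hb
  · subst hb
    rw [mul_one]
    refine Finset.prod_congr rfl fun i _ => ?_
    rw [← Polynomial.C_pow]
    exact congrArg _ (Polynomial.coeff_C_zero)
  · obtain ⟨i, hi⟩ : ∃ i, b i ≠ 0 := by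
      by_contra! h
      exact hb (funext fun i => (h i).symm)
    rw [mul_zero]
    refine Finset.prod_eq_zero (Finset.mem_univ i) ?_
    rw [← Polynomial.C_pow, Polynomial.coeff_C, if_neg, mul_zero]
    exact fun h => hi (Fin.ext h)

theorem mu_upperUnipotent (t : k) :
    mu σ m n (upperUnipotent t) (muBasis F n 0) = muBasis F n 0 := by
  rw [mu_upperTriangular _ _ _ _ (by simp [coe_upperUnipotent])]
  simp [coe_upperUnipotent]

variable {p : ℕ} [Fact p.Prime] {σ} (hσ : ∀ i x, σ (i + 1) x ^ p = σ i x)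
  (hk : Nat.card k = p ^ f) {n} (hn : ∀ i, n i ≤ p - 1)

include hσ hk hn

/-- The vectors invariant under the upper unipotent subgroup are multiples of the highest weight
vector. -/
theorem eq_smul_of_upperUnipotent_fixed
    {v : MuSpace F n}
    (hv : ∀ t : k, mu σ m n (upperUnipotent t) v = v) :
    v = (muBasis F n).repr v 0 • muBasis F n 0 := by
  classical
  have hp : p.Prime := Fact.out
  have hp1 := hp.one_lt
  have h1 : ∀ t : k, ∑ a, (muBasis F n).repr v a * ∏ i, σ i t ^ (a i : ℕ) =
      (muBasis F n).repr v 0 := fun t => by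
    have h2 : (muBasis F n).repr (mu σ m n (upperUnipotent t)
        (∑ a, (muBasis F n).repr v a • muBasis F n a)) 0 = (muBasis F n).repr v 0 := by
      rw [(muBasis F n).sum_repr, hv]
    rw [← h2, map_sum, map_sum, Finsupp.coe_finsetSum, Finset.sum_apply]
    refine Finset.sum_congr rfl fun a _ => ?_
    rw [map_smul, map_smul, Finsupp.smul_apply, smul_eq_mul, repr_mu_upperUnipotent]
  -- The highest weight coordinate of u(t) v is constant in t. Subtracting that constant from the
  -- coefficient at a = 0 gives a vanishing combination of independent functions, so the coordinates
  -- of v at a ≠ 0 are zero.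
  have h2 := eq_zero_of_sum_prod_embedding_eq_zero hσ hk
    (fun (a : ∀ i, Fin (n i + 1)) i => (a i : ℕ))
    (fun a i => by have := (a i).2; have := hn i; omega)
    (fun a b h => funext fun i => Fin.ext (congrFun h i))
    (fun a => (muBasis F n).repr v a - if a = 0 then (muBasis F n).repr v 0 else 0)
    (fun t => by
      simp only [sub_mul, Finset.sum_sub_distrib, h1, ite_mul, zero_mul, Finset.sum_ite_eq',
        Finset.mem_univ, if_true]
      simp)
  refine (muBasis F n).ext_elem fun a => ?_
  have := h2 a
  rw [map_smul, Finsupp.smul_apply, Module.Basis.repr_self, Finsupp.single_apply]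
  by_cases ha : a = 0
  · simp [ha]
  · rw [if_neg ha, sub_zero] at this
    rw [this, if_neg (Ne.symm ha), smul_zero]

/-- The highest weight vector generates the representation. -/
theorem eq_top_of_muBasis_zero_mem
    (W : Submodule F (MuSpace F n))
    (hW : ∀ g, ∀ v ∈ W, mu σ m n g v ∈ W) (h0 : muBasis F n 0 ∈ W) : W = ⊤ := by
  have hp : p.Prime := Fact.out
  have hp1 := hp.one_lt
  have : CharP k p := by
    have hfin : Finite k := Nat.finite_of_card_ne_zero (by rw [hk]; exact pow_ne_zero _ hp.ne_zero)
    have : Fintype k := Fintype.ofFinite k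
    refine charP_of_card_eq_prime_pow (f := f) ?_
    rw [← Nat.card_eq_fintype_card, hk]
  have : CharP F p := charP_of_injective_ringHom (σ 0).injective p
  by_contra hne
  -- A linear form ℓ vanishing on W vanishes on the orbit of the highest weight vector under the
  -- lower unipotent group. Independence gives ∏ binom(n_i, b_i) · ℓ(e_b) = 0, and these binomial
  -- coefficients are nonzero in F because n_i < p.
  obtain ⟨ℓ, hℓ, hℓW⟩ := Submodule.exists_le_ker_of_lt_top (V := MuSpace F n) W (lt_top_iff_ne_top.2 hne)
  refine hℓ ((muBasis F n).ext fun b => ?_)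
  have h2 := eq_zero_of_sum_prod_embedding_eq_zero hσ hk
    (fun (a : ∀ i, Fin (n i + 1)) i => (a i : ℕ))
    (fun a i => by have := (a i).2; have := hn i; omega)
    (fun a b h => funext fun i => Fin.ext (congrFun h i))
    (fun a => (∏ i, ((n i).choose (a i) : F)) * ℓ (muBasis F n a))
    (fun t => by
      have h3 : ℓ (mu σ m n (lowerUnipotent t) (muBasis F n 0)) = 0 := hℓW (hW _ _ h0)
      rw [← (muBasis F n).sum_repr (mu σ m n (lowerUnipotent t) (muBasis F n 0)), map_sum] at h3
      rw [← h3]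
      refine Finset.sum_congr rfl fun a _ => ?_
      rw [map_smul, repr_mu_lowerUnipotent, smul_eq_mul]
      ring) b
  rw [LinearMap.zero_apply]
  refine (mul_eq_zero.1 h2).resolve_left (Finset.prod_ne_zero_iff.2 fun i _ => ?_)
  rw [Ne, CharP.cast_eq_zero_iff F p]
  have h4 := (b i).2
  have h5 := hn i
  intro hd
  have h6 : p ∣ (n i).factorial := by
    rw [← Nat.choose_mul_factorial_mul_factorial (Nat.lt_succ_iff.1 h4), mul_assoc]
    exact dvd_mul_of_dvd_left hd _
  have := (hp.dvd_factorial).1 h6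
  omega

/-- The upper unipotent group is a p-group, so it fixes a nonzero vector in any nonzero
subrepresentation, a finite set of order divisible by p. That vector is a multiple of the highest
weight vector, which generates everything. -/
theorem mu_isIrreducible [Finite F] :
    Representation.IsIrreducible (V := MuSpace F n) (mu σ m n) := by
  have hp : p.Prime := Fact.out
  have hfin : Finite k := Nat.finite_of_card_ne_zero (by rw [hk]; exact pow_ne_zero _ hp.ne_zero)
  have : CharP k p := by
    have : Fintype k := Fintype.ofFinite k
    refine charP_of_card_eq_prime_pow (f := f) ?_
    rw [← Nat.card_eq_fintype_card, hk]
  have : CharP F p := charP_of_injective_ringHom (σ 0).injective p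
  have key : ∀ W : Subrepresentation (mu σ m n), W.toSubmodule = ⊥ ∨ W.toSubmodule = ⊤ := by
    intro W
    refine or_iff_not_imp_left.2 fun hW => ?_
    let act : MulAction (Multiplicative k) W.toSubmodule :=
      { smul := fun t v => ⟨mu σ m n (upperUnipotent t.toAdd) v, W.apply_mem_toSubmodule _ v.2⟩
        one_smul := fun v => Subtype.ext (by
          change mu σ m n (upperUnipotent 0) v.1 = v.1
          rw [upperUnipotent_zero, map_one]
          rfl)
        mul_smul := fun s t v => Subtype.ext (by
          change mu σ m n (upperUnipotent (s.toAdd + t.toAdd)) v.1 =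
            mu σ m n (upperUnipotent s.toAdd) (mu σ m n (upperUnipotent t.toAdd) v.1)
          rw [upperUnipotent_add, map_mul]
          rfl) }
    have hG : IsPGroup p (Multiplicative k) := IsPGroup.of_card (n := f) (by
      rw [Nat.card_congr Multiplicative.toAdd, hk])
    have : Finite W.toSubmodule := by
      have : Finite (MuSpace F n) := Module.finite_of_finite F
      infer_instance
    have hcard : p ∣ Nat.card W.toSubmodule :=
      dvd_natCard_submodule (V := MuSpace F n) p W.toSubmodule hW
    obtain ⟨v, hv, hv0⟩ := hG.exists_fixed_point_of_prime_dvd_card_of_fixed_point W.toSubmodule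
      hcard (a := 0) (fun t => Subtype.ext (map_zero (mu σ m n (upperUnipotent t.toAdd))))
    have h1 := eq_smul_of_upperUnipotent_fixed m hσ hk hn (v := v.1) fun t =>
      congrArg Subtype.val (hv (Multiplicative.ofAdd t))
    refine eq_top_of_muBasis_zero_mem m hσ hk hn _ (fun g v hv => W.apply_mem_toSubmodule g hv) ?_
    have hc : (muBasis F n).repr v.1 0 ≠ 0 := fun hc => by
      rw [hc, zero_smul] at h1
      exact hv0 (Subtype.ext h1.symm)
    rw [← Submodule.smul_mem_iff _ hc, ← h1]
    exact v.2
  have hnt : Nontrivial (Subrepresentation (mu σ m n)) := by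
    refine ⟨⊥, ⊤, fun h => ?_⟩
    have h1 : muBasis F n 0 ∈ (⊤ : Subrepresentation (mu σ m n)) := Submodule.mem_top
    rw [← h] at h1
    exact (muBasis F n).ne_zero 0 ((Submodule.mem_bot F).1 h1)
  exact
    { toNontrivial := hnt
      eq_bot_or_eq_top := fun W => (key W).imp
        (fun h => Subrepresentation.toSubmodule_injective h)
        (fun h => Subrepresentation.toSubmodule_injective h) }

/-- An endomorphism maps the highest weight vector to a vector fixed by the upper unipotent group,
hence to a multiple of itself, and this vector generates. -/
theorem mu_exists_eq_smul
    (φ : MuSpace F n →ₗ[F] MuSpace F n)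
    (hφ : ∀ g x, φ (mu σ m n g x) = mu σ m n g (φ x)) : ∃ c : F, ∀ x, φ x = c • x := by
  have h1 := eq_smul_of_upperUnipotent_fixed m hσ hk hn (v := φ (muBasis F n 0)) fun t => by
    rw [← hφ, mu_upperUnipotent]
  set c := (muBasis F n).repr (φ (muBasis F n 0)) 0
  refine ⟨c, fun x => ?_⟩
  have h2 := eq_top_of_muBasis_zero_mem m hσ hk hn (LinearMap.eqLocus φ (c • LinearMap.id))
    (fun g v hv => by
      rw [LinearMap.mem_eqLocus] at hv ⊢
      rw [hφ, hv]
      simp)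
    (by
      rw [LinearMap.mem_eqLocus]
      exact h1)
  exact (h2.ge (Submodule.mem_top : x ∈ ⊤) :)

/-- The exponents `n` and the character `∏ i, σ i ^ m i` are determined by the isomorphism class
of `μ_{m,n}`. -/
theorem isoRep_mu_iff {m m' : ZMod f → ℤ} {n' : ZMod f → ℕ} (hn' : ∀ i, n' i ≤ p - 1) :
    IsoRep (mu σ m n) (mu σ m' n') ↔
      n = n' ∧ ∀ x : k, x ≠ 0 → ∏ i, σ i x ^ m i = ∏ i, σ i x ^ m' i := by
  have hp : p.Prime := Fact.out
  have hp1 := hp.one_lt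
  constructor
  swap
  · rintro ⟨rfl, h⟩
    rw [mu_congr σ n h]
    exact ⟨Representation.Equiv.refl _⟩
  rintro ⟨φ⟩
  have hφ : ∀ g x, φ.toLinearEquiv (mu σ m n g x) = mu σ m' n' g (φ.toLinearEquiv x) :=
    fun g x => LinearMap.congr_fun (φ.isIntertwining' g) x
  have h1 := eq_smul_of_upperUnipotent_fixed m' hσ hk hn' (v := φ.toLinearEquiv (muBasis F n 0))
    fun t => by rw [← hφ, mu_upperUnipotent]
  set c := (muBasis F n').repr (φ.toLinearEquiv (muBasis F n 0)) 0
  have hc : c ≠ 0 := fun hc => by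
    rw [hc, zero_smul] at h1
    exact (muBasis F n).ne_zero 0 (φ.toLinearEquiv.map_eq_zero_iff.1 h1)
  -- The isomorphism matches the highest weight lines, so the Borel subgroup acts on them by the
  -- same character. Diagonal matrices then separate m from n.
  have h2 : ∀ g : GL (Fin 2) k, g.1 1 0 = 0 →
      ∏ i, σ i g.1.det ^ m i * σ i (g.1 0 0) ^ n i =
        ∏ i, σ i g.1.det ^ m' i * σ i (g.1 0 0) ^ n' i := fun g hg => by
    have h3 := hφ g (muBasis F n 0)
    rw [mu_upperTriangular _ _ _ _ hg, map_smul, h1, map_smul, mu_upperTriangular _ _ _ _ hg,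
      smul_smul, smul_smul, mul_comm] at h3
    have h4 := congrArg (fun v => (muBasis F n').repr v 0) h3
    simp only [map_smul, Module.Basis.repr_self, Finsupp.smul_apply, Finsupp.single_eq_same,
      smul_eq_mul, mul_one] at h4
    exact mul_left_cancel₀ hc h4
  have h2' : ∀ s t : k, s ≠ 0 → t ≠ 0 → ∏ i, σ i (s * t) ^ m i * σ i s ^ n i =
      ∏ i, σ i (s * t) ^ m' i * σ i s ^ n' i := fun s t hs ht => by
    have h3 := h2 (Matrix.GeneralLinearGroup.mkOfDetNeZero !![s, 0; 0, t] (by simp [hs, ht])) rfl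
    change ∏ i, σ i (!![s, 0; 0, t]).det ^ m i * σ i s ^ n i =
      ∏ i, σ i (!![s, 0; 0, t]).det ^ m' i * σ i s ^ n' i at h3
    rwa [Matrix.det_fin_two_of, mul_zero, sub_zero] at h3
  have hm : ∀ x : k, x ≠ 0 → ∏ i, σ i x ^ m i = ∏ i, σ i x ^ m' i := fun x hx => by
    simpa using h2' 1 x one_ne_zero hx
  refine ⟨?_, hm⟩
  have hn2 : ∀ x : k, x ≠ 0 → ∏ i, σ i x ^ (n i : ℤ) = ∏ i, σ i x ^ (n' i : ℤ) := fun x hx => by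
    have h3 := h2' x 1 hx one_ne_zero
    rw [Finset.prod_mul_distrib, Finset.prod_mul_distrib, mul_one, hm x hx] at h3
    simpa using mul_left_cancel₀ (Finset.prod_ne_zero_iff.2 fun i _ =>
      zpow_ne_zero _ ((map_ne_zero _).2 hx)) h3
  rw [prod_embedding_eq_iff hσ hk, digitSum_natCast, digitSum_natCast] at hn2
  have hdim := φ.toLinearEquiv.finrank_eq
  rw [finrank_mu, finrank_mu] at hdim
  have hlt : ∀ i, n i < p := fun i => by have := hn i; omega
  have hlt' : ∀ i, n' i < p := fun i => by have := hn' i; omega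
  have hb := natDigitSum_lt hlt
  have hb' := natDigitSum_lt hlt'
  have hq : p ≤ p ^ f := Nat.le_self_pow (NeZero.ne f) p
  have hcast : ((p ^ f - 1 : ℕ) : ℤ) = (p : ℤ) ^ f - 1 := by
    rw [Nat.cast_sub (by omega)]
    push_cast
    rfl
  rw [← hcast] at hn2
  have hz : natDigitSum p (fun _ : ZMod f => 0) = 0 := by simp [natDigitSum]
  -- The torus determines n only modulo p^f - 1. The remaining ambiguity is n = 0 against all n_i =
  -- p - 1, and there the dimensions are 1 and p^f.
  have hone : ∀ n n' : ZMod f → ℕ, (∀ i, n i < p) → (∀ i, n' i < p) → natDigitSum p n = 0 →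
      natDigitSum p n' = p ^ f - 1 → ∏ i, (n i + 1) ≠ ∏ i, (n' i + 1) := by
    intro n n' hn hn' h h' he
    have h3 : n = fun _ => 0 := natDigitSum_injOn hn (fun _ => hp.pos) (h.trans hz.symm)
    have h4 : n' = fun _ => p - 1 := natDigitSum_injOn hn' (fun _ => by omega)
      (h'.trans (natDigitSum_const p hp.pos).symm)
    rw [h3, h4] at he
    simp only [zero_add, Finset.prod_const_one, Finset.prod_const, Finset.card_univ, ZMod.card,
      Nat.sub_add_cancel hp.one_le] at he
    omega
  obtain ⟨z, hz'⟩ := hn2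
  have hz1 : z = 0 ∨ z = 1 ∨ z = -1 := by
    have h5 : (0 : ℤ) < ((p ^ f - 1 : ℕ) : ℤ) := by omega
    have h6 : z < 2 := by by_contra! h; nlinarith
    have h7 : -2 < z := by by_contra! h; nlinarith
    omega
  rcases hz1 with rfl | rfl | rfl
  · exact natDigitSum_injOn hlt hlt' (by omega)
  · exact absurd hdim.symm (hone n' n hlt' hlt (by omega) (by omega))
  · exact absurd hdim (hone n n' hlt hlt' (by omega) (by omega))

end Mu

end SerreWeights
end

noncomputable section
namespace SerreWeights

/-! ### The principal series and the trace of its reduction -/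

section PrincipalSeries

variable {R k : Type*} [CommRing R] [Field k] (ψ₁ ψ₂ : kˣ →* Rˣ)

theorem borel_entries_ne_zero (b : borel k) : b.1.1 0 0 ≠ 0 ∧ b.1.1 1 1 ≠ 0 :=
  ⟨(borelDiag 0 b).ne_zero, (borelDiag 1 b).ne_zero⟩

theorem charRep_borelChar (b : borel k) (r : R) :
    charRep (borelChar ψ₁ ψ₂) b r =
      MulChar.ofUnitHom ψ₁ (b.1.1 0 0) * MulChar.ofUnitHom ψ₂ (b.1.1 1 1) * r := by
  have h0 : b.1.1 0 0 = (borelDiag 0 b : kˣ) := rfl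
  have h1 : b.1.1 1 1 = (borelDiag 1 b : kˣ) := rfl
  rw [h0, h1, MulChar.ofUnitHom_coe, MulChar.ofUnitHom_coe]
  rfl

/-- Representatives of `B \ GL₂(k)`, i.e. of the projective line. -/
def cosetRep : Option k → GL (Fin 2) k
  | none => 1
  | some y => Matrix.GeneralLinearGroup.mkOfDetNeZero !![0, 1; 1, y] (by simp)

theorem coe_cosetRep_some (y : k) : (cosetRep (some y)).1 = !![0, 1; 1, y] := rfl

open Classical in
/-- The extension of a function on the coset representatives to an element of the principal
series. -/
def principalExtend (c : Option k → R) (g : GL (Fin 2) k) : R :=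
  if g.1 1 0 = 0 then
    MulChar.ofUnitHom ψ₁ (g.1 0 0) * MulChar.ofUnitHom ψ₂ (g.1 1 1) * c none
  else
    MulChar.ofUnitHom ψ₁ (-g.1.det / g.1 1 0) * MulChar.ofUnitHom ψ₂ (g.1 1 0) *
      c (some (g.1 1 1 / g.1 1 0))

theorem principalExtend_mul (c : Option k → R) (b : borel k) (g : GL (Fin 2) k) :
    principalExtend ψ₁ ψ₂ c (b.1 * g) =
      MulChar.ofUnitHom ψ₁ (b.1.1 0 0) * MulChar.ofUnitHom ψ₂ (b.1.1 1 1) *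
        principalExtend ψ₁ ψ₂ c g := by
  have hb : b.1.1 1 0 = 0 := b.2
  obtain ⟨h0, h1⟩ := borel_entries_ne_zero b
  have hbdet : b.1.1.det = b.1.1 0 0 * b.1.1 1 1 := by
    rw [Matrix.det_fin_two, hb, mul_zero, sub_zero]
  have e10 : (b.1 * g).1 1 0 = b.1.1 1 1 * g.1 1 0 := by
    rw [Units.val_mul, Matrix.mul_apply, Fin.sum_univ_two, hb, zero_mul, zero_add]
  have e11 : (b.1 * g).1 1 1 = b.1.1 1 1 * g.1 1 1 := by
    rw [Units.val_mul, Matrix.mul_apply, Fin.sum_univ_two, hb, zero_mul, zero_add]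
  have e00 : (b.1 * g).1 0 0 = b.1.1 0 0 * g.1 0 0 + b.1.1 0 1 * g.1 1 0 := by
    rw [Units.val_mul, Matrix.mul_apply, Fin.sum_univ_two]
  have ed : (b.1 * g).1.det = b.1.1 0 0 * b.1.1 1 1 * g.1.det := by
    rw [Units.val_mul, Matrix.det_mul, hbdet]
  unfold principalExtend
  rw [e10, e11, e00, ed]
  by_cases hg : g.1 1 0 = 0
  · rw [if_pos (by rw [hg, mul_zero]), if_pos hg, hg, mul_zero, add_zero, map_mul, map_mul]
    ring
  · rw [if_neg (mul_ne_zero h1 hg), if_neg hg, mul_div_mul_left _ _ h1]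
    have : -(b.1.1 0 0 * b.1.1 1 1 * g.1.det) / (b.1.1 1 1 * g.1 1 0) =
        b.1.1 0 0 * (-g.1.det / g.1 1 0) := by
      field_simp
    rw [this, map_mul, map_mul]
    ring

theorem principalExtend_cosetRep (c : Option k → R) (o : Option k) :
    principalExtend ψ₁ ψ₂ c (cosetRep o) = c o := by
  cases o with
  | none => simp [principalExtend, cosetRep]
  | some y => simp [principalExtend, coe_cosetRep_some]

theorem eq_principalExtend (φ : GL (Fin 2) k → R)
    (hφ : φ ∈ Representation.coindV (borel k).subtype (charRep (borelChar ψ₁ ψ₂)))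
    (g : GL (Fin 2) k) : φ g = principalExtend ψ₁ ψ₂ (fun o => φ (cosetRep o)) g := by
  have hdet : g.1.det ≠ 0 := ((Matrix.isUnit_iff_isUnit_det _).1 g.isUnit).ne_zero
  have key : ∀ (b : borel k) (o : Option k), g = b.1 * cosetRep o →
      φ g = principalExtend ψ₁ ψ₂ (fun o => φ (cosetRep o)) g := by
    rintro b o rfl
    rw [principalExtend_mul, principalExtend_cosetRep, ← charRep_borelChar]
    exact hφ b _
  by_cases hg : g.1 1 0 = 0
  · exact key ⟨g, hg⟩ none (by simp [cosetRep])
  -- The Bruhat decomposition of g on the big cell: an upper triangular matrix times the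
  -- representative of the point g₁₁/g₁₀.
  · refine key ⟨Matrix.GeneralLinearGroup.mkOfDetNeZero
      !![-g.1.det / g.1 1 0, g.1 0 0; 0, g.1 1 0] ?_, rfl⟩ (some (g.1 1 1 / g.1 1 0)) ?_
    · rw [Matrix.det_fin_two_of, mul_zero, sub_zero]
      exact mul_ne_zero (div_ne_zero (neg_ne_zero.2 hdet) hg) hg
    · refine Units.ext ?_
      rw [Units.val_mul, coe_cosetRep_some]
      change g.1 = !![-g.1.det / g.1 1 0, g.1 0 0; 0, g.1 1 0] * _
      rw [Matrix.mul_fin_two, Matrix.det_fin_two]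
      conv_lhs => rw [Matrix.eta_fin_two g.1]
      congr 1
      have : g.1 0 1 = -(g.1 0 0 * g.1 1 1 - g.1 0 1 * g.1 1 0) / g.1 1 0 * 1 +
          g.1 0 0 * (g.1 1 1 / g.1 1 0) := by
        field_simp
        ring
      rw [← this, mul_div_cancel₀ _ hg]
      simp

/-- The principal series is free on the projective line. -/
def principalBasis [Fintype k] : Module.Basis (Option k) R
    (Representation.coindV (borel k).subtype (charRep (borelChar ψ₁ ψ₂))) :=
  Module.Basis.ofEquivFun
    { toFun := fun φ o => φ.1 (cosetRep o)
      map_add' := fun φ φ' => rfl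
      map_smul' := fun r φ => rfl
      invFun := fun c => ⟨principalExtend ψ₁ ψ₂ c, fun b g => by
        rw [charRep_borelChar]
        exact principalExtend_mul ψ₁ ψ₂ c b g⟩
      left_inv := fun φ => Subtype.ext (funext fun g => (eq_principalExtend ψ₁ ψ₂ φ.1 φ.2 g).symm)
      right_inv := fun c => funext fun o => principalExtend_cosetRep ψ₁ ψ₂ c o }

-- In the basis indexed by the projective line g acts by a monomial matrix. The trace is a sum over
-- fixed points: the first term is the point with representative 1, the sum runs over the affine
-- points y.
open Classical in
theorem trace_principalSeries [Fintype k] (g : GL (Fin 2) k) :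
    LinearMap.trace R _ (principalSeries (R := R) ψ₁ ψ₂ g) =
      (if g.1 1 0 = 0 then MulChar.ofUnitHom ψ₁ (g.1 0 0) * MulChar.ofUnitHom ψ₂ (g.1 1 1) else 0) +
      ∑ y : k, if g.1 0 0 + y * g.1 1 0 ≠ 0 ∧
          g.1 0 1 + y * g.1 1 1 = y * (g.1 0 0 + y * g.1 1 0) then
        MulChar.ofUnitHom ψ₁ (g.1.det / (g.1 0 0 + y * g.1 1 0)) *
          MulChar.ofUnitHom ψ₂ (g.1 0 0 + y * g.1 1 0) else 0 := by
  have h1 : ∀ o, (principalBasis (R := R) ψ₁ ψ₂).repr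
      (principalSeries ψ₁ ψ₂ g (principalBasis ψ₁ ψ₂ o)) o =
        principalExtend ψ₁ ψ₂ (Pi.single o 1) (cosetRep o * g) := fun o => by
    rw [principalBasis, Module.Basis.coe_ofEquivFun]
    rfl
  rw [trace_eq_sum_repr (principalBasis ψ₁ ψ₂)]
  simp only [h1]
  rw [Fintype.sum_option]
  congr 1
  · simp [principalExtend, cosetRep]
  · refine Finset.sum_congr rfl fun y _ => ?_
    have e : (cosetRep (some y) * g).1 = !![g.1 1 0, g.1 1 1;
        g.1 0 0 + y * g.1 1 0, g.1 0 1 + y * g.1 1 1] := by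
      rw [Units.val_mul, coe_cosetRep_some]
      conv_lhs => rw [Matrix.eta_fin_two g.1, Matrix.mul_fin_two]
      simp
    have ed : (cosetRep (some y) * g).1.det = -g.1.det := by
      rw [Units.val_mul, Matrix.det_mul, coe_cosetRep_some]
      simp
    unfold principalExtend
    rw [ed, e]
    simp only [Matrix.of_apply, Matrix.cons_val', Matrix.cons_val_zero, Matrix.cons_val_one,
      Matrix.cons_val_fin_one, neg_neg]
    by_cases h0 : g.1 0 0 + y * g.1 1 0 = 0
    · simp [h0]
    · rw [if_neg h0]
      simp only [Pi.single_apply, Option.some.injEq, div_eq_iff h0, ne_eq, h0, not_false_eq_true,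
        true_and, mul_ite, mul_one, mul_zero]

end PrincipalSeries

/-! ### Traces of reductions as sums over eigenlines -/

section ReductionTrace

variable {p : ℕ} [Fact p.Prime] {F k : Type*} [Field F] [Field k] [Finite k]

instance free_principalSeries {R : Type*} [CommRing R] (ψ₁ ψ₂ : kˣ →* Rˣ) :
    Module.Free R (Representation.coindV (borel k).subtype (charRep (borelChar ψ₁ ψ₂))) := by
  have : Fintype k := Fintype.ofFinite k
  exact Module.Free.of_basis (principalBasis ψ₁ ψ₂)

instance finite_principalSeries {R : Type*} [CommRing R] (ψ₁ ψ₂ : kˣ →* Rˣ) :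
    Module.Finite R (Representation.coindV (borel k).subtype (charRep (borelChar ψ₁ ψ₂))) := by
  have : Fintype k := Fintype.ofFinite k
  exact Module.Finite.of_basis (principalBasis ψ₁ ψ₂)

variable (ψ₁ ψ₂ : kˣ →* (WittVector p F)ˣ)

theorem finrank_reduction_principalSeries [CharP F p] :
    Module.finrank F (F ⊗[WittVector p F]
      Representation.coindV (borel k).subtype (charRep (borelChar ψ₁ ψ₂))) = Nat.card k + 1 := by
  have : Fintype k := Fintype.ofFinite k
  rw [Module.finrank_eq_card_basis (Algebra.TensorProduct.basis F (principalBasis ψ₁ ψ₂)),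
    Fintype.card_option, Nat.card_eq_fintype_card]

open Classical in
/-- The trace of the reduction of a principal series at a matrix with rational eigenvalues. -/
theorem trace_reduction_principalSeries [CharP k p] {χ₁ χ₂ : k → F}
    (h1 : ∀ u : kˣ, WittVector.constantCoeff (ψ₁ u : WittVector p F) = χ₁ u)
    (h2 : ∀ u : kˣ, WittVector.constantCoeff (ψ₂ u : WittVector p F) = χ₂ u) [CharP F p]
    (g : GL (Fin 2) k) {α β : k} (htr : g.1.trace = α + β) (hdet : g.1.det = α * β) :
    LinearMap.trace F _ (reduction (principalSeries ψ₁ ψ₂) g) =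
      χ₁ α * χ₂ β + if α = β then 0 else χ₁ β * χ₂ α := by
  have : Fintype k := Fintype.ofFinite k
  have hd0 : g.1.det ≠ 0 := ((Matrix.isUnit_iff_isUnit_det _).1 g.isUnit).ne_zero
  have hα : α ≠ 0 := by rintro rfl; exact hd0 (by rw [hdet, zero_mul])
  have hβ : β ≠ 0 := by rintro rfl; exact hd0 (by rw [hdet, mul_zero])
  have h1' : ∀ x : k, x ≠ 0 → WittVector.constantCoeff (MulChar.ofUnitHom ψ₁ x) = χ₁ x :=
    fun x hx => by
      rw [← Units.val_mk0 hx, MulChar.ofUnitHom_coe, h1]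
  have h2' : ∀ x : k, x ≠ 0 → WittVector.constantCoeff (MulChar.ofUnitHom ψ₂ x) = χ₂ x :=
    fun x hx => by
      rw [← Units.val_mk0 hx, MulChar.ofUnitHom_coe, h2]
  obtain ⟨P, u, hU⟩ := exists_conj_upperTriangular g htr hdet
  have hconj : LinearMap.trace F _ (reduction (principalSeries ψ₁ ψ₂) g) =
      LinearMap.trace F _ (reduction (principalSeries ψ₁ ψ₂) (P⁻¹ * g * P)) := by
    rw [map_mul (reduction _) _ P, LinearMap.trace_mul_comm, ← map_mul,
      mul_inv_cancel_left]
  rw [hconj]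
  refine (LinearMap.trace_baseChange (principalSeries ψ₁ ψ₂ (P⁻¹ * g * P)) F).trans ?_
  rw [trace_principalSeries, hU, map_add, map_sum]
  change WittVector.constantCoeff _ + ∑ y, WittVector.constantCoeff _ = _
  simp only [Matrix.of_apply, Matrix.cons_val', Matrix.cons_val_zero, Matrix.cons_val_one,
    Matrix.cons_val_fin_one, Matrix.det_fin_two_of, mul_zero, sub_zero, add_zero, if_true,
    map_mul, h1' α hα, h2' β hβ, ne_eq, hα, not_false_eq_true, true_and,
    mul_div_cancel_left₀ β hα, apply_ite (WittVector.constantCoeff (R := F) (p := p)), map_zero,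
    h1' β hβ, h2' α hα]
  congr 1
  -- For α = β the affine points contribute zero: a scalar matrix fixes all card k of them, a
  -- multiple of p, and a non-scalar one fixes none. For α ≠ β there is one further fixed point, y =
  -- u/(α - β).
  by_cases hαβ : α = β
  · rw [if_pos hαβ, hαβ]
    by_cases hu : u = 0
    · simp only [hu, zero_add, if_true, Finset.sum_const, Finset.card_univ, nsmul_eq_mul]
      have : (Fintype.card k : F) = 0 := by
        rw [CharP.cast_eq_zero_iff F p]
        obtain ⟨r, -, hr⟩ := FiniteField.card k p
        rw [hr]
        exact dvd_pow_self _ r.ne_zero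
      rw [this, zero_mul]
    · refine Finset.sum_eq_zero fun y _ => if_neg fun h => hu ?_
      linear_combination h
  · rw [if_neg hαβ, Finset.sum_eq_single (u / (α - β))]
    · rw [if_pos]
      field_simp [sub_ne_zero.2 hαβ]
      ring
    · intro y _ hy
      refine if_neg fun h => hy ?_
      rw [eq_div_iff (sub_ne_zero.2 hαβ)]
      linear_combination -h
    · simp

/-- A fixed point on the projective line is an eigenline over k, which would split the
characteristic polynomial; without one every term of the trace vanishes. -/
theorem trace_reduction_principalSeries_eq_zero (g : GL (Fin 2) k)
    (h : ∀ α β : k, g.1.trace = α + β → g.1.det = α * β → False) :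
    LinearMap.trace F _ (reduction (principalSeries ψ₁ ψ₂) g) = 0 := by
  classical
  have : Fintype k := Fintype.ofFinite k
  refine (LinearMap.trace_baseChange (principalSeries ψ₁ ψ₂ g) F).trans ?_
  rw [trace_principalSeries, if_neg, zero_add, Finset.sum_eq_zero, map_zero]
  · intro y _
    refine if_neg fun hy => h (g.1 0 0 + y * g.1 1 0) (g.1 1 1 - y * g.1 1 0) ?_ ?_
    · rw [Matrix.trace_fin_two]
      ring
    · rw [Matrix.det_fin_two]
      linear_combination -g.1 1 0 * hy.2
  · intro h0
    refine h (g.1 0 0) (g.1 1 1) (Matrix.trace_fin_two _) ?_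
    rw [Matrix.det_fin_two, h0]
    ring

end ReductionTrace

end SerreWeights
end

noncomputable section
namespace SerreWeights

/-! ### Cyclic sums and the trace identity -/

section CyclicSums

variable {f : ℕ} [NeZero f]

/-- Cyclicity of the trace for a product of matrices T_i = U_i V_i, regrouped as V_{i+1} U_i. The
inner index set may have another size than the outer one, which is used when T_i has rank one. -/
theorem sum_cyclic_eq {K X Y : Type*} [CommRing K] [Fintype X] [Fintype Y]
    (T : ZMod f → X → X → K) (U : ZMod f → X → Y → K) (V : ZMod f → Y → X → K)
    (hT : ∀ i x y, T i x y = ∑ u, U i x u * V i u y) :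
    ∑ s : ZMod f → X, ∏ i, T i (s (i + 1)) (s i) =
      ∑ u : ZMod f → Y, ∏ i, ∑ x, V (i + 1) (u (i + 1)) x * U i x (u i) := by
  classical
  simp only [hT, Finset.prod_univ_sum, Fintype.piFinset_univ]
  rw [Finset.sum_comm]
  refine Finset.sum_congr rfl fun u _ => ?_
  rw [← ((Equiv.addRight (1 : ZMod f)).arrowCongr (Equiv.refl X)).sum_comp]
  refine Finset.sum_congr rfl fun s _ => ?_
  rw [Finset.prod_mul_distrib, Finset.prod_mul_distrib, mul_comm]
  congr 1
  · refine (Equiv.prod_comp (Equiv.addRight (1 : ZMod f)) _).symm.trans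
      (Finset.prod_congr rfl fun i _ => ?_)
    simp [Equiv.arrowCongr]
  · refine Finset.prod_congr rfl fun i _ => ?_
    simp [Equiv.arrowCongr]

theorem ZMod.forall_of_add_one {P : ZMod f → Prop} (h : ∀ i, P i → P (i + 1)) {i : ZMod f}
    (hi : P i) (j : ZMod f) : P j := by
  have h1 : ∀ l : ℕ, P (i + l) := fun l => by
    induction l with
    | zero => simpa using hi
    | succ l ih =>
      have := h _ ih
      rwa [add_assoc, ← Nat.cast_succ] at this
  have := h1 (j - i).val
  rwa [ZMod.natCast_zmod_val, add_sub_cancel] at this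

theorem sum_cyclic_of_triangular {K : Type*} [CommRing K] (T : ZMod f → Bool → Bool → K)
    (hT : ∀ i, T i false true = 0) :
    ∑ s : ZMod f → Bool, ∏ i, T i (s (i + 1)) (s i) =
      ∏ i, T i true true + ∏ i, T i false false := by
  have hne : (fun _ : ZMod f => true) ≠ fun _ => false := fun h => by
    simpa using congrFun h 0
  rw [← Finset.sum_subset (Finset.subset_univ {fun _ : ZMod f => true, fun _ => false}),
    Finset.sum_pair hne]
  intro s _ hs
  by_contra h0
  have h1 : ∀ i, s i = true → s (i + 1) = true := fun i hi => by
    by_contra hi'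
    rw [Bool.not_eq_true] at hi'
    refine h0 (Finset.prod_eq_zero (Finset.mem_univ i) ?_)
    rw [hi, hi', hT]
  simp only [Finset.mem_insert, Finset.mem_singleton, not_or] at hs
  obtain ⟨i, hi⟩ : ∃ i, s i = true := by
    by_contra! h
    exact hs.2 (funext fun i => by simpa using h i)
  exact hs.1 (funext fun j => ZMod.forall_of_add_one h1 hi j)

/-- Away from 0 the matrices are diagonal, so a contributing closed path is constant; the vanishing
diagonal at 0 then kills it. -/
theorem sum_cyclic_of_swap {K : Type*} [CommRing K] (T : ZMod f → Bool → Bool → K)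
    (hT : ∀ i, i ≠ 0 → ∀ x y, x ≠ y → T i x y = 0) (h0 : ∀ x, T 0 x x = 0) :
    ∑ s : ZMod f → Bool, ∏ i, T i (s (i + 1)) (s i) = 0 := by
  refine Finset.sum_eq_zero fun s _ => ?_
  by_contra hne
  have h1 : ∀ i, i ≠ 0 → s (i + 1) = s i := fun i hi => by
    by_contra hi'
    exact hne (Finset.prod_eq_zero (Finset.mem_univ i) (hT i hi _ _ hi'))
  have h2 : ∀ i, s i = s 1 := by
    refine ZMod.forall_of_add_one (i := 1) (fun i hi => ?_) rfl
    by_cases h : i = 0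
    · rw [h, zero_add]
    · rw [h1 i h, hi]
  refine hne (Finset.prod_eq_zero (Finset.mem_univ 0) ?_)
  rw [zero_add, h2 0, h0]

/-- One more than the exponents `n` of the constituents of a principal series. -/
def transferDim (p r : ℕ) : Bool → Bool → ℕ
  | true, true => r + 1
  | false, true => r
  | true, false => p - 1 - r
  | false, false => p - r

/-- The exponents of the determinant for the constituents of a principal series. -/
def transferDet (r : ℕ) : Bool → Bool → ℕ
  | _, true => 0
  | true, false => r + 1
  | false, false => r

theorem sum_prod_transferDim (p : ℕ) (r : ZMod f → ℕ) (hr : ∀ i, r i < p) :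
    ∑ s : ZMod f → Bool, ∏ i, transferDim p (r i) (s (i + 1)) (s i) = p ^ f + 1 := by
  -- The factors are chosen so that each regrouped matrix V_{i+1} U_i is triangular with diagonal
  -- entries p and 1, giving p^f + 1.
  have h1 := sum_cyclic_eq (K := ℤ) (Y := Bool)
    (fun i x y => (transferDim p (r i) x y : ℤ))
    (fun i x u => if u = true then 1 else if x = true then 0 else 1)
    (fun i u y => if u = true then (if y = true then (r i : ℤ) + 1 else p - 1 - r i) else
      if y = true then -1 else 1) (fun i x y => by
        have := hr i
        have e1 : ((p - 1 - r i : ℕ) : ℤ) = p - 1 - r i := by omega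
        have e2 : ((p - r i : ℕ) : ℤ) = p - r i := by omega
        cases x <;> cases y <;> simp [transferDim, e1, e2]; ring)
  rw [sum_cyclic_of_triangular (T := fun i x y => ∑ z : Bool,
    (if x = true then (if z = true then (r (i + 1) : ℤ) + 1 else p - 1 - r (i + 1)) else
      if z = true then -1 else 1) * (if y = true then 1 else if z = true then 0 else 1))
    (fun i => by simp)] at h1
  have h2 : ((∑ s : ZMod f → Bool, ∏ i, transferDim p (r i) (s (i + 1)) (s i) : ℕ) : ℤ) =
      ((p ^ f + 1 : ℕ) : ℤ) := by
    push_cast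
    rw [h1]
    have h3 : ∀ i : ZMod f, (r (i + 1) : ℤ) + 1 + (p - 1 - r (i + 1)) = p := fun i => by ring
    simp [h3, ZMod.card]
  exact_mod_cast h2

variable {K : Type*} [Field K]

/-- The trace of `Sym ^ (N - 1)` in terms of the eigenvalues. -/
def eigenSum (N : ℕ) (A B : K) : K := ∑ i ∈ Finset.range N, A ^ i * B ^ (N - 1 - i)

theorem eigenSum_mul_sub (N : ℕ) (A B : K) : eigenSum N A B * (A - B) = A ^ N - B ^ N :=
  (Commute.all A B).geom_sum₂_mul N

theorem eigenSum_self (N : ℕ) (A : K) : eigenSum N A A * A = N * A ^ N := by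
  have : ∀ i ∈ Finset.range N, A ^ i * A ^ (N - 1 - i) * A = A ^ N := fun i hi => by
    rw [← pow_add, ← pow_succ]
    congr 1
    have := Finset.mem_range.1 hi
    omega
  rw [eigenSum, Finset.sum_mul, Finset.sum_congr rfl this, Finset.sum_const, Finset.card_range,
    nsmul_eq_mul]

/-- The factors of the trace of the constituents of a principal series. -/
def transfer (p r : ℕ) (A B : K) (x y : Bool) : K :=
  (A * B) ^ transferDet r x y * eigenSum (transferDim p r x y) A B

/-- The column vectors in the decomposition of `transfer`. -/
def transferCol (r : ℕ) (A B : K) (x u : Bool) : K :=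
  if u = true then A ^ r * (if x = true then A else 1) / (A - B)
  else -(B ^ r * (if x = true then B else 1)) / (A - B)

/-- The row vectors in the decomposition of `transfer`. -/
def transferRow (A B : K) (u y : Bool) : K :=
  if y = true then 1 else if u = true then -B else -A

/-- All entries have the form (A^s B^t - B^s A^t)/(A - B), so they split into a part for each
eigenvalue. The column factor involves (A, B) and the row factor (A^p, B^p); since A_{i+1}^p = A_i,
the row at i+1 meets the column at i with the same pair of eigenvalues. -/
theorem transfer_eq {p r : ℕ} (hr : r < p) {A B : K} (hAB : A ≠ B) (x y : Bool) :
    transfer p r A B x y = ∑ u, transferCol r A B x u * transferRow (A ^ p) (B ^ p) u y := by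
  have h0 : A - B ≠ 0 := sub_ne_zero.2 hAB
  have key : ∀ N, eigenSum N A B = (A ^ N - B ^ N) / (A - B) := fun N => by
    rw [eq_div_iff h0, eigenSum_mul_sub]
  obtain ⟨t, rfl⟩ : ∃ t, p = r + 1 + t := ⟨p - (r + 1), by omega⟩
  have e1 : r + 1 + t - 1 - r = t := by omega
  have e2 : r + 1 + t - r = t + 1 := by omega
  rw [transfer, key, Fintype.sum_bool]
  cases x <;> cases y <;> simp [transferDet, transferDim, transferCol, transferRow, e2] <;>
    field_simp <;> ring

theorem sum_transferRow_mul_transferCol (r : ℕ) {A B : K} (hAB : A ≠ B) (u' u : Bool) :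
    ∑ x, transferRow A B u' x * transferCol r A B x u =
      if u' = u then (if u = true then A ^ r else B ^ r) else 0 := by
  have h0 : A - B ≠ 0 := sub_ne_zero.2 hAB
  rw [Fintype.sum_bool]
  cases u' <;> cases u <;> simp [transferCol, transferRow] <;> field_simp <;> ring

/-- The matching at the place where Frobenius exchanges the eigenvalues: the diagonal disappears, as
required by `sum_cyclic_of_swap`. -/
theorem sum_transferRow_swap_mul_transferCol (r : ℕ) {A B : K} (hAB : A ≠ B) (u : Bool) :
    ∑ x, transferRow B A u x * transferCol r A B x u = 0 := by
  have h0 : A - B ≠ 0 := sub_ne_zero.2 hAB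
  rw [Fintype.sum_bool]
  cases u <;> simp [transferCol, transferRow] <;> field_simp <;> ring

/-- The trace identity for distinct eigenvalues that are fixed by the `f`-th power of Frobenius. -/
theorem sum_prod_transfer_of_ne {p : ℕ} {r : ZMod f → ℕ} (hr : ∀ i, r i < p) {A B : ZMod f → K}
    (hA : ∀ i, A (i + 1) ^ p = A i) (hB : ∀ i, B (i + 1) ^ p = B i) (hAB : ∀ i, A i ≠ B i) :
    ∑ s : ZMod f → Bool, ∏ i, transfer p (r i) (A i) (B i) (s (i + 1)) (s i) =
      ∏ i, A i ^ r i + ∏ i, B i ^ r i := by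
  rw [sum_cyclic_eq _ _ _ fun i x y => transfer_eq (hr i) (hAB i) x y]
  simp only [hA, hB, fun i => sum_transferRow_mul_transferCol (r i) (hAB i)]
  rw [sum_cyclic_of_triangular (T := fun i x y =>
    if x = y then (if y = true then A i ^ r i else B i ^ r i) else 0) (fun i => by simp)]
  simp

/-- The trace identity for eigenvalues that are interchanged by the `f`-th power of Frobenius. -/
theorem sum_prod_transfer_of_swap {p : ℕ} {r : ZMod f → ℕ} (hr : ∀ i, r i < p) {A B : ZMod f → K}
    (hA : ∀ i, i ≠ 0 → A (i + 1) ^ p = A i) (hB : ∀ i, i ≠ 0 → B (i + 1) ^ p = B i)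
    (hA0 : A 1 ^ p = B 0) (hB0 : B 1 ^ p = A 0) (hAB : ∀ i, A i ≠ B i) :
    ∑ s : ZMod f → Bool, ∏ i, transfer p (r i) (A i) (B i) (s (i + 1)) (s i) = 0 := by
  rw [sum_cyclic_eq _ _ _ fun i x y => transfer_eq (hr i) (hAB i) x y]
  refine sum_cyclic_of_swap (fun i x y => ∑ z, transferRow (A (i + 1) ^ p) (B (i + 1) ^ p) x z *
    transferCol (r i) (A i) (B i) z y) (fun i hi x y hxy => ?_) fun x => ?_
  · simp only [hA i hi, hB i hi, sum_transferRow_mul_transferCol (r i) (hAB i), if_neg hxy]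
  · simp only [zero_add, hA0, hB0]
    exact sum_transferRow_swap_mul_transferCol _ (hAB 0) x

/-- The trace identity for equal eigenvalues. -/
theorem sum_prod_transfer_self {p : ℕ} [CharP K p] {r : ZMod f → ℕ} (hr : ∀ i, r i < p)
    {A : ZMod f → K} (hA : ∀ i, A (i + 1) ^ p = A i) (hA0 : ∀ i, A i ≠ 0) :
    ∑ s : ZMod f → Bool, ∏ i, transfer p (r i) (A i) (A i) (s (i + 1)) (s i) =
      ∏ i, A i ^ r i := by
  -- For equal eigenvalues `eigenSum N A A` is N A^(N-1), and in characteristic p the dimensions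
  -- p-1-r and p-r become -(r+1) and -r. The columns are then proportional, so the matrix has rank
  -- one and a single inner index suffices.
  rw [sum_cyclic_eq (Y := Unit) _
    (fun i x _ => if x = true then ((r i : K) + 1) * A i ^ r i else r i * A i ^ r i / A i)
    (fun i _ y => if y = true then 1 else -A i ^ p) fun i x y => ?_]
  · rw [Fintype.sum_unique]
    refine Finset.prod_congr rfl fun i _ => ?_
    rw [Fintype.sum_bool]
    have := hA0 i
    simp [hA]
    field_simp
    ring
  · have h0 := hA0 i
    have h1 : ∀ N, eigenSum N (A i) (A i) = N * A i ^ N / A i := fun N => by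
      rw [eq_div_iff h0, eigenSum_self]
    have hri := hr i
    have hp : (p : K) = 0 := CharP.cast_eq_zero K p
    have e1 : ((p - 1 - r i : ℕ) : K) = -1 - r i := by
      rw [Nat.cast_sub (by omega), Nat.cast_sub (by omega), hp]
      simp
    have e2 : ((p - r i : ℕ) : K) = -r i := by
      rw [Nat.cast_sub (by omega), hp]
      simp
    have e3 : A i ^ p = A i ^ (r i + 1) * A i ^ (p - 1 - r i) := by
      rw [← pow_add]
      congr 1
      omega
    have e4 : A i ^ (p - r i) = A i ^ (p - 1 - r i) * A i := by
      rw [← pow_succ]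
      congr 1
      omega
    rw [transfer, h1, Fintype.sum_unique]
    cases x <;> cases y <;> simp [transferDet, transferDim, e1, e2, e3, e4] <;>
      field_simp <;> ring

end CyclicSums

end SerreWeights
end

noncomputable section
namespace SerreWeights

/-! ### The constituents of the reduction of a principal series -/

section TraceIdentity

variable {k F K : Type*} [Field k] [Field F] [Field K] {f : ℕ} [NeZero f]

/-- The trace of `Sym ^ (N - 1)`, which is zero if `N = 0`. -/
def predSymTrace (N : ℕ) (g : Matrix (Fin 2) (Fin 2) K) : K :=
  if N = 0 then 0 else symTrace (N - 1) g

theorem predSymTrace_eq (N : ℕ) (g : GL (Fin 2) K) {A B : K} (htr : g.1.trace = A + B)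
    (hdet : g.1.det = A * B) : predSymTrace N g.1 = eigenSum N A B := by
  cases N with
  | zero => simp [predSymTrace, eigenSum]
  | succ n =>
    rw [predSymTrace, if_neg n.succ_ne_zero, Nat.add_sub_cancel,
      symTrace_eq n g (htr.trans (add_comm _ _)) (hdet.trans (mul_comm _ _)), eigenSum]
    exact Finset.sum_congr rfl fun i _ => by rw [Nat.add_sub_cancel, mul_comm]

/-- The sum of the traces of the potential constituents of a principal series. -/
def transferTrace (p : ℕ) (r : ZMod f → ℕ) (σ : ZMod f → k →+* K) (g : GL (Fin 2) k) : K :=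
  ∑ s : ZMod f → Bool, ∏ i, σ i g.1.det ^ transferDet (r i) (s (i + 1)) (s i) *
    predSymTrace (transferDim p (r i) (s (i + 1)) (s i)) (g.1.map (σ i))

theorem map_transferTrace (p : ℕ) (r : ZMod f → ℕ) (σ : ZMod f → k →+* F) (φ : F →+* K)
    (g : GL (Fin 2) k) :
    φ (transferTrace p r σ g) = transferTrace p r (fun i => φ.comp (σ i)) g := by
  simp only [transferTrace, map_sum, map_prod, map_mul, map_pow, predSymTrace,
    apply_ite φ, map_zero, map_symTrace, Matrix.map_map]
  rfl

theorem transferTrace_eq (p : ℕ) (r : ZMod f → ℕ) (σ : ZMod f → k →+* K) (g : GL (Fin 2) k)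
    {A B : ZMod f → K} (htr : ∀ i, σ i g.1.trace = A i + B i)
    (hdet : ∀ i, σ i g.1.det = A i * B i) :
    transferTrace p r σ g =
      ∑ s : ZMod f → Bool, ∏ i, transfer p (r i) (A i) (B i) (s (i + 1)) (s i) := by
  refine Finset.sum_congr rfl fun s _ => Finset.prod_congr rfl fun i _ => ?_
  have h1 : (Matrix.GeneralLinearGroup.map (σ i) g).1.trace = A i + B i := by
    rw [← htr i]
    simp [Matrix.trace_fin_two]
  have h2 : (Matrix.GeneralLinearGroup.map (σ i) g).1.det = A i * B i := by
    rw [← hdet i]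
    simp [Matrix.det_fin_two]
  rw [transfer, hdet, ← predSymTrace_eq _ _ h1 h2]
  rfl

variable {p : ℕ} [Fact p.Prime] {σ : ZMod f → k →+* F} (hσ : ∀ i x, σ (i + 1) x ^ p = σ i x)
  {r : ZMod f → ℕ} (hr : ∀ i, r i < p)

open Classical in
theorem transferTrace_of_split [CharP F p] {σ : ZMod f → k →+* F}
    (hσ : ∀ i x, σ (i + 1) x ^ p = σ i x) (hr : ∀ i, r i < p) (g : GL (Fin 2) k) {α β : k}
    (htr : g.1.trace = α + β) (hdet : g.1.det = α * β) :
    transferTrace p r σ g =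
      ∏ i, σ i α ^ r i + if α = β then 0 else ∏ i, σ i β ^ r i := by
  have hd0 : g.1.det ≠ 0 := ((Matrix.isUnit_iff_isUnit_det _).1 g.isUnit).ne_zero
  have hα : α ≠ 0 := by rintro rfl; exact hd0 (by rw [hdet, zero_mul])
  rw [transferTrace_eq p r σ g (A := fun i => σ i α) (B := fun i => σ i β)
    (fun i => by rw [htr, map_add]) fun i => by rw [hdet, map_mul]]
  split_ifs with h
  · subst h
    rw [add_zero]
    exact sum_prod_transfer_self hr (fun i => hσ i α) fun i => (map_ne_zero _).2 hα
  · exact sum_prod_transfer_of_ne hr (fun i => hσ i α) (fun i => hσ i β)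
      fun i h' => h ((σ i).injective h')

theorem ZMod.val_neg_add_one {i : ZMod f} (hi : i ≠ 0) : (-(i + 1)).val + 1 = (-i).val := by
  have h0 : (-i).val ≠ 0 := fun h => hi (by simpa using (ZMod.val_eq_zero _).1 h)
  have h1 : -(i + 1) = (((-i).val - 1 : ℕ) : ZMod f) := by
    rw [Nat.cast_sub (by omega), ZMod.natCast_zmod_val]
    push_cast
    ring
  rw [h1, ZMod.val_natCast, Nat.mod_eq_of_lt (by have := ZMod.val_lt (-i); omega)]
  omega

theorem ZMod.val_neg_one_add_one : (-1 : ZMod f).val + 1 = f := by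
  obtain ⟨g, rfl⟩ : ∃ g, f = g + 1 := ⟨f - 1, (Nat.sub_add_cancel (NeZero.one_le)).symm⟩
  rw [ZMod.val_neg_one]

theorem embedding_eq_pow {σ : ZMod f → k →+* F}
    (hσ : ∀ i x, σ (i + 1) x ^ p = σ i x) (i : ZMod f) (x : k) :
    σ i x = σ 0 x ^ p ^ (-i).val := by
  have h := embedding_embIndex hσ ((embIndex f).symm i) x
  rw [Equiv.apply_symm_apply] at h
  rw [h]
  congr 2
  have h2 : -(((embIndex f).symm i : ℕ) : ZMod f) = i := by
    rw [← embIndex_apply, Equiv.apply_symm_apply]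
  conv_rhs => rw [← h2]
  rw [neg_neg, ZMod.val_natCast, Nat.mod_eq_of_lt (Fin.is_lt _)]

/-- The polynomial X^(p^f) - X already has p^f roots in k, so it acquires no new ones in K. -/
theorem mem_range_of_pow_eq (hk : Nat.card k = p ^ f) (φ : k →+* K) {x : K}
    (hx : x ^ p ^ f = x) : ∃ a, φ a = x := by
  have hp : p.Prime := Fact.out
  have hfin : Finite k := Nat.finite_of_card_ne_zero (by rw [hk]; exact pow_ne_zero _ hp.ne_zero)
  have : Fintype k := Fintype.ofFinite k
  have hq : 1 < Fintype.card k := Fintype.one_lt_card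
  rw [Nat.card_eq_fintype_card] at hk
  have hroots := FiniteField.roots_X_pow_card_sub_X k
  have hmap : ((Polynomial.X ^ Fintype.card k - Polynomial.X : Polynomial k).map φ).roots =
      (Polynomial.X ^ Fintype.card k - Polynomial.X : Polynomial k).roots.map φ := by
    refine Polynomial.Splits.roots_map (Polynomial.splits_iff_card_roots.2 ?_) φ
    rw [hroots, FiniteField.X_pow_card_sub_X_natDegree_eq _ hq]
    rfl
  have hmem : x ∈ (Polynomial.X ^ Fintype.card k - Polynomial.X : Polynomial k).roots.map φ := by
    rw [← hmap, Polynomial.map_sub, Polynomial.map_pow, Polynomial.map_X,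
      Polynomial.mem_roots (FiniteField.X_pow_card_sub_X_ne_zero _ hq), hk]
    simp [hx]
  obtain ⟨a, -, ha⟩ := Multiset.mem_map.1 hmem
  exact ⟨a, ha⟩

/-- Over an algebraic closure the two eigenvalues are interchanged by the p^f-th power map. The
chains α^(p^j) and β^(p^j) are compatible with Frobenius except at the wrap-around, where they are
swapped. -/
theorem transferTrace_of_nonsplit [CharP F p] {σ : ZMod f → k →+* F}
    (hσ : ∀ i x, σ (i + 1) x ^ p = σ i x) (hk : Nat.card k = p ^ f) (hr : ∀ i, r i < p)
    (g : GL (Fin 2) k) (h : ∀ α β : k, g.1.trace = α + β → g.1.det = α * β → False) :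
    transferTrace p r σ g = 0 := by
  have hp : p.Prime := Fact.out
  let K := AlgebraicClosure F
  have : CharP K p := charP_of_injective_algebraMap (algebraMap F K).injective p
  refine (algebraMap F K).injective ?_
  rw [map_transferTrace, map_zero]
  set τ : ZMod f → k →+* K := fun i => (algebraMap F K).comp (σ i) with hτ
  have hτp : ∀ i x, τ i x = τ 0 x ^ p ^ (-i).val := fun i x => by
    simp only [hτ, RingHom.comp_apply]
    rw [embedding_eq_pow hσ, map_pow]
  have hq : ∀ x : k, x ^ p ^ f = x := fun x => by
    have hfin : Finite k := Nat.finite_of_card_ne_zero (by rw [hk]; exact pow_ne_zero _ hp.ne_zero)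
    have : Fintype k := Fintype.ofFinite k
    rw [← hk, Nat.card_eq_fintype_card, FiniteField.pow_card]
  obtain ⟨α, hα⟩ : ∃ α : K, α * α - τ 0 g.1.trace * α + τ 0 g.1.det = 0 := by
    have hd : (Polynomial.X ^ 2 - Polynomial.C (τ 0 g.1.trace) * Polynomial.X +
        Polynomial.C (τ 0 g.1.det)).degree ≠ 0 := by
      have : (Polynomial.X ^ 2 - Polynomial.C (τ 0 g.1.trace) * Polynomial.X +
        Polynomial.C (τ 0 g.1.det)).natDegree = 2 := by compute_degree!
      intro h0
      have h1 := Polynomial.natDegree_eq_zero_iff_degree_le_zero.2 h0.le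
      omega
    obtain ⟨α, hα⟩ := IsAlgClosed.exists_root _ hd
    refine ⟨α, ?_⟩
    simpa [Polynomial.IsRoot, sq] using hα
  set β := τ 0 g.1.trace - α with hβ
  have htr : τ 0 g.1.trace = α + β := by rw [hβ]; ring
  have hdet : τ 0 g.1.det = α * β := by rw [hβ]; linear_combination hα
  -- The p^f-th power map fixes the coefficients of the characteristic polynomial, so it permutes
  -- its roots; fixing α would put an eigenvalue in k.
  have hroot : (α ^ p ^ f - α) * (α ^ p ^ f - β) = 0 := by
    have h1 : (α * α - τ 0 g.1.trace * α + τ 0 g.1.det) ^ p ^ f = 0 := by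
      rw [hα, zero_pow (pow_ne_zero _ hp.ne_zero)]
    rw [add_pow_char_pow, sub_pow_char_pow, mul_pow, mul_pow, ← map_pow, ← map_pow, hq, hq, htr,
      hdet] at h1
    linear_combination h1
  have hne : α ^ p ^ f ≠ α := fun h1 => by
    obtain ⟨a, ha⟩ := mem_range_of_pow_eq hk (τ 0) h1
    refine h a (g.1.trace - a) (by ring) ((τ 0).injective ?_)
    rw [map_mul, map_sub, ha, hdet]
  have hαβ : α ^ p ^ f = β := by
    rcases mul_eq_zero.1 hroot with h1 | h1
    · exact absurd (sub_eq_zero.1 h1) hne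
    · exact sub_eq_zero.1 h1
  have hβα : β ^ p ^ f = α := by
    have h1 : (α + β) ^ p ^ f = α + β := by rw [← htr, ← map_pow, hq]
    rw [add_pow_char_pow, hαβ] at h1
    linear_combination h1
  have hne' : α ≠ β := fun h1 => hne (by rw [hαβ, h1])
  rw [transferTrace_eq p r τ g (A := fun i => α ^ p ^ (-i).val) (B := fun i => β ^ p ^ (-i).val)
    (fun i => by rw [hτp, htr, add_pow_char_pow]) fun i => by rw [hτp, hdet, mul_pow]]
  refine sum_prod_transfer_of_swap hr (fun i hi => ?_) (fun i hi => ?_) ?_ ?_ fun i h1 => ?_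
  · rw [← pow_mul, ← pow_succ, ZMod.val_neg_add_one hi]
  · rw [← pow_mul, ← pow_succ, ZMod.val_neg_add_one hi]
  · rw [← pow_mul, ← pow_succ, ZMod.val_neg_one_add_one, hαβ]
    simp
  · rw [← pow_mul, ← pow_succ, ZMod.val_neg_one_add_one, hβα]
    simp
  · exact hne' (iterateFrobenius_inj K p (-i).val (by simpa [iterateFrobenius_def] using h1))

end TraceIdentity

/-! ### Candidate constituents indexed by subsets J -/

section Constituents

universe u

variable {p : ℕ} [Fact p.Prime] {k : Type} {F : Type u} [Field k] [Field F] {f : ℕ} [NeZero f]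
  {σ : ZMod f → k →+* F}

/-- One more than the exponents `n` of the constituent of a principal series indexed by `J`. -/
def constDim (p : ℕ) (r : ZMod f → ℕ) (J : Finset (ZMod f)) (i : ZMod f) : ℕ :=
  transferDim p (r i) (decide (i + 1 ∈ J)) (decide (i ∈ J))

/-- The exponents `m` of the constituent of a principal series indexed by `J`. -/
def constDet (r : ZMod f → ℕ) (y : ZMod f → ℤ) (J : Finset (ZMod f)) (i : ZMod f) : ℤ :=
  y i + transferDet (r i) (decide (i + 1 ∈ J)) (decide (i ∈ J))

theorem constDim_le {r : ZMod f → ℕ} (hr : ∀ i, r i < p) (J : Finset (ZMod f)) (i : ZMod f) :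
    constDim p r J i - 1 ≤ p - 1 := by
  have := hr i
  unfold constDim
  cases decide (i + 1 ∈ J) <;> cases decide (i ∈ J) <;> simp only [transferDim] <;> omega

/-- Subsets and their indicator functions. -/
def finsetEquivBool (f : ℕ) [NeZero f] : Finset (ZMod f) ≃ (ZMod f → Bool) where
  toFun J i := decide (i ∈ J)
  invFun s := Finset.univ.filter fun i => s i = true
  left_inv J := by ext; simp
  right_inv s := by ext; simp

theorem charP_of_embedding (hk : Nat.card k = p ^ f) (φ : k →+* F) :
    Finite k ∧ CharP k p ∧ CharP F p := by
  have hp : p.Prime := Fact.out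
  have hfin : Finite k := Nat.finite_of_card_ne_zero (by rw [hk]; exact pow_ne_zero _ hp.ne_zero)
  have : CharP k p := by
    have : Fintype k := Fintype.ofFinite k
    refine charP_of_card_eq_prime_pow (f := f) ?_
    rw [← Nat.card_eq_fintype_card, hk]
  exact ⟨hfin, this, charP_of_injective_ringHom φ.injective p⟩

variable [Finite F] (hσ : ∀ i x, σ (i + 1) x ^ p = σ i x) (hk : Nat.card k = p ^ f)
  {r : ZMod f → ℕ} (hr : ∀ i, r i < p) (y : ZMod f → ℤ)

include hσ hk hr

open Classical in
/-- The constituents of a representation which has the trace of the reduction of a principal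
series. -/
theorem isJHConstituent_iff_of_trace {V : Type u} [AddCommGroup V] [Module F V]
    [FiniteDimensional F V] (ρ : Representation F (GL (Fin 2) k) V)
    (hV : Module.finrank F V = p ^ f + 1)
    (hs : ∀ g α β, g.1.trace = α + β → g.1.det = α * β → LinearMap.trace F V (ρ g) =
      (∏ i, σ i g.1.det ^ y i) * (∏ i, σ i α ^ r i + if α = β then 0 else ∏ i, σ i β ^ r i))
    (hns : ∀ g : GL (Fin 2) k, (∀ α β : k, g.1.trace = α + β → g.1.det = α * β → False) →
      LinearMap.trace F V (ρ g) = 0)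
    (hne : ∀ J J' : Finset (ZMod f), (∀ i, constDim p r J i ≠ 0) → (∀ i, constDim p r J' i ≠ 0) →
      (∀ i, constDim p r J i = constDim p r J' i) →
      (∀ x : k, x ≠ 0 → ∏ i, σ i x ^ constDet r y J i = ∏ i, σ i x ^ constDet r y J' i) →
      J = J')
    {T : Type u} [AddCommGroup T] [Module F T] (τ : Representation F (GL (Fin 2) k) T) :
    IsJHConstituent τ ρ ↔ ∃ J : Finset (ZMod f), (∀ i, constDim p r J i ≠ 0) ∧
      IsoRep (mu σ (constDet r y J) fun i => constDim p r J i - 1) τ := by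
  obtain ⟨hfin, hck, hcF⟩ := charP_of_embedding hk (σ 0)
  have hn := constDim_le (p := p) (f := f) hr
  have htr : ∀ g, LinearMap.trace F V (ρ g) = (∏ i, σ i g.1.det ^ y i) * transferTrace p r σ g := by
    intro g
    by_cases h : ∀ α β : k, g.1.trace = α + β → g.1.det = α * β → False
    · rw [hns g h, transferTrace_of_nonsplit hσ hk hr g h, mul_zero]
    · push Not at h
      obtain ⟨α, β, h1, h2, -⟩ := h
      rw [hs g α β h1 h2, transferTrace_of_split hσ hr g h1 h2]
  have key := isJHConstituent_iff_of_trace_eq ρ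
    -- A subset with some `constDim` equal to zero stands for Sym^(-1) = 0. It contributes nothing
    -- to the trace or to the dimension, so it is left out of the index set.
    (ι := {J : Finset (ZMod f) // ∀ i, constDim p r J i ≠ 0})
    (S := fun J => MuSpace F fun i => constDim p r J.1 i - 1)
    (fun J => mu σ (constDet r y J.1) fun i => constDim p r J.1 i - 1)
    (fun J => mu_isIrreducible _ hσ hk (hn J.1))
    (fun J J' h => by
      have h1 := (isoRep_mu_iff hσ hk (hn J.1) (hn J'.1)).1 h
      refine Subtype.ext (hne _ _ J.2 J'.2 (fun i => ?_) h1.2)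
      have h2 := congrFun h1.1 i
      have h3 := J.2 i
      have h4 := J'.2 i
      change constDim p r J.1 i - 1 = constDim p r J'.1 i - 1 at h2
      omega)
    (fun J φ hφ => mu_exists_eq_smul _ hσ hk (hn J.1) φ hφ)
    (fun g => by
      have hd0 : g.1.det ≠ 0 := ((Matrix.isUnit_iff_isUnit_det _).1 g.isUnit).ne_zero
      simp only [trace_mu]
      rw [htr, transferTrace, ← (finsetEquivBool f).sum_comp, Finset.mul_sum,
        ← Fintype.sum_subtype_add_sum_subtype (fun J => ∀ i, constDim p r J i ≠ 0)]
      rw [add_eq_left.2]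
      · refine Finset.sum_congr rfl fun J _ => ?_
        rw [← Finset.prod_mul_distrib]
        refine Finset.prod_congr rfl fun i _ => ?_
        have h1 : transferDim p (r i) (finsetEquivBool f J.1 (i + 1)) (finsetEquivBool f J.1 i) =
          constDim p r J.1 i := rfl
        rw [h1, predSymTrace, if_neg (J.2 i), constDet, zpow_add₀ ((map_ne_zero _).2 hd0), mul_assoc,
          zpow_natCast]
        rfl
      · refine Finset.sum_eq_zero fun J _ => ?_
        obtain ⟨i, hi⟩ := not_forall.1 J.2
        refine mul_eq_zero_of_right _ (Finset.prod_eq_zero (Finset.mem_univ i) ?_)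
        have h1 : transferDim p (r i) (finsetEquivBool f J.1 (i + 1)) (finsetEquivBool f J.1 i) =
          constDim p r J.1 i := rfl
        rw [h1, predSymTrace, if_pos (not_not.1 hi), mul_zero])
    (by
      simp only [finrank_mu]
      rw [hV, ← sum_prod_transferDim p r hr, ← (finsetEquivBool f).sum_comp,
        ← Fintype.sum_subtype_add_sum_subtype (fun J => ∀ i, constDim p r J i ≠ 0)]
      rw [add_eq_left.2]
      · refine Finset.sum_congr rfl fun J _ => Finset.prod_congr rfl fun i _ => ?_
        have := J.2 i
        change constDim p r J.1 i = _
        omega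
      · refine Finset.sum_eq_zero fun J _ => ?_
        obtain ⟨i, hi⟩ := not_forall.1 J.2
        exact Finset.prod_eq_zero (Finset.mem_univ i) (not_not.1 hi))
    τ
  exact key.trans ⟨fun ⟨J, h⟩ => ⟨J.1, J.2, h⟩, fun ⟨J, h1, h2⟩ => ⟨⟨J, h1⟩, h2⟩⟩

end Constituents

end SerreWeights
end

noncomputable section
namespace SerreWeights

/-! ### The constituents of the types -/

section Types

universe u

variable {p : ℕ} [Fact p.Prime] {k : Type} {F : Type u} [Field k] [Field F] {f : ℕ} [NeZero f]
  {σ : ZMod f → k →+* F}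

theorem symTrace_zero (g : Matrix (Fin 2) (Fin 2) F) : symTrace 0 g = 1 := by
  simp [symTrace]

theorem Weight.mk_eq_mk_iff {m m' : ZMod f → ℤ} {n n' : ZMod f → ℕ} :
    Weight.mk σ m n = Weight.mk σ m' n' ↔ IsoRep (mu σ m n) (mu σ m' n') :=
  Quotient.eq (r := weightSetoid σ)

/-- The constituent of a principal series indexed by `J`. -/
def constWeight (σ : ZMod f → k →+* F) (p : ℕ) (r : ZMod f → ℕ) (y : ZMod f → ℤ)
    (J : Finset (ZMod f)) : Weight σ :=
  Weight.mk σ (constDet r y J) fun i => constDim p r J i - 1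

theorem teichmullerChar_apply (s : ZMod f → ℤ) (u : kˣ) :
    (teichmullerChar p σ s u : WittVector p F) =
      WittVector.teichmuller p (∏ i, σ i (u : k) ^ s i) := by
  have h : teichmullerChar p σ s u = Units.map (WittVector.teichmuller p : F →* WittVector p F)
      (∏ i, (Units.map (σ i : k →* F) u) ^ s i) := by
    rw [map_prod]
    simp only [teichmullerChar, MonoidHom.finsetProd_apply, map_zpow]
    rfl
  rw [h, Units.coe_map]
  simp

theorem constantCoeff_teichmullerChar (s : ZMod f → ℤ) (u : kˣ) :
    WittVector.constantCoeff (teichmullerChar p σ s u : WittVector p F) =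
      ∏ i, σ i (u : k) ^ s i := by
  rw [teichmullerChar_apply]
  exact WittVector.teichmuller_coeff_zero p _

theorem teichmullerChar_eq_iff (s t : ZMod f → ℤ) :
    teichmullerChar p σ s = teichmullerChar p σ t ↔
      ∀ x : k, x ≠ 0 → ∏ i, σ i x ^ s i = ∏ i, σ i x ^ t i := by
  constructor
  · intro h x hx
    have h1 := constantCoeff_teichmullerChar (p := p) (σ := σ) s (Units.mk0 x hx)
    rw [h, constantCoeff_teichmullerChar] at h1
    exact h1.symm
  · intro h
    refine MonoidHom.ext fun u => Units.ext ?_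
    rw [teichmullerChar_apply, teichmullerChar_apply, h _ u.ne_zero]

theorem trace_reduction_twist {G V : Type*} [Group G] [AddCommGroup V]
    [Module (WittVector p F) V] [Module.Free (WittVector p F) V] [Module.Finite (WittVector p F) V]
    (χ : G →* (WittVector p F)ˣ) (ρ : Representation (WittVector p F) G V) (g : G) :
    LinearMap.trace F _ (reduction (twist χ ρ) g) =
      WittVector.constantCoeff (χ g : WittVector p F) * LinearMap.trace F _ (reduction ρ g) := by
  have h1 : ∀ ρ : Representation (WittVector p F) G V, LinearMap.trace F _ (reduction ρ g) =
      WittVector.constantCoeff (LinearMap.trace (WittVector p F) V (ρ g)) := fun ρ =>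
    LinearMap.trace_baseChange (ρ g) F
  rw [h1, h1, ← map_mul]
  congr 1
  exact map_smul (LinearMap.trace (WittVector p F) V) _ _

variable [Finite F] (hσ : ∀ i x, σ (i + 1) x ^ p = σ i x) (hk : Nat.card k = p ^ f)
  {r : ZMod f → ℕ} (hr : ∀ i, r i < p) {b c a : ZMod f → ℤ} (hra : ∀ i, b i + 2 * a i = r i)

include hra in
theorem typeChar_eq_iff : typeChar₁ p σ b c a = typeChar₂ p σ c a ↔
    ∀ x : k, x ≠ 0 → ∏ i, σ i x ^ r i = 1 := by
  rw [typeChar₁, typeChar₂, teichmullerChar_eq_iff]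
  refine forall₂_congr fun x hx => ?_
  have h1 : ∀ i, c i + b i + a i = c i - a i + r i := fun i => by rw [← hra]; ring
  simp only [h1, zpow_add₀ ((map_ne_zero _).2 hx), Finset.prod_mul_distrib, zpow_natCast]
  exact mul_eq_left₀ (Finset.prod_ne_zero_iff.2 fun i _ => zpow_ne_zero _ ((map_ne_zero _).2 hx))

include hσ hk hra

-- In both cases the trace at eigenvalues α, β is det^(c-a) times the sum of ∏ σ_i^{r_i} over the
-- distinct eigenvalues. In the scalar case this holds because ∏ σ_i^{r_i} is trivial on k^×, so the
-- twist of Ind 1 fits the same formula.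
include hr in
theorem isConstituentTheta'_iff
    (hne : ∀ J J' : Finset (ZMod f), (∀ i, constDim p r J i ≠ 0) → (∀ i, constDim p r J' i ≠ 0) →
      (∀ i, constDim p r J i = constDim p r J' i) →
      (∀ x : k, x ≠ 0 → ∏ i, σ i x ^ constDet r (fun i => c i - a i) J i =
        ∏ i, σ i x ^ constDet r (fun i => c i - a i) J' i) → J = J')
    (m : ZMod f → ℤ) (n : ZMod f → ℕ) :
    IsConstituentTheta' (U := MuSpace F n) p σ b c a (mu σ m n) ↔
      ∃ J : Finset (ZMod f), (∀ i, constDim p r J i ≠ 0) ∧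
        Weight.mk σ m n = constWeight σ p r (fun i => c i - a i) J := by
  classical
  obtain ⟨hfin, hck, hcF⟩ := charP_of_embedding hk (σ 0)
  have h1 : ∀ i, c i + b i + a i = c i - a i + r i := fun i => by rw [← hra]; ring
  have hne0 : ∀ (g : GL (Fin 2) k), g.1.det ≠ 0 := fun g =>
    ((Matrix.isUnit_iff_isUnit_det _).1 g.isUnit).ne_zero
  have hsymm : ∀ J, Weight.mk σ m n = constWeight σ p r (fun i => c i - a i) J ↔
      IsoRep (mu σ (constDet r (fun i => c i - a i) J) fun i => constDim p r J i - 1) (mu σ m n) :=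
    fun J => eq_comm.trans Weight.mk_eq_mk_iff
  simp only [hsymm]
  by_cases h : typeChar₁ p σ b c a = typeChar₂ p σ c a
  · rw [IsConstituentTheta', or_iff_right fun h' => h'.1 h, and_iff_right h]
    rw [typeChar_eq_iff hra] at h
    have hdet : ∀ g : GL (Fin 2) k,
        WittVector.constantCoeff (detChar (typeChar₁ p σ b c a) g : WittVector p F) =
        ∏ i, σ i g.1.det ^ (c i - a i) := fun g => by
      refine (constantCoeff_teichmullerChar (p := p) (σ := σ) (fun i => c i + b i + a i)
        (Matrix.GeneralLinearGroup.det g)).trans ?_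
      simp only [h1, Matrix.GeneralLinearGroup.val_det_apply, zpow_add₀ ((map_ne_zero _).2 (hne0 g)),
        Finset.prod_mul_distrib, zpow_natCast, h _ (hne0 g), mul_one]
    refine isJHConstituent_iff_of_trace hσ hk hr (fun i => c i - a i) _ ?_ ?_ ?_ hne _
    · rw [finrank_reduction_principalSeries, hk]
    · intro g α β htr hd
      have hα : α ≠ 0 := by rintro rfl; exact hne0 g (by rw [hd, zero_mul])
      have hβ : β ≠ 0 := by rintro rfl; exact hne0 g (by rw [hd, mul_zero])
      rw [trace_reduction_twist, hdet, trace_reduction_principalSeries (χ₁ := fun _ => 1)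
        (χ₂ := fun _ => 1) 1 1 (fun u => by simp) (fun u => by simp) g htr hd, h α hα, h β hβ]
      simp
    · intro g hg
      rw [trace_reduction_twist, trace_reduction_principalSeries_eq_zero _ _ g hg, mul_zero]
  · rw [IsConstituentTheta', or_iff_left fun h' => h h'.1, and_iff_right h]
    refine isJHConstituent_iff_of_trace hσ hk hr (fun i => c i - a i) _ ?_ ?_ ?_ hne _
    · rw [finrank_reduction_principalSeries, hk]
    · intro g α β htr hd
      have hα : α ≠ 0 := by rintro rfl; exact hne0 g (by rw [hd, zero_mul])
      have hβ : β ≠ 0 := by rintro rfl; exact hne0 g (by rw [hd, mul_zero])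
      refine (trace_reduction_principalSeries (χ₁ := fun x => ∏ i, σ i x ^ (c i + b i + a i))
        (χ₂ := fun x => ∏ i, σ i x ^ (c i - a i)) (typeChar₁ p σ b c a) (typeChar₂ p σ c a)
        (constantCoeff_teichmullerChar _) (constantCoeff_teichmullerChar _) g htr hd).trans ?_
      simp only [h1, zpow_add₀ ((map_ne_zero (σ _)).2 hα), zpow_add₀ ((map_ne_zero (σ _)).2 hβ), hd,
        map_mul, mul_zpow, Finset.prod_mul_distrib, zpow_natCast]
      split_ifs <;> ring
    · intro g hg
      exact trace_reduction_principalSeries_eq_zero _ _ g hg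

theorem isConstituentTheta_iff_of_eq (h : typeChar₁ p σ b c a = typeChar₂ p σ c a)
    (m : ZMod f → ℤ) (n : ZMod f → ℕ) :
    IsConstituentTheta (U := MuSpace F n) p σ b c a (mu σ m n) ↔
      Weight.mk σ m n = Weight.mk σ (fun i => c i - a i) fun _ => 0 := by
  have h1 : ∀ i, c i + b i + a i = c i - a i + r i := fun i => by rw [← hra]; ring
  have hne0 : ∀ (g : GL (Fin 2) k), g.1.det ≠ 0 := fun g =>
    ((Matrix.isUnit_iff_isUnit_det _).1 g.isUnit).ne_zero
  rw [eq_comm, Weight.mk_eq_mk_iff, IsConstituentTheta, or_iff_right fun h' => h'.1 h,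
    and_iff_right h]
  rw [typeChar_eq_iff hra] at h
  refine (isJHConstituent_iff_of_trace_eq _ (ι := Unit) (S := fun _ => MuSpace F fun _ => 0)
    (fun _ => mu σ (fun i => c i - a i) fun _ => 0)
    (fun _ => mu_isIrreducible _ hσ hk fun _ => Nat.zero_le _) (fun _ _ _ => rfl)
    (fun _ φ hφ => mu_exists_eq_smul _ hσ hk (fun _ => Nat.zero_le _) φ hφ) (fun g => ?_) ?_ _).trans
    ⟨fun ⟨_, h⟩ => h, fun h => ⟨(), h⟩⟩
  · rw [charRep, trace_reduction_twist, Fintype.sum_unique, trace_mu]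
    have h2 : LinearMap.trace F _ (reduction
        (Representation.trivial (WittVector p F) (GL (Fin 2) k) (WittVector p F)) g) = 1 := by
      refine (LinearMap.trace_baseChange _ F).trans ?_
      rw [Representation.trivial, MonoidHom.one_apply]
      simp [LinearMap.trace_one]
    rw [h2, mul_one]
    simp only [symTrace_zero, mul_one]
    refine (constantCoeff_teichmullerChar (p := p) (σ := σ) (fun i => c i + b i + a i)
      (Matrix.GeneralLinearGroup.det g)).trans ?_
    simp only [h1, Matrix.GeneralLinearGroup.val_det_apply, zpow_add₀ ((map_ne_zero _).2 (hne0 g)),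
      Finset.prod_mul_distrib, zpow_natCast, h _ (hne0 g), mul_one]
  · rw [Fintype.sum_unique, finrank_mu, Module.finrank_baseChange]
    simp

end Types

end SerreWeights
end

noncomputable section
namespace SerreWeights

/-! ### Combinatorics of the predicted weights -/

section Combinatorics

variable {p f : ℕ} [NeZero f]

/-- The congruence of exponents which expresses that the products of powers of the embeddings
agree. -/
def ExpCong (p : ℕ) (s t : ZMod f → ℤ) : Prop :=
  (p : ℤ) ^ f - 1 ∣ digitSum p s - digitSum p t

theorem ExpCong.refl (s : ZMod f → ℤ) : ExpCong p s s := by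
  simp [ExpCong]

theorem ExpCong.symm {s t : ZMod f → ℤ} (h : ExpCong p s t) : ExpCong p t s := by
  have := dvd_neg.2 h
  rwa [neg_sub] at this

theorem ExpCong.trans {s t u : ZMod f → ℤ} (h : ExpCong p s t) (h' : ExpCong p t u) :
    ExpCong p s u := by
  have := dvd_add h h'
  rwa [sub_add_sub_cancel] at this

theorem ExpCong.add {s t s' t' : ZMod f → ℤ} (h : ExpCong p s t) (h' : ExpCong p s' t') :
    ExpCong p (fun i => s i + s' i) (fun i => t i + t' i) := by
  have := dvd_add h h'
  rwa [ExpCong, digitSum_add, digitSum_add, add_sub_add_comm]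

theorem ExpCong.sub {s t s' t' : ZMod f → ℤ} (h : ExpCong p s t) (h' : ExpCong p s' t') :
    ExpCong p (fun i => s i - s' i) (fun i => t i - t' i) := by
  have := dvd_sub h h'
  rwa [ExpCong, digitSum_sub, digitSum_sub, sub_sub_sub_comm]

theorem digitSum_telescope (x : ZMod f → ℤ) :
    digitSum p (fun i => p * x i - x (i + 1)) = ((p : ℤ) ^ f - 1) * x 1 := by
  rw [digitSum_sub, digitSum_mul_left, digitSum_shift]
  ring

/-- The relation σ_{i+1}^p = σ_i lets p units at place i+1 be traded for one unit at place i. The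
vector x records these carries; the congruences below are verified by exhibiting it. -/
theorem ExpCong.of_sub_eq {s t : ZMod f → ℤ} (x : ZMod f → ℤ)
    (h : ∀ i, s i - t i = p * x i - x (i + 1)) : ExpCong p s t := by
  rw [ExpCong, ← digitSum_sub, funext h, digitSum_telescope]
  exact dvd_mul_right _ _

theorem natDigitSum_zero : natDigitSum p (fun _ : ZMod f => 0) = 0 := by
  simp [natDigitSum]

/-- Exponents in the box `[0, p - 1]` are determined by the congruence up to the two corners. -/
theorem eq_or_of_expCong (hp : 1 < p) {s t : ZMod f → ℤ} (hs : ∀ i, 0 ≤ s i ∧ s i ≤ p - 1)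
    (ht : ∀ i, 0 ≤ t i ∧ t i ≤ p - 1) (h : ExpCong p s t) :
    s = t ∨ (∀ i, s i = 0 ∧ t i = p - 1) ∨ (∀ i, s i = p - 1 ∧ t i = 0) := by
  have key : ∀ s : ZMod f → ℤ, (∀ i, 0 ≤ s i ∧ s i ≤ p - 1) →
      digitSum p s = natDigitSum p (fun i => (s i).toNat) ∧ ∀ i, (s i).toNat < p := fun s hs => by
    refine ⟨?_, fun i => by have := hs i; omega⟩
    rw [← digitSum_natCast]
    congr 1
    funext i
    have := hs i
    omega
  obtain ⟨h1, h2⟩ := key s hs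
  obtain ⟨h3, h4⟩ := key t ht
  have h5 := natDigitSum_lt h2
  have h6 := natDigitSum_lt h4
  rw [ExpCong, h1, h3] at h
  have hq : 1 < p ^ f := Nat.one_lt_pow (NeZero.ne f) hp
  have hcast : ((p ^ f - 1 : ℕ) : ℤ) = (p : ℤ) ^ f - 1 := by
    rw [Nat.cast_sub (by omega)]
    push_cast
    rfl
  rw [← hcast] at h
  obtain ⟨z, hz⟩ := h
  have hz1 : z = 0 ∨ z = 1 ∨ z = -1 := by
    have h5 : (0 : ℤ) < ((p ^ f - 1 : ℕ) : ℤ) := by omega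
    have h6 : z < 2 := by by_contra! h; nlinarith
    have h7 : -2 < z := by by_contra! h; nlinarith
    omega
  have corner : ∀ s t : ZMod f → ℤ, (∀ i, 0 ≤ s i ∧ s i ≤ p - 1) → (∀ i, 0 ≤ t i ∧ t i ≤ p - 1) →
      (∀ i, (s i).toNat < p) → (∀ i, (t i).toNat < p) →
      natDigitSum p (fun i => (s i).toNat) = 0 →
      natDigitSum p (fun i => (t i).toNat) = p ^ f - 1 → ∀ i, s i = 0 ∧ t i = p - 1 := by
    intro s t hs ht hs' ht' h h' i
    have e1 := congrFun (natDigitSum_injOn hs' (fun _ => by omega) (h.trans natDigitSum_zero.symm)) i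
    have e2 := congrFun (natDigitSum_injOn ht' (t := fun _ => p - 1) (fun _ => by omega)
      (h'.trans (natDigitSum_const p (by omega)).symm)) i
    have := hs i
    have := ht i
    omega
  rcases hz1 with rfl | rfl | rfl
  · left
    funext i
    have e1 := congrFun (natDigitSum_injOn h2 h4 (by omega)) i
    have := hs i
    have := ht i
    omega
  · right; right
    exact fun i => (corner t s ht hs h4 h2 (by omega) (by omega) i).symm
  · right; left
    exact corner s t hs ht h2 h4 (by omega) (by omega)

/-- The exponents `n` of the constituent of the type `a` indexed by `J`. -/
def typeN (p : ℕ) (b a : ZMod f → ℤ) (J : Finset (ZMod f)) (i : ZMod f) : ℤ :=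
  if i ∈ J then if i + 1 ∈ J then b i + 2 * a i else b i + 2 * a i - 1
  else if i + 1 ∈ J then p - 2 - b i - 2 * a i else p - 1 - b i - 2 * a i

/-- The exponents `m` of the constituent of the type `a` indexed by `J`. -/
def typeM (b c a : ZMod f → ℤ) (J : Finset (ZMod f)) (i : ZMod f) : ℤ :=
  if i ∈ J then c i - a i
  else if i + 1 ∈ J then c i + b i + a i + 1 else c i + b i + a i

/-- Agreement of J and J' at i is equivalent to agreement at i+1, hence holds everywhere or nowhere
on the cycle. -/
theorem mem_iff_or_mem_iff_not {J J' : Finset (ZMod f)}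
    (h : ∀ i, (i ∈ J ↔ i ∈ J') ↔ (i + 1 ∈ J ↔ i + 1 ∈ J')) :
    J = J' ∨ ∀ i, i ∈ J ↔ i ∉ J' := by
  by_cases h0 : (0 : ZMod f) ∈ J ↔ (0 : ZMod f) ∈ J'
  · exact Or.inl (Finset.ext fun j => ZMod.forall_of_add_one (P := fun i => i ∈ J ↔ i ∈ J')
      (fun i hi => (h i).1 hi) h0 j)
  · refine Or.inr fun j => ?_
    have := ZMod.forall_of_add_one (P := fun i => ¬(i ∈ J ↔ i ∈ J'))
      (fun i hi => (not_congr (h i)).1 hi) h0 j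
    tauto

/-- The constituents of the types for different `(a, J)` are different. -/
theorem typeN_typeM_injective (hp : 1 < p) (hodd : Odd p) {b c a a' : ZMod f → ℤ}
    {J J' : Finset (ZMod f)} (hN : ∀ i, typeN p b a J i = typeN p b a' J' i)
    (hM : ExpCong p (typeM b c a J) (typeM b c a' J')) : a = a' ∧ J = J' := by
  obtain ⟨t, ht⟩ := hodd
  -- As p is odd, the parity of n_i - b_i records whether exactly one of i, i+1 lies in J.
  have hpar : ∀ i, (i ∈ J ↔ i ∈ J') ↔ (i + 1 ∈ J ↔ i + 1 ∈ J') := fun i => by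
    have := hN i
    unfold typeN at this
    split_ifs at this <;> first | tauto | (exfalso; omega)
  rcases mem_iff_or_mem_iff_not hpar with rfl | hJ
  · refine ⟨funext fun i => ?_, rfl⟩
    have := hN i
    unfold typeN at this
    split_ifs at this <;> omega
  · exfalso
    classical
    -- For complementary sets, equality of the n_i turns twice the difference of the m_i into a
    -- telescoping expression in signs ±1. Its digit sum is ±(p^f - 1), whereas the congruence makes
    -- it an even multiple of p^f - 1.
    have h1 : ∀ i, 2 * (typeM b c a J i - typeM b c a' J' i) =
        p * (if i ∈ J then -1 else 1) - (if i + 1 ∈ J then -1 else 1) := fun i => by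
      have h2 := hN i
      have h3 := hJ i
      have h4 := hJ (i + 1)
      unfold typeN at h2
      unfold typeM
      split_ifs at h2 ⊢ <;> first | tauto | omega
    have h2 := digitSum_telescope (p := p) fun i : ZMod f => if i ∈ J then (-1 : ℤ) else 1
    rw [← funext h1, digitSum_mul_left, digitSum_sub] at h2
    obtain ⟨z, hz⟩ := hM
    rw [hz] at h2
    have hq : (1 : ℤ) < (p : ℤ) ^ f := by exact_mod_cast Nat.one_lt_pow (NeZero.ne f) hp
    have h3 : ((p : ℤ) ^ f - 1) * (2 * z) =
        ((p : ℤ) ^ f - 1) * (if (1 : ZMod f) ∈ J then (-1 : ℤ) else 1) := by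
      rw [← h2]; ring
    have h4 := mul_left_cancel₀ (by omega) h3
    split_ifs at h4 <;> omega

/-- The tuples `a` and sets `J` for which the constituent of the type `a` indexed by `J` is of the
form `μ(J, d)`. -/
def Compatible (e : ℕ) (a : ZMod f → ℤ) (J : Finset (ZMod f)) : Prop :=
  ∀ i, (i + 1 ∈ J → 0 ≤ a i ∧ a i ≤ e - 1) ∧ (i + 1 ∉ J → 1 ≤ a i ∧ a i ≤ e)

theorem Compatible.mem_setA {e : ℕ} {a : ZMod f → ℤ} {J : Finset (ZMod f)} (h : Compatible e a J) :
    a ∈ setA f e := fun i => by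
  have := h i
  by_cases hi : i + 1 ∈ J
  · have := this.1 hi
    omega
  · have := this.2 hi
    omega

/-- The tuple `a` for which `μ(J, d)` is a constituent of the type `a`. -/
def typeOf (J : Finset (ZMod f)) (d : ZMod f → ℤ) (i : ZMod f) : ℤ :=
  d i + (if i ∈ J then 1 else 0) - if i + 1 ∈ J then 1 else 0

theorem sum_typeOf (J : Finset (ZMod f)) (d : ZMod f → ℤ) : ∑ i, typeOf J d i = ∑ i, d i := by
  classical
  simp only [typeOf, Finset.sum_sub_distrib, Finset.sum_add_distrib]
  have h : ∑ i : ZMod f, (if i + 1 ∈ J then (1 : ℤ) else 0) = ∑ i, if i ∈ J then 1 else 0 :=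
    Equiv.sum_comp (Equiv.addRight (1 : ZMod f)) fun i => if i ∈ J then (1 : ℤ) else 0
  rw [h, add_sub_cancel_right]

theorem exists_typeOf_eq (J : Finset (ZMod f)) (a : ZMod f → ℤ) : ∃ d, typeOf J d = a := by
  refine ⟨fun i => a i - (if i ∈ J then 1 else 0) + if i + 1 ∈ J then 1 else 0, funext fun i => ?_⟩
  simp only [typeOf]
  ring

/-- The shift by [i ∈ J] - [i+1 ∈ J] carries bounds governed by i ∈ J into the same bounds governed
by i+1 ∈ J. -/
theorem compatible_typeOf_iff {e : ℕ} {J : Finset (ZMod f)} {d : ZMod f → ℤ} :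
    Compatible e (typeOf J d) J ↔ Admissible e J d := by
  refine forall_congr' fun i => ?_
  unfold typeOf
  split_ifs with h1 h2 h2 <;> simp only [h1, h2, forall_const, not_true, not_false_eq_true,
    false_imp_iff, and_true, true_and] <;> omega

theorem typeN_typeOf (b : ZMod f → ℤ) (J : Finset (ZMod f)) (d : ZMod f → ℤ) (i : ZMod f) :
    typeN p b (typeOf J d) J i = muN p b J d i := by
  unfold typeN typeOf muN
  split_ifs <;> ring

theorem expCong_typeM_typeOf (b c : ZMod f → ℤ) (J : Finset (ZMod f)) (d : ZMod f → ℤ) :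
    ExpCong p (muM p b c J d) (typeM b c (typeOf J d) J) := by
  classical
  refine ExpCong.of_sub_eq (fun i => if i ∈ J then 1 else 0) fun i => ?_
  unfold muM typeM typeOf
  split_ifs <;> ring

/-- The compatible sets form an interval S ⊆ J ⊆ T: a_i = 0 forces i+1 into J, a_i = e forces it
out, and otherwise it is free. Positivity of e makes the two requirements exclusive. -/
theorem card_compatible {e : ℕ} (he : 0 < e) {a : ZMod f → ℤ} (ha : a ∈ setA f e) :
    {J : Finset (ZMod f) | Compatible e a J}.ncard = 2 ^ (f - delta e a) := by
  classical
  let S : Finset (ZMod f) := Finset.univ.filter fun i => a (i - 1) = 0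
  let T : Finset (ZMod f) := Finset.univ.filter fun i => a (i - 1) ≠ e
  have hset : {J : Finset (ZMod f) | Compatible e a J} = (Finset.Icc S T : Finset _) := by
    ext J
    simp only [Set.mem_ofPred_eq, Finset.coe_Icc, Set.mem_Icc]
    constructor
    · intro h
      refine ⟨fun i hi => ?_, fun i hi => ?_⟩
      · by_contra hJ
        have h1 := (h (i - 1)).2 (by rwa [sub_add_cancel])
        have h2 := (Finset.mem_filter.1 hi).2
        omega
      · refine Finset.mem_filter.2 ⟨Finset.mem_univ _, fun h2 => ?_⟩
        have h1 := (h (i - 1)).1 (by rwa [sub_add_cancel])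
        omega
    · rintro ⟨h1, h2⟩ i
      have h3 := ha i
      refine ⟨fun hi => ?_, fun hi => ?_⟩
      · have := (Finset.mem_filter.1 (h2 hi)).2
        rw [add_sub_cancel_right] at this
        omega
      · have : a i ≠ 0 := fun h => hi (h1 (Finset.mem_filter.2 ⟨Finset.mem_univ _, by
          rwa [add_sub_cancel_right]⟩))
        omega
  have hST : S ⊆ T := fun i hi => by
    have := (Finset.mem_filter.1 hi).2
    exact Finset.mem_filter.2 ⟨Finset.mem_univ _, by omega⟩
  have hcard : ∀ (P : ℤ → Prop) [DecidablePred P], (Finset.univ.filter fun i : ZMod f => P (a (i - 1))).card =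
      (Finset.univ.filter fun i : ZMod f => P (a i)).card := fun P _ => by
    refine Finset.card_bij (fun i _ => i - 1) (fun i hi => by simpa using hi)
      (fun i _ j _ h => by simpa using h) fun i hi => ⟨i + 1, by simpa using hi, by simp⟩
  have hS : S.card = (Finset.univ.filter fun i => a i = 0).card := hcard fun x => x = 0
  have hT : T.card = (Finset.univ.filter fun i => a i ≠ e).card := hcard fun x => x ≠ e
  rw [hset, Set.ncard_coe_finset, Finset.card_Icc_finset hST, hS, hT]
  congr 1
  have h1 := Finset.card_filter_add_card_filter_not (s := (Finset.univ : Finset (ZMod f)))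
    (fun i => a i = e)
  rw [Finset.card_univ, ZMod.card] at h1
  have h2 : delta e a = (Finset.univ.filter fun i => a i = 0).card +
      (Finset.univ.filter fun i => a i = e).card := by
    rw [delta, Finset.filter_or, Finset.card_union_of_disjoint]
    exact Finset.disjoint_filter.2 fun i _ h h' => by omega
  simp only [ne_eq]
  omega

end Combinatorics

end SerreWeights
end

noncomputable section
namespace SerreWeights

/-! ### The predicted weights and the constituents of the types -/

section PredictedWeights

universe u

variable {p : ℕ} [Fact p.Prime] {k : Type} {F : Type u} [Field k] [Field F] {f : ℕ} [NeZero f]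
  {σ : ZMod f → k →+* F}

/-- The constituent of the type `a` indexed by `J`. -/
def typeWeight (σ : ZMod f → k →+* F) (p : ℕ) (b c a : ZMod f → ℤ) (J : Finset (ZMod f)) :
    Weight σ :=
  Weight.mk σ (typeM b c a J) fun i => (typeN p b a J i).toNat

/-- The pairs `(a, J)` for which the constituent of the type `a` indexed by `J` is predicted. -/
def IsPredicted (p e : ℕ) (b a : ZMod f → ℤ) (J : Finset (ZMod f)) : Prop :=
  Compatible e a J ∨ (J = ∅ ∧ ∀ i, b i = 0 ∧ a i = 0) ∨
    (J = Finset.univ ∧ ∀ i, b i = p - 1 - 2 * e ∧ a i = e)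

/-- The set of predicted weights in terms of congruences between exponents. -/
def predictedSet (σ : ZMod f → k →+* F) (p e : ℕ) (b c : ZMod f → ℤ) : Set (Weight σ) :=
  {w | ∃ (m : ZMod f → ℤ) (n : ZMod f → ℕ), (∀ i, n i ≤ p - 1) ∧ w = Weight.mk σ m n ∧
    ∃ (J : Finset (ZMod f)) (d : ZMod f → ℤ), Admissible e J d ∧
      ExpCong p (fun i => if i ∈ J then m i + n i + e - d i else m i + e - d i)
        (fun i => c i + (b i + e)) ∧
      ExpCong p (fun i => if i ∈ J then m i + d i else m i + n i + d i) c}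

theorem IsPredicted.mem_setA {e : ℕ} {b a : ZMod f → ℤ} {J : Finset (ZMod f)}
    (h : IsPredicted p e b a J) : a ∈ setA f e := by
  rcases h with h | ⟨-, h⟩ | ⟨-, h⟩
  · exact h.mem_setA
  · intro i
    have := h i
    omega
  · intro i
    have := h i
    omega

theorem typeN_le {e : ℕ} {b a : ZMod f → ℤ}
    (hb : ∀ i, (e : ℤ) ≤ b i + e ∧ b i + e ≤ p - 1 - e) (ha : a ∈ setA f e)
    (J : Finset (ZMod f)) (i : ZMod f) : -1 ≤ typeN p b a J i ∧ typeN p b a J i ≤ p - 1 := by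
  have h1 := hb i
  have h2 := ha i
  unfold typeN
  split_ifs <;> omega

/-- Ensures that a predicted pair never indexes a vanishing candidate (typeN = -1), so passing to
natural numbers is harmless. -/
theorem IsPredicted.typeN_nonneg {e : ℕ} {b a : ZMod f → ℤ}
    (hb : ∀ i, (e : ℤ) ≤ b i + e ∧ b i + e ≤ p - 1 - e) {J : Finset (ZMod f)}
    (h : IsPredicted p e b a J) (i : ZMod f) : 0 ≤ typeN p b a J i := by
  have h1 := hb i
  rcases h with h | ⟨rfl, h⟩ | ⟨rfl, h⟩
  · have h2 := h i
    unfold typeN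
    split_ifs with h3 h4 h4 <;> simp only [h4, not_true, not_false_eq_true, false_imp_iff, true_imp_iff, and_true, true_and] at h2 <;> omega
  · have := h i
    simp only [typeN, Finset.notMem_empty, if_false]
    omega
  · have := h i
    simp only [typeN, Finset.mem_univ, if_true]
    omega

variable (hσ : ∀ i x, σ (i + 1) x ^ p = σ i x) (hk : Nat.card k = p ^ f)

include hσ hk

theorem Weight.mk_congr {m m' : ZMod f → ℤ} (n : ZMod f → ℕ) (h : ExpCong p m m') :
    Weight.mk σ m n = Weight.mk σ m' n := by
  rw [Weight.mk_eq_mk_iff, mu_congr σ n ((prod_embedding_eq_iff hσ hk m m').2 h)]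
  exact ⟨Representation.Equiv.refl _⟩

theorem Weight.mk_eq_mk_iff_expCong {m m' : ZMod f → ℤ} {n n' : ZMod f → ℕ}
    (hn : ∀ i, n i ≤ p - 1) (hn' : ∀ i, n' i ≤ p - 1) :
    Weight.mk σ m n = Weight.mk σ m' n' ↔ n = n' ∧ ExpCong p m m' := by
  rw [Weight.mk_eq_mk_iff, isoRep_mu_iff hσ hk hn hn', prod_embedding_eq_iff hσ hk]
  rfl

theorem muJd_eq_typeWeight (b c : ZMod f → ℤ) (J : Finset (ZMod f)) (d : ZMod f → ℤ) :
    muJd σ p b c J d = typeWeight σ p b c (typeOf J d) J := by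
  rw [muJd, Weight.mk_congr hσ hk _ (expCong_typeM_typeOf b c J d), typeWeight]
  simp only [typeN_typeOf]

theorem setW_eq (e : ℕ) (b c : ZMod f → ℤ) :
    setW σ p e b c = {w | ∃ a J, Compatible e a J ∧ w = typeWeight σ p b c a J} := by
  ext w
  constructor
  · rintro ⟨J, d, hd, rfl⟩
    exact ⟨_, J, compatible_typeOf_iff.2 hd, muJd_eq_typeWeight hσ hk b c J d⟩
  · rintro ⟨a, J, h, rfl⟩
    obtain ⟨d, rfl⟩ := exists_typeOf_eq J a
    exact ⟨J, d, compatible_typeOf_iff.1 h, (muJd_eq_typeWeight hσ hk b c J d).symm⟩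

omit [Fact p.Prime] hσ hk in
theorem expCong_const : ExpCong p (fun _ : ZMod f => (p : ℤ) - 1) fun _ => 0 :=
  ExpCong.of_sub_eq (fun _ => 1) fun i => by ring

variable (hp : p ≠ 2) {e : ℕ} (he : 0 < e) {b : ZMod f → ℤ}
  (hb : ∀ i, (e : ℤ) ≤ b i + e ∧ b i + e ≤ p - 1 - e) (c : ZMod f → ℤ)

include hp hb in
theorem typeWeight_injective {a a' : ZMod f → ℤ} {J J' : Finset (ZMod f)} (ha : a ∈ setA f e)
    (ha' : a' ∈ setA f e) (hJ : ∀ i, 0 ≤ typeN p b a J i) (hJ' : ∀ i, 0 ≤ typeN p b a' J' i)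
    (h : typeWeight σ p b c a J = typeWeight σ p b c a' J') : a = a' ∧ J = J' := by
  have hpp : p.Prime := Fact.out
  have h1 := typeN_le hb ha J
  have h2 := typeN_le hb ha' J'
  rw [typeWeight, typeWeight, Weight.mk_eq_mk_iff_expCong hσ hk
    (fun i => by have := h1 i; omega) fun i => by have := h2 i; omega] at h
  refine typeN_typeM_injective hpp.one_lt (hpp.odd_of_ne_two hp) (fun i => ?_) h.2
  have h3 := congrFun h.1 i
  have h4 := hJ i
  have h5 := hJ' i
  omega

omit [Fact p.Prime] hσ hk in
/-- The congruence for the second character, relative to that for the first. -/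
theorem expCong_second_iff {m d : ZMod f → ℤ} {n : ZMod f → ℕ} {J : Finset (ZMod f)}
    (h : ExpCong p (fun i => if i ∈ J then m i + d i else m i + n i + d i) c) :
    ExpCong p (fun i => if i ∈ J then m i + n i + e - d i else m i + e - d i)
        (fun i => c i + (b i + e)) ↔
      ExpCong p (fun i => if i ∈ J then (n i : ℤ) else -n i)
        (fun i => b i + 2 * d i) := by
  classical
  have hd := ExpCong.refl (p := p) fun i => (e : ℤ) - 2 * d i
  constructor
  · intro h'
    have h1 := (h'.sub h).sub hd
    refine (cast ?_ h1)
    congr 1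
    · funext i
      split_ifs <;> ring
    · funext i
      ring
  · intro h'
    have h1 := (h'.add h).add hd
    refine (cast ?_ h1)
    congr 1
    · funext i
      split_ifs <;> ring
    · funext i
      ring

omit hσ hk in
theorem muJd_mem_predictedSet {J : Finset (ZMod f)} {d : ZMod f → ℤ}
    (hb : ∀ i, (e : ℤ) ≤ b i + e ∧ b i + e ≤ p - 1 - e) (hd : Admissible e J d) :
    muJd σ p b c J d ∈ predictedSet σ p e b c := by
  classical
  have hn := muN_mem hb hd
  have h1 : ExpCong p (fun i => if i ∈ J then muM p b c J d i + d i
      else muM p b c J d i + (muN p b J d i).toNat + d i) c := by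
    refine ExpCong.of_sub_eq (fun _ => 1) fun i => ?_
    have h2 : ((muN p b J d i).toNat : ℤ) = muN p b J d i := by have := hn i; omega
    rw [h2]
    unfold muM muN
    split_ifs <;> ring
  refine ⟨_, _, fun i => by have := hn i; omega, rfl, J, d, hd, (expCong_second_iff c h1).2 ?_, h1⟩
  refine ExpCong.of_sub_eq (fun i => if i ∈ J then 0 else -1) fun i => ?_
  have h2 : ((muN p b J d i).toNat : ℤ) = muN p b J d i := by have := hn i; omega
  rw [h2]
  unfold muN
  split_ifs <;> ring

/-- For given (J,d), the congruence for the quotient of the characters fixes the signed exponents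
±n_i, which μ(J,d) also realises. Up to the two corners of the box this forces n to be that of
μ(J,d), and the congruence for χ₁ then fixes m. The corners give the exceptional weights. -/
theorem predictedSet_eq (he : 0 < e)
    (hb : ∀ i, (e : ℤ) ≤ b i + e ∧ b i + e ≤ p - 1 - e) :
    predictedSet σ p e b c = {w | ∃ a J, IsPredicted p e b a J ∧ w = typeWeight σ p b c a J} := by
  classical
  have hpp : p.Prime := Fact.out
  have hp1 := hpp.one_lt
  ext w
  constructor
  · rintro ⟨m, n, hn, rfl, J, d, hd, h2, h1⟩
    rw [expCong_second_iff c h1] at h2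
    have hN := muN_mem hb hd
    have h3 : ExpCong p (fun i => if i ∈ J then muN p b J d i else -muN p b J d i)
        (fun i => b i + 2 * d i) := by
      refine ExpCong.of_sub_eq (fun i => if i ∈ J then 0 else -1) fun i => ?_
      unfold muN
      split_ifs <;> ring
    -- Adding p - 1 outside J turns -n_i into p - 1 - n_i, which brings both sides into the box [0,
    -- p-1].
    have h4 := (h2.trans h3.symm).add
      (ExpCong.refl (p := p) fun i => if i ∈ J then (0 : ℤ) else p - 1)
    have h5 := fun h5 h6 => eq_or_of_expCong hp1 h5 h6 h4
    rcases h5 (fun i => by have := hn i; split_ifs <;> omega)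
      (fun i => by have := hN i; split_ifs <;> omega) with h5 | h5 | h5
    · have h6 : ∀ i, (n i : ℤ) = muN p b J d i := fun i => by
        have := congrFun h5 i
        split_ifs at this <;> omega
      refine ⟨typeOf J d, J, Or.inl (compatible_typeOf_iff.2 hd), ?_⟩
      rw [← muJd_eq_typeWeight hσ hk, muJd]
      have h7 : n = fun i => (muN p b J d i).toNat := funext fun i => by
        have := h6 i
        omega
      rw [← h7]
      refine Weight.mk_congr hσ hk n ?_
      have h8 : ExpCong p (fun i => if i ∈ J then muM p b c J d i + d i
          else muM p b c J d i + n i + d i) c := by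
        refine ExpCong.of_sub_eq (fun _ => 1) fun i => ?_
        rw [h6]
        unfold muM muN
        split_ifs <;> ring
      have h9 := (h1.trans h8.symm).sub
        (ExpCong.refl (p := p) fun i => if i ∈ J then d i else n i + d i)
      refine cast ?_ h9
      congr 1 <;> funext i <;> split_ifs <;> ring
    -- First corner: an element of J would need `muN` equal to p - 1, but `muN` is at most p - 2.
    -- With J empty, `muN` = 0 forces b_i = p - 1 - 2e and d_i = e.
    · have hJ : ∀ i, i ∉ J := fun i hi => by
        have h6 := h5 i
        have h7 := hN i
        simp only [hi, if_true] at h6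
        omega
      have hJ' : J = ∅ := Finset.eq_empty_of_forall_notMem hJ
      subst hJ'
      have h6 : ∀ i, b i = p - 1 - 2 * e ∧ d i = e ∧ n i = p - 1 := fun i => by
        have h7 := h5 i
        have h8 := hb i
        have h9 := (hd i).2 (hJ i)
        simp only [muN, Finset.notMem_empty, if_false] at h7
        omega
      refine ⟨fun _ => e, Finset.univ, Or.inr (Or.inr ⟨rfl, fun i => ⟨(h6 i).1, rfl⟩⟩), ?_⟩
      have h7 : n = fun i => (typeN p b (fun _ => e) Finset.univ i).toNat := funext fun i => by
        have := h6 i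
        simp only [typeN, Finset.mem_univ, if_true]
        omega
      rw [typeWeight, ← h7]
      refine Weight.mk_congr hσ hk n ?_
      have h8 := (h1.sub (ExpCong.refl (p := p) fun i => (e : ℤ))).sub (expCong_const)
      refine cast ?_ h8
      congr 1
      · funext i
        have := h6 i
        simp only [Finset.notMem_empty, if_false]
        omega
      · funext i
        simp [typeM]
    -- Second corner: now it is an element outside J that would need `muN` equal to p - 1. With J
    -- everything, b_i + 2d_i = 0 forces b = d = 0.
    · have hJ : ∀ i, i ∈ J := fun i => by
        by_contra hi
        have h6 := h5 i
        have h7 := hN i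
        simp only [hi, if_false] at h6
        omega
      have hJ' : J = Finset.univ := Finset.eq_univ_of_forall hJ
      subst hJ'
      have h6 : ∀ i, b i = 0 ∧ d i = 0 ∧ n i = p - 1 := fun i => by
        have h7 := h5 i
        have h8 := hb i
        have h9 := (hd i).1 (hJ i)
        simp only [muN, Finset.mem_univ, if_true] at h7
        omega
      refine ⟨fun _ => 0, ∅, Or.inr (Or.inl ⟨rfl, fun i => ⟨(h6 i).1, rfl⟩⟩), ?_⟩
      have h7 : n = fun i => (typeN p b (fun _ => 0) ∅ i).toNat := funext fun i => by
        have := h6 i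
        simp only [typeN, Finset.notMem_empty, if_false]
        omega
      rw [typeWeight, ← h7]
      refine Weight.mk_congr hσ hk n ?_
      refine cast ?_ h1
      congr 1
      · funext i
        have := h6 i
        simp only [Finset.mem_univ, if_true]
        omega
      · funext i
        have := h6 i
        simp only [typeM, Finset.notMem_empty, if_false]
        omega
  · rintro ⟨a, J, h | ⟨rfl, h⟩ | ⟨rfl, h⟩, rfl⟩
    · obtain ⟨d, rfl⟩ := exists_typeOf_eq J a
      rw [← muJd_eq_typeWeight hσ hk]
      exact muJd_mem_predictedSet c hb (compatible_typeOf_iff.1 h)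
    · have h1 : ExpCong p (fun i => if i ∈ (Finset.univ : Finset (ZMod f)) then
          typeM b c a ∅ i + 0 else typeM b c a ∅ i + (typeN p b a ∅ i).toNat + 0) c := by
        refine ExpCong.of_sub_eq (fun _ => 0) fun i => ?_
        have := h i
        simp only [typeM, Finset.notMem_empty, Finset.mem_univ, if_false, if_true]
        omega
      refine ⟨_, _, fun i => ?_, rfl, Finset.univ, fun _ => 0, fun i => ⟨fun _ => ?_, fun hi => ?_⟩,
        (expCong_second_iff c h1).2 ?_, h1⟩
      · have := h i
        simp only [typeN, Finset.notMem_empty, if_false]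
        omega
      · change (0 : ℤ) ≤ 0 ∧ (0 : ℤ) ≤ e - 1
        omega
      · simp at hi
      · refine ExpCong.of_sub_eq (fun _ => 1) fun i => ?_
        have := h i
        simp only [typeN, Finset.notMem_empty, Finset.mem_univ, if_false, if_true]
        omega
    · have h1 : ExpCong p (fun i => if i ∈ (∅ : Finset (ZMod f)) then
          typeM b c a Finset.univ i + e else
          typeM b c a Finset.univ i + (typeN p b a Finset.univ i).toNat + e) c := by
        refine ExpCong.of_sub_eq (fun _ => 1) fun i => ?_
        have := h i
        simp only [typeM, typeN, Finset.notMem_empty, Finset.mem_univ, if_false, if_true]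
        omega
      refine ⟨_, _, fun i => ?_, rfl, ∅, fun _ => e, fun i => ⟨fun hi => ?_, fun _ => ?_⟩,
        (expCong_second_iff c h1).2 ?_, h1⟩
      · have := h i
        simp only [typeN, Finset.mem_univ, if_true]
        omega
      · simp at hi
      · change (1 : ℤ) ≤ e ∧ (e : ℤ) ≤ e
        omega
      · refine ExpCong.of_sub_eq (fun _ => -2) fun i => ?_
        have := h i
        simp only [typeN, Finset.notMem_empty, Finset.mem_univ, if_false, if_true]
        omega

omit hσ hk in
-- In the exceptional cases a = d, and the additional weight is indexed by the complement of J.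
theorem muPrimeJd_eq_typeWeight {J : Finset (ZMod f)} {d : ZMod f → ℤ} (h : Exceptional p e b J d) :
    ∃ J', IsPredicted p e b d J' ∧ muPrimeJd σ p e c J = typeWeight σ p b c d J' := by
  rcases h with ⟨rfl, h⟩ | ⟨rfl, h⟩
  · refine ⟨∅, Or.inr (Or.inl ⟨rfl, h⟩), ?_⟩
    rw [muPrimeJd, typeWeight]
    congr 1
    · funext i
      have := h i
      simp only [typeM, Finset.notMem_empty, Finset.mem_univ, if_false, if_true]
      omega
    · funext i
      have := h i
      simp only [typeN, Finset.notMem_empty, if_false]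
      omega
  · refine ⟨Finset.univ, Or.inr (Or.inr ⟨rfl, h⟩), ?_⟩
    rw [muPrimeJd, typeWeight]
    congr 1
    · funext i
      have := h i
      simp only [typeM, Finset.notMem_empty, Finset.mem_univ, if_false, if_true]
      omega
    · funext i
      have := h i
      simp only [typeN, Finset.mem_univ, if_true]
      omega

end PredictedWeights

end SerreWeights
end

noncomputable section
namespace SerreWeights

/-! ### Intersections of the predicted weights with the constituents of the types -/

section TypeConstituents

universe u

variable {p : ℕ} [Fact p.Prime] {k : Type} {F : Type u} [Field k] [Field F] [Finite F] {f : ℕ}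
  [NeZero f] {σ : ZMod f → k →+* F} (hσ : ∀ i x, σ (i + 1) x ^ p = σ i x)
  (hk : Nat.card k = p ^ f) (hp : p ≠ 2) {e : ℕ} (he : 0 < e) {b : ZMod f → ℤ}
  (hb : ∀ i, (e : ℤ) ≤ b i + e ∧ b i + e ≤ p - 1 - e) (c : ZMod f → ℤ) {a : ZMod f → ℤ}
  (ha : a ∈ setA f e)

/-- The set of the constituents of the reduction of `θ_a`. -/
def thetaSet (σ : ZMod f → k →+* F) (p : ℕ) [Fact p.Prime] (b c a : ZMod f → ℤ) :
    Set (Weight σ) :=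
  {w | ∃ m n, w = Weight.mk σ m n ∧
    IsConstituentTheta (U := MuSpace F n) p σ b c a (mu σ m n)}

/-- The set of the constituents of the reduction of `θ'_a`. -/
def thetaSet' (σ : ZMod f → k →+* F) (p : ℕ) [Fact p.Prime] (b c a : ZMod f → ℤ) :
    Set (Weight σ) :=
  {w | ∃ m n, w = Weight.mk σ m n ∧
    IsConstituentTheta' (U := MuSpace F n) p σ b c a (mu σ m n)}

include hb ha in
-- Identifies the candidates for r = b + 2a with `typeN`; the shift by one is the passage from
-- dimension to degree.
theorem constDim_eq (J : Finset (ZMod f)) (i : ZMod f) :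
    (constDim p (fun i => (b i + 2 * a i).toNat) J i : ℤ) = typeN p b a J i + 1 := by
  have h1 := hb i
  have h2 := ha i
  unfold constDim typeN
  by_cases h3 : i ∈ J <;> by_cases h4 : i + 1 ∈ J <;> simp only [h3, h4, decide_true,
    decide_false, if_true, if_false, transferDim] <;> omega

include hb ha in
theorem constDet_eq (J : Finset (ZMod f)) :
    constDet (fun i => (b i + 2 * a i).toNat) (fun i => c i - a i) J = typeM b c a J := by
  funext i
  have h1 := hb i
  have h2 := ha i
  unfold constDet typeM
  by_cases h3 : i ∈ J <;> by_cases h4 : i + 1 ∈ J <;> simp only [h3, h4, decide_true,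
    decide_false, if_true, if_false, transferDet] <;> omega

include hb ha in
theorem constWeight_eq (J : Finset (ZMod f)) :
    constWeight σ p (fun i => (b i + 2 * a i).toNat) (fun i => c i - a i) J =
      typeWeight σ p b c a J := by
  rw [constWeight, typeWeight, constDet_eq hb c ha]
  congr 1
  funext i
  have := constDim_eq hb ha J i
  omega

include hσ hk hp hb ha

theorem constWeight_separated (J J' : Finset (ZMod f))
    (hN : ∀ i, constDim p (fun i => (b i + 2 * a i).toNat) J i =
      constDim p (fun i => (b i + 2 * a i).toNat) J' i)
    (hM : ∀ x : k, x ≠ 0 →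
      ∏ i, σ i x ^ constDet (fun i => (b i + 2 * a i).toNat) (fun i => c i - a i) J i =
        ∏ i, σ i x ^ constDet (fun i => (b i + 2 * a i).toNat) (fun i => c i - a i) J' i) :
    J = J' := by
  have hpp : p.Prime := Fact.out
  rw [prod_embedding_eq_iff hσ hk, constDet_eq hb c ha, constDet_eq hb c ha] at hM
  refine (typeN_typeM_injective hpp.one_lt (hpp.odd_of_ne_two hp) (b := b) (fun i => ?_) hM).2
  have h1 := constDim_eq (p := p) hb ha J i
  have h2 := constDim_eq (p := p) hb ha J' i
  have h3 := hN i
  omega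

theorem thetaSet'_eq : thetaSet' σ p b c a =
    {w | ∃ J, (∀ i, 0 ≤ typeN p b a J i) ∧ w = typeWeight σ p b c a J} := by
  have hpp : p.Prime := Fact.out
  have hr : ∀ i, (b i + 2 * a i).toNat < p := fun i => by
    have h1 := hb i
    have h2 := ha i
    have := hpp.one_lt
    omega
  have hra : ∀ i, b i + 2 * a i = (b i + 2 * a i).toNat := fun i => by
    have h1 := hb i
    have h2 := ha i
    omega
  have key := isConstituentTheta'_iff hσ hk hr (c := c) hra fun J J' _ _ hN hM =>
    constWeight_separated hσ hk hp hb c ha J J' hN hM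
  have hval : ∀ J : Finset (ZMod f), (∀ i, constDim p (fun i => (b i + 2 * a i).toNat) J i ≠ 0) ↔
      ∀ i, 0 ≤ typeN p b a J i := fun J => forall_congr' fun i => by
    have := constDim_eq (p := p) hb ha J i
    omega
  simp only [hval, constWeight_eq hb c ha] at key
  ext w
  constructor
  · rintro ⟨m, n, rfl, h⟩
    exact (key m n).1 h
  · rintro ⟨J, hJ, rfl⟩
    exact ⟨_, _, rfl, (key _ _).2 ⟨J, hJ, rfl⟩⟩

include he

/-- A predicted weight comes from some pair (a', J'); if it is also a constituent of θ'_a,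
injectivity forces a' = a. -/
theorem predictedSet_inter_thetaSet' : predictedSet σ p e b c ∩ thetaSet' σ p b c a =
    {w | ∃ J, IsPredicted p e b a J ∧ w = typeWeight σ p b c a J} := by
  rw [predictedSet_eq hσ hk c he hb, thetaSet'_eq hσ hk hp hb c ha]
  ext w
  constructor
  · rintro ⟨⟨a', J', h, rfl⟩, J, hJ, h'⟩
    obtain ⟨rfl, rfl⟩ := typeWeight_injective hσ hk hp hb c h.mem_setA ha (h.typeN_nonneg hb) hJ h'
    exact ⟨J', h, rfl⟩
  · rintro ⟨J, h, rfl⟩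
    exact ⟨⟨a, J, h, rfl⟩, J, h.typeN_nonneg hb, rfl⟩

/-- For a non-scalar type θ_a = θ'_a, and the exceptional pairs do not arise since they make the
type scalar. For a scalar type there is exactly one compatible J, and its weight is the reduction of
ψ ∘ det. -/
theorem predictedSet_inter_thetaSet : predictedSet σ p e b c ∩ thetaSet σ p b c a =
    {w | ∃ J, Compatible e a J ∧ w = typeWeight σ p b c a J} := by
  have hpp : p.Prime := Fact.out
  have hp1 := hpp.one_lt
  have hr : ∀ i, (b i + 2 * a i).toNat < p := fun i => by
    have h1 := hb i
    have h2 := ha i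
    omega
  have hra : ∀ i, b i + 2 * a i = (b i + 2 * a i).toNat := fun i => by
    have h1 := hb i
    have h2 := ha i
    omega
  -- The quotient of the two characters has exponents b_i + 2a_i in the box [0, p-1], so it is
  -- trivial only at the two corners.
  have hscalar : typeChar₁ p σ b c a = typeChar₂ p σ c a ↔
      (∀ i, b i + 2 * a i = 0) ∨ ∀ i, b i + 2 * a i = p - 1 := by
    rw [typeChar_eq_iff hra]
    have h1 : (∀ x : k, x ≠ 0 → ∏ i, σ i x ^ (b i + 2 * a i).toNat = 1) ↔
        ExpCong p (fun i => b i + 2 * a i) fun _ => 0 := by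
      rw [ExpCong, ← prod_embedding_eq_iff hσ hk]
      refine forall₂_congr fun x _ => ?_
      have : ∀ i, σ i x ^ (b i + 2 * a i) = σ i x ^ (b i + 2 * a i).toNat := fun i => by
        rw [← zpow_natCast, ← hra]
      simp only [this, zpow_zero, Finset.prod_const_one]
    rw [h1]
    constructor
    · intro h
      have h2 := fun h2 h3 => eq_or_of_expCong hp1 h2 h3 h
      rcases h2 (fun i => by have := hb i; have := ha i; omega) (fun i => by omega) with h | h | h
      · exact Or.inl fun i => congrFun h i
      · exact Or.inl fun i => (h i).1
      · exact Or.inr fun i => (h i).1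
    · rintro (h | h)
      · rw [funext h]
        exact ExpCong.refl _
      · rw [funext h]
        exact expCong_const
  by_cases h : typeChar₁ p σ b c a = typeChar₂ p σ c a
  · have key := isConstituentTheta_iff_of_eq hσ hk hra h
    -- Both scalar cases reduce to exhibiting the unique compatible set: everything if a = 0,
    -- nothing if a_i = e for all i.
    have hmem : ∀ J, (∀ J', Compatible e a J' ↔ J' = J) →
        Weight.mk σ (fun i => c i - a i) (fun _ => 0) = typeWeight σ p b c a J →
        predictedSet σ p e b c ∩ thetaSet σ p b c a =
          {w | ∃ J, Compatible e a J ∧ w = typeWeight σ p b c a J} := by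
      intro J hJ hw
      ext w
      constructor
      · rintro ⟨-, m, n, rfl, h1⟩
        exact ⟨J, (hJ J).2 rfl, ((key m n).1 h1).trans hw⟩
      · rintro ⟨J', h1, rfl⟩
        obtain rfl := (hJ J').1 h1
        rw [predictedSet_eq hσ hk c he hb]
        exact ⟨⟨a, J', Or.inl h1, rfl⟩, _, _, hw.symm, (key _ _).2 rfl⟩
    rcases hscalar.1 h with h0 | h0
    · have h1 : ∀ i, b i = 0 ∧ a i = 0 := fun i => by
        have h1 := hb i
        have h2 := ha i
        have h3 := h0 i
        omega
      refine hmem Finset.univ (fun J => ⟨fun hJ => ?_, ?_⟩) ?_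
      · refine Finset.eq_univ_of_forall fun i => ?_
        by_contra hi
        have h2 := (hJ (i - 1)).2 (by rwa [sub_add_cancel])
        have h3 := h1 (i - 1)
        omega
      · rintro rfl i
        have h3 := h1 i
        simp only [Finset.mem_univ, not_true, false_imp_iff, and_true, true_imp_iff]
        omega
      · rw [typeWeight]
        congr 1
        · funext i
          simp [typeM]
        · funext i
          simp [typeN, h0]
    · have h1 : ∀ i, b i = p - 1 - 2 * e ∧ a i = e := fun i => by
        have h1 := hb i
        have h2 := ha i
        have h3 := h0 i
        omega
      refine hmem ∅ (fun J => ⟨fun hJ => ?_, ?_⟩) ?_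
      · refine Finset.eq_empty_of_forall_notMem fun i hi => ?_
        have h2 := (hJ (i - 1)).1 (by rwa [sub_add_cancel])
        have h3 := h1 (i - 1)
        omega
      · rintro rfl i
        have h3 := h1 i
        simp only [Finset.notMem_empty, not_false_eq_true, false_imp_iff, true_and, true_imp_iff]
        omega
      · have h2 : (fun _ => 0) = fun i => (typeN p b a ∅ i).toNat := funext fun i => by
          have := h0 i
          simp only [typeN, Finset.notMem_empty, if_false]
          omega
        rw [typeWeight, ← h2]
        refine Weight.mk_congr hσ hk _ (ExpCong.symm (ExpCong.of_sub_eq (fun _ => 1) fun i => ?_))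
        have := h0 i
        simp only [typeM, Finset.notMem_empty, if_false]
        omega
  · have h1 : thetaSet σ p b c a = thetaSet' σ p b c a := by
      unfold thetaSet thetaSet' IsConstituentTheta IsConstituentTheta'
      simp only [h, false_and, or_false]
    rw [h1, predictedSet_inter_thetaSet' hσ hk hp he hb c ha]
    refine Set.ext fun w => exists_congr fun J => and_congr_left fun _ => ⟨?_, Or.inl⟩
    rintro (h2 | ⟨-, h2⟩ | ⟨-, h2⟩)
    · exact h2
    · refine absurd (hscalar.2 (Or.inl fun i => ?_)) h
      have := h2 i
      omega
    · refine absurd (hscalar.2 (Or.inr fun i => ?_)) h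
      have := h2 i
      omega

theorem ncard_predictedSet_inter_thetaSet :
    (predictedSet σ p e b c ∩ thetaSet σ p b c a).ncard = 2 ^ (f - delta e a) := by
  have h : predictedSet σ p e b c ∩ thetaSet σ p b c a =
      typeWeight σ p b c a '' {J | Compatible e a J} := by
    rw [predictedSet_inter_thetaSet hσ hk hp he hb c ha]
    ext w
    simp only [Set.mem_image, Set.mem_ofPred_eq, eq_comm]
  rw [h, Set.InjOn.ncard_image, card_compatible he ha]
  intro J hJ J' hJ' h
  have h1 : IsPredicted p e b a J := Or.inl hJ
  have h2 : IsPredicted p e b a J' := Or.inl hJ'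
  exact (typeWeight_injective hσ hk hp hb c ha ha (h1.typeN_nonneg hb) (h2.typeN_nonneg hb) h).2

end TypeConstituents

/-! ### The decomposition in terms of congruences -/

section Main

universe u

variable {p : ℕ} [Fact p.Prime] {k : Type} {F : Type u} [Field k] [Field F] [Finite F] {f : ℕ}
  [NeZero f] {σ : ZMod f → k →+* F}

/-- The decomposition of the predicted weights according to types, for the sets of weights defined
by congruences. -/
theorem predictedSet_decomposition (hσ : ∀ i x, σ (i + 1) x ^ p = σ i x)
    (hk : Nat.card k = p ^ f) (hp : p ≠ 2) {e : ℕ} (he : 0 < e) {b : ZMod f → ℤ}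
    (hb : ∀ i, (e : ℤ) ≤ b i + e ∧ b i + e ≤ p - 1 - e) (c : ZMod f → ℤ) :
    (setW σ p e b c = ⋃ a ∈ setA f e, predictedSet σ p e b c ∩ thetaSet σ p b c a) ∧
    (setA f e).PairwiseDisjoint (fun a => predictedSet σ p e b c ∩ thetaSet σ p b c a) ∧
    (predictedSet σ p e b c = ⋃ a ∈ setA f e, predictedSet σ p e b c ∩ thetaSet' σ p b c a) ∧
    (setA f e).PairwiseDisjoint (fun a => predictedSet σ p e b c ∩ thetaSet' σ p b c a) ∧
    (∀ a ∈ setA f e,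
      (predictedSet σ p e b c ∩ thetaSet σ p b c a).ncard = 2 ^ (f - delta e a)) ∧
    (∀ a ∈ setA f e, ∀ J d, Admissible e J d →
      muJd σ p b c J d ∈ predictedSet σ p e b c ∩ thetaSet' σ p b c a → ∑ i, a i = ∑ i, d i) ∧
    (∀ a ∈ setA f e, ∀ J d, Exceptional p e b J d →
      muPrimeJd σ p e c J ∈ predictedSet σ p e b c ∩ thetaSet' σ p b c a →
        ∑ i, a i = ∑ i, d i) := by
  have h1 := fun a ha => predictedSet_inter_thetaSet' hσ hk hp he hb c (a := a) ha
  have h2 := fun a ha => predictedSet_inter_thetaSet hσ hk hp he hb c (a := a) ha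
  have hinj : ∀ a a' J J', IsPredicted p e b a J → IsPredicted p e b a' J' →
      typeWeight σ p b c a J = typeWeight σ p b c a' J' → a = a' := fun a a' J J' h h' hw =>
    (typeWeight_injective hσ hk hp hb c h.mem_setA h'.mem_setA (h.typeN_nonneg hb)
      (h'.typeN_nonneg hb) hw).1
  refine ⟨?_, ?_, ?_, ?_, fun a ha => ncard_predictedSet_inter_thetaSet hσ hk hp he hb c ha,
    ?_, ?_⟩
  · rw [setW_eq hσ hk]
    ext w
    simp only [Set.mem_iUnion₂]
    constructor
    · rintro ⟨a, J, h, rfl⟩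
      exact ⟨a, h.mem_setA, by rw [h2 a h.mem_setA]; exact ⟨J, h, rfl⟩⟩
    · rintro ⟨a, ha, hw⟩
      rw [h2 a ha] at hw
      exact ⟨a, hw⟩
  · intro a ha a' ha' hne
    simp only [Function.onFun]
    rw [h2 a ha, h2 a' ha', Set.disjoint_left]
    rintro w ⟨J, h, rfl⟩ ⟨J', h', hw⟩
    exact hne (hinj a a' J J' (Or.inl h) (Or.inl h') hw)
  · ext w
    simp only [Set.mem_iUnion₂]
    constructor
    · intro hw
      rw [predictedSet_eq hσ hk c he hb] at hw
      obtain ⟨a, J, h, rfl⟩ := hw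
      exact ⟨a, h.mem_setA, by rw [h1 a h.mem_setA]; exact ⟨J, h, rfl⟩⟩
    · rintro ⟨a, ha, hw⟩
      exact hw.1
  · intro a ha a' ha' hne
    simp only [Function.onFun]
    rw [h1 a ha, h1 a' ha', Set.disjoint_left]
    rintro w ⟨J, h, rfl⟩ ⟨J', h', hw⟩
    exact hne (hinj a a' J J' h h' hw)
  · intro a ha J d hd hw
    rw [h1 a ha, muJd_eq_typeWeight hσ hk] at hw
    obtain ⟨J', h, hw⟩ := hw
    rw [← hinj _ _ _ _ (Or.inl (compatible_typeOf_iff.2 hd)) h hw, sum_typeOf]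
  · intro a ha J d hd hw
    obtain ⟨J₁, hJ₁, hw₁⟩ := muPrimeJd_eq_typeWeight (σ := σ) c hd
    rw [h1 a ha, hw₁] at hw
    obtain ⟨J', h, hw⟩ := hw
    rw [← hinj _ _ _ _ hJ₁ h hw]

end Main

end SerreWeights
end

noncomputable section
namespace SerreWeights

/-! ### Automorphisms with prescribed action on the residue field -/

section Residue

variable {p : ℕ} [Fact p.Prime]

/-- The ring of integers of the algebraic closure. -/
def integers (p : ℕ) [Fact p.Prime] : Subring (PadicAlgCl p) where
  carrier := {x | ‖x‖ ≤ 1}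
  one_mem' := by simp
  zero_mem' := by simp
  mul_mem' {a b} ha hb := by
    simp only [Set.mem_ofPred_eq, norm_mul] at *
    exact mul_le_one₀ ha (norm_nonneg _) hb
  add_mem' {a b} ha hb := (IsUltrametricDist.norm_add_le_max a b).trans (max_le ha hb)
  neg_mem' {a} ha := by simpa using ha

theorem mem_integers {x : PadicAlgCl p} : x ∈ integers p ↔ ‖x‖ ≤ 1 := Iff.rfl

/-- The maximal ideal of the ring of integers of the algebraic closure. -/
def integersIdeal (p : ℕ) [Fact p.Prime] : Ideal (integers p) where
  carrier := {x | ‖(x : PadicAlgCl p)‖ < 1}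
  zero_mem' := by simp
  add_mem' {a b} ha hb := (IsUltrametricDist.norm_add_le_max (a : PadicAlgCl p) b).trans_lt
    (max_lt ha hb)
  smul_mem' c x hx := by
    have hc : ‖(c : PadicAlgCl p)‖ ≤ 1 := c.2
    have hx' : ‖(x : PadicAlgCl p)‖ < 1 := hx
    change ‖(c : PadicAlgCl p) * x‖ < 1
    rw [norm_mul]
    exact mul_lt_one_of_nonneg_of_lt_one_right hc (norm_nonneg _) hx'

theorem mem_integersIdeal {x : integers p} :
    x ∈ integersIdeal p ↔ ‖(x : PadicAlgCl p)‖ < 1 := Iff.rfl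

instance isPrime_integersIdeal : (integersIdeal p).IsPrime := by
  refine ⟨fun h => ?_, fun {x y} h => ?_⟩
  · have := (Ideal.eq_top_iff_one _).1 h
    rw [mem_integersIdeal] at this
    simp at this
  · by_contra! h'
    rw [mem_integersIdeal, mem_integersIdeal, not_lt, not_lt] at h'
    rw [mem_integersIdeal] at h
    have hx : ‖(x : PadicAlgCl p)‖ ≤ 1 := x.2
    have hy : ‖(y : PadicAlgCl p)‖ ≤ 1 := y.2
    rw [Subring.coe_mul, norm_mul, le_antisymm hx h'.1, le_antisymm hy h'.2] at h
    simp at h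

theorem norm_algEquiv (h : PadicAlgCl p ≃ₐ[ℚ_[p]] PadicAlgCl p) (x : PadicAlgCl p) :
    ‖h x‖ = ‖x‖ :=
  (spectralNorm_eq_of_equiv h x).symm

/-- The action of automorphisms on the integers of the algebraic closure. -/
def integersEquiv (h : PadicAlgCl p ≃ₐ[ℚ_[p]] PadicAlgCl p) : integers p ≃+* integers p where
  toFun x := ⟨h x, by rw [mem_integers, norm_algEquiv]; exact x.2⟩
  invFun x := ⟨h.symm x, by rw [mem_integers, norm_algEquiv]; exact x.2⟩
  left_inv x := Subtype.ext (h.symm_apply_apply _)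
  right_inv x := Subtype.ext (h.apply_symm_apply _)
  map_mul' x y := Subtype.ext (map_mul h _ _)
  map_add' x y := Subtype.ext (map_add h _ _)

variable (E : IntermediateField ℚ_[p] (PadicAlgCl p))

instance integersAction : MulSemiringAction (absGal E) (integers p) where
  smul g x := integersEquiv (g.restrictScalars ℚ_[p]) x
  one_smul _ := rfl
  mul_smul _ _ _ := rfl
  smul_zero g := map_zero (integersEquiv (g.restrictScalars ℚ_[p]))
  smul_add g := map_add (integersEquiv (g.restrictScalars ℚ_[p]))
  smul_one g := map_one (integersEquiv (g.restrictScalars ℚ_[p]))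
  smul_mul g := map_mul (integersEquiv (g.restrictScalars ℚ_[p]))

/-- Any automorphism that acts trivially on the residue field of `E` has the same action on the
residue field of the algebraic closure as some element of the Galois group of `E`. -/
theorem exists_absGal_norm_sub_lt (h : PadicAlgCl p ≃ₐ[ℚ_[p]] PadicAlgCl p)
    (hE : ∀ x ∈ E, ‖x‖ ≤ 1 → ‖h x - x‖ < 1) :
    ∃ g : absGal E, ∀ x, ‖x‖ ≤ 1 → ‖g x - h x‖ < 1 := by
  -- The Galois group acts on the integers of the algebraic closure with open stabilisers, and the
  -- stabiliser of the maximal ideal Q surjects onto the automorphisms of the residue field over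
  -- that of the invariants A. This is applied to the automorphism induced by h.
  have : IsAlgClosure E (PadicAlgCl p) := ⟨inferInstance, inferInstance⟩
  have : IsGalois E (PadicAlgCl p) := inferInstance
  let A := FixedPoints.subring (integers p) (absGal E)
  have hcomm : SMulCommClass (absGal E) A (integers p) := ⟨fun g a b => by
    change g • (a.1 * b) = a.1 * g • b
    rw [smul_mul', a.2 g]⟩
  have hinv : Algebra.IsInvariant A (integers p) (absGal E) := ⟨fun b hb => ⟨⟨b, hb⟩, rfl⟩⟩
  let _ : TopologicalSpace (integers p) := ⊥
  have : DiscreteTopology (integers p) := ⟨rfl⟩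
  have hcont : ContinuousSMul (absGal E) (integers p) := by
    refine continuousSMul_iff_stabilizer_isOpen.2 fun x => ?_
    have := stabilizer_isOpen_of_isIntegral (K := E) (x : PadicAlgCl p)
    convert this using 2
    ext g
    simp only [MulAction.mem_stabilizer_iff]
    exact Subtype.ext_iff
  let Q := integersIdeal p
  let P := Q.under A
  have hmap : Q = Ideal.map (integersEquiv h : integers p →+* integers p) Q := by
    ext x
    rw [Ideal.mem_map_iff_of_surjective (integersEquiv h : integers p →+* integers p)
      (integersEquiv h).surjective]
    constructor
    · intro hx
      refine ⟨(integersEquiv h).symm x, ?_, (integersEquiv h).apply_symm_apply x⟩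
      change ‖h.symm (x : PadicAlgCl p)‖ < 1
      rwa [norm_algEquiv]
    · rintro ⟨y, hy, rfl⟩
      change ‖h (y : PadicAlgCl p)‖ < 1
      rwa [norm_algEquiv]
  let τ := Ideal.quotientEquiv Q Q (integersEquiv h) hmap
  have hτ : ∀ a : A ⧸ P, τ (algebraMap (A ⧸ P) (integers p ⧸ Q) a) = algebraMap _ _ a := by
    intro a
    obtain ⟨a, rfl⟩ := Ideal.Quotient.mk_surjective a
    change Ideal.Quotient.mk Q (integersEquiv h a.1) = Ideal.Quotient.mk Q a.1
    rw [Ideal.Quotient.eq]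
    change ‖h (a.1 : PadicAlgCl p) - a.1‖ < 1
    -- Invariant integers lie in E, so the hypothesis on h says that it induces an automorphism over
    -- A/P.
    refine hE _ ?_ a.1.2
    obtain ⟨y, hy⟩ := (InfiniteGalois.mem_range_algebraMap_iff_fixed (k := E)
      (a.1 : PadicAlgCl p)).2 fun g => congrArg Subtype.val (a.2 g)
    rw [← hy]
    exact y.2
  obtain ⟨g, hg⟩ := Ideal.Quotient.stabilizerHom_surjective_of_profinite (G := absGal E) P Q
    (AlgEquiv.ofRingEquiv (f := τ) hτ)
  refine ⟨g, fun x hx => ?_⟩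
  have h1 := congrArg (fun φ => φ (Ideal.Quotient.mk Q ⟨x, hx⟩)) hg
  have h2 : Ideal.Quotient.mk Q ((g : absGal E) • (⟨x, hx⟩ : integers p)) =
    Ideal.Quotient.mk Q (integersEquiv h ⟨x, hx⟩) := h1
  rw [Ideal.Quotient.eq] at h2
  exact h2

end Residue

end SerreWeights
end

noncomputable section
namespace SerreWeights

/-! ### Surjectivity of the tame character on inertia -/

section Tame

open Polynomial IntermediateField

variable {p : ℕ} [Fact p.Prime] {L : IntermediateField ℚ_[p] (PadicAlgCl p)} {f e : ℕ}
  {π : PadicAlgCl p}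

theorem IsLocalSetting.one_lt_card [NeZero f] : 1 < p ^ f :=
  Nat.one_lt_pow (NeZero.ne f) (Fact.out : p.Prime).one_lt

theorem IsLocalSetting.norm_lt_one (hL : IsLocalSetting L f e π) : ‖π‖ < 1 := by
  by_contra! h
  have h1 := hL.norm_pow_lt_one
  rw [norm_pow] at h1
  exact absurd (one_le_pow₀ h) (not_le.2 h1)

theorem IsLocalSetting.norm_pos (hL : IsLocalSetting L f e π) : 0 < ‖π‖ :=
  norm_pos_iff.2 hL.ne_zero

/-- Scaling x by a power of the uniformiser π^(p^f - 1) brings its norm into [1, ‖π^(p^f - 1)‖⁻¹);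
maximality of the norm of the uniformiser below one leaves only the value 1. -/
theorem IsLocalSetting.exists_norm_eq (hL : IsLocalSetting L f e π) {x : PadicAlgCl p} (hx : x ∈ L)
    (hx0 : x ≠ 0) : ∃ z : ℤ, ‖x‖ = ‖π‖ ^ (((p ^ f - 1 : ℕ) : ℤ) * z) := by
  have hlt := hL.norm_pow_lt_one
  have hpos : 0 < ‖π ^ (p ^ f - 1)‖ := norm_pos_iff.2 (pow_ne_zero _ hL.ne_zero)
  obtain ⟨n, hn1, hn2⟩ := exists_mem_Ico_zpow (norm_pos_iff.2 hx0) ((one_lt_inv₀ hpos).2 hlt)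
  have hy : x * (π ^ (p ^ f - 1)) ^ n ∈ L := mul_mem hx (zpow_mem hL.pow_mem _)
  have hny : ‖x * (π ^ (p ^ f - 1)) ^ n‖ = ‖x‖ * ‖π ^ (p ^ f - 1)‖ ^ n := by
    rw [norm_mul, norm_zpow]
  rw [inv_zpow, inv_le_comm₀ (zpow_pos hpos _) (norm_pos_iff.2 hx0)] at hn1
  have h1 : 1 ≤ ‖x‖ * ‖π ^ (p ^ f - 1)‖ ^ n := by
    rwa [inv_le_iff_one_le_mul₀' (norm_pos_iff.2 hx0)] at hn1
  have h2 : ‖x‖ * ‖π ^ (p ^ f - 1)‖ ^ n < ‖π ^ (p ^ f - 1)‖⁻¹ := by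
    rw [inv_zpow, lt_inv_comm₀ (norm_pos_iff.2 hx0) (zpow_pos hpos _), zpow_add_one₀ hpos.ne'] at hn2
    rw [← lt_inv_comm₀ hpos (by positivity), mul_inv]
    rw [← mul_lt_mul_iff_of_pos_right (zpow_pos hpos n), mul_comm, mul_assoc,
      inv_mul_cancel₀ (zpow_pos hpos n).ne', mul_one]
    exact hn2
  refine ⟨-n, ?_⟩
  suffices h3 : ‖x‖ * ‖π ^ (p ^ f - 1)‖ ^ n = 1 by
    rw [zpow_mul, zpow_natCast, ← norm_pow, zpow_neg]
    exact eq_inv_of_mul_eq_one_left h3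
  refine le_antisymm ?_ h1
  by_contra! h3
  have h4 := hL.norm_le (x * (π ^ (p ^ f - 1)) ^ n)⁻¹ (inv_mem hy) (by
    rw [norm_inv, hny]
    exact inv_lt_one_of_one_lt₀ h3)
  rw [norm_inv, hny] at h4
  exact absurd h4 (not_le.2 ((lt_inv_comm₀ hpos (by positivity)).2 h2))

/-- The terms of a polynomial in `π` of small degree have different norms. -/
theorem IsLocalSetting.norm_coeff_le (hL : IsLocalSetting L f e π) {P : L[X]}
    (hP : P.natDegree < p ^ f - 1) (i : ℕ) :
    ‖((P.coeff i : L) : PadicAlgCl p) * π ^ i‖ ≤ ‖aeval π P‖ := by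
  set N := p ^ f - 1
  set T : ℕ → PadicAlgCl p := fun i => ((P.coeff i : L) : PadicAlgCl p) * π ^ i with hT
  have hsum : aeval π P = ∑ i ∈ Finset.range N, T i := by
    rw [aeval_eq_sum_range' hP]
    exact Finset.sum_congr rfl fun i _ => Algebra.smul_def _ _
  obtain ⟨k, hk, hmax⟩ := Finset.exists_max_image (Finset.range N) (fun i => ‖T i‖)
    ⟨0, Finset.mem_range.2 (by omega)⟩
  have hi : ‖T i‖ ≤ ‖T k‖ := by
    by_cases hi : i < N
    · exact hmax i (Finset.mem_range.2 hi)
    · simp only [hT]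
      rw [coeff_eq_zero_of_natDegree_lt (by omega)]
      simp
      positivity
  by_cases h0 : T k = 0
  · rw [h0, norm_zero] at hi
    exact hi.trans (norm_nonneg _)
  refine hi.trans (le_of_eq ?_)
  rw [hsum]
  refine (IsNonarchimedean.apply_sum_eq_of_lt (f := fun x : PadicAlgCl p => ‖x‖)
    (PadicAlgCl.isNonarchimedean p) (fun a => (norm_neg a).symm) hk fun j hj hjk => ?_).symm
  refine lt_of_le_of_ne (hmax j hj) fun h => hjk ?_
  have h0j : T j ≠ 0 := fun hj0 => h0 (by rw [← norm_eq_zero, ← h, hj0, norm_zero])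
  have key : ∀ l, T l ≠ 0 → ∃ z : ℤ, ‖T l‖ = ‖π‖ ^ ((N : ℤ) * z + l) := fun l hl => by
    obtain ⟨z, hz⟩ := hL.exists_norm_eq (P.coeff l).2 (left_ne_zero_of_mul hl)
    refine ⟨z, ?_⟩
    rw [norm_mul, hz, norm_pow, zpow_add₀ hL.norm_pos.ne', zpow_natCast]
  obtain ⟨z, hz⟩ := key j h0j
  obtain ⟨z', hz'⟩ := key k h0
  rw [hz, hz'] at h
  have h1 := zpow_right_injective₀ hL.norm_pos hL.norm_lt_one.ne h
  have hjN := Finset.mem_range.1 hj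
  have hkN := Finset.mem_range.1 hk
  have h2 : ((N : ℤ)) ∣ j - k := ⟨z' - z, by linear_combination h1⟩
  have h3 := Int.eq_zero_of_abs_lt_dvd h2 (by rw [abs_lt]; omega)
  omega

theorem IsLocalSetting.minpoly_eq [NeZero f] (hL : IsLocalSetting L f e π) :
    minpoly L π = X ^ (p ^ f - 1) - C (⟨π ^ (p ^ f - 1), hL.pow_mem⟩ : L) := by
  have hq := IsLocalSetting.one_lt_card (p := p) (f := f)
  have hroot : aeval π (X ^ (p ^ f - 1) - C (⟨π ^ (p ^ f - 1), hL.pow_mem⟩ : L)) = 0 := by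
    rw [map_sub, map_pow, aeval_X, aeval_C]
    exact sub_self _
  have hmon : (X ^ (p ^ f - 1) - C (⟨π ^ (p ^ f - 1), hL.pow_mem⟩ : L)).Monic :=
    monic_X_pow_sub_C _ (by omega)
  have hint : IsIntegral L π := ⟨_, hmon, hroot⟩
  refine (minpoly.unique _ _ hmon hroot fun Q hQ hQ0 => ?_).symm
  rw [degree_X_pow_sub_C (by omega), degree_eq_natDegree hQ.ne_zero, Nat.cast_le]
  by_contra! h
  have h1 := hL.norm_coeff_le h Q.natDegree
  rw [hQ.coeff_natDegree, hQ0, norm_zero, norm_le_zero_iff] at h1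
  simp only [OneMemClass.coe_one, one_mul] at h1
  exact pow_ne_zero _ hL.ne_zero h1

/-- `L(π)` has the same residue field as `L`. -/
theorem IsLocalSetting.exists_norm_sub_lt [NeZero f] (hL : IsLocalSetting L f e π)
    {x : PadicAlgCl p} (hx : x ∈ L⟮π⟯) (hx1 : ‖x‖ ≤ 1) : ∃ y ∈ L, ‖y‖ ≤ 1 ∧ ‖x - y‖ < 1 := by
  have hq := IsLocalSetting.one_lt_card (p := p) (f := f)
  have hmon : (X ^ (p ^ f - 1) - C (⟨π ^ (p ^ f - 1), hL.pow_mem⟩ : L)).Monic :=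
    monic_X_pow_sub_C _ (by omega)
  have hroot : aeval π (X ^ (p ^ f - 1) - C (⟨π ^ (p ^ f - 1), hL.pow_mem⟩ : L)) = 0 := by
    rw [map_sub, map_pow, aeval_X, aeval_C]
    exact sub_self _
  have hint : IsIntegral L π := ⟨_, hmon, hroot⟩
  rw [← mem_toSubalgebra, adjoin_simple_toSubalgebra_of_isAlgebraic hint.isAlgebraic,
    Algebra.adjoin_singleton_eq_range_aeval] at hx
  obtain ⟨P₀, rfl⟩ := hx
  obtain ⟨P, hP, hPx⟩ : ∃ P : L[X], P.natDegree < p ^ f - 1 ∧ aeval π P = aeval π P₀ := by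
    refine ⟨P₀ %ₘ (X ^ (p ^ f - 1) - C (⟨π ^ (p ^ f - 1), hL.pow_mem⟩ : L)), ?_, ?_⟩
    · refine (natDegree_modByMonic_lt _ hmon fun h => ?_).trans_eq (natDegree_X_pow_sub_C)
      have := congrArg natDegree h
      rw [natDegree_X_pow_sub_C, natDegree_one] at this
      omega
    · exact aeval_modByMonic_eq_self_of_root hroot
  change ‖aeval π P₀‖ ≤ 1 at hx1
  change ∃ y ∈ L, ‖y‖ ≤ 1 ∧ ‖aeval π P₀ - y‖ < 1
  rw [← hPx] at hx1 ⊢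
  -- The constant term is the required approximation. Every other nonzero term has norm at most 1
  -- and equal to ‖π‖ raised to an exponent not divisible by p^f - 1, so the exponent is at least 1.
  refine ⟨P.coeff 0, (P.coeff 0).2, ?_, ?_⟩
  · simpa using (hL.norm_coeff_le hP 0).trans hx1
  · have hsum : aeval π P - (P.coeff 0 : L) = ∑ i ∈ Finset.range (p ^ f - 1 - 1),
        ((P.coeff (i + 1) : L) : PadicAlgCl p) * π ^ (i + 1) := by
      rw [aeval_eq_sum_range' hP, ← Nat.sub_add_cancel (show 1 ≤ p ^ f - 1 by omega),
        Finset.sum_range_succ', pow_zero, Algebra.smul_def, mul_one, Nat.add_sub_cancel]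
      refine (add_sub_cancel_right _ _).trans
        (Finset.sum_congr rfl fun i _ => Algebra.smul_def _ _)
    rw [hsum]
    refine lt_of_le_of_lt (IsUltrametricDist.norm_sum_le_of_forall_le_of_nonneg (norm_nonneg π)
      fun i hi => ?_) hL.norm_lt_one
    by_cases h0 : P.coeff (i + 1) = 0
    · rw [h0]
      simp
    have h1 := (hL.norm_coeff_le hP (i + 1)).trans hx1
    obtain ⟨z, hz⟩ := hL.exists_norm_eq (P.coeff (i + 1)).2 (by simpa using h0)
    have h2 : ‖((P.coeff (i + 1) : L) : PadicAlgCl p) * π ^ (i + 1)‖ =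
        ‖π‖ ^ (((p ^ f - 1 : ℕ) : ℤ) * z + (i + 1 : ℕ)) := by
      rw [norm_mul, hz, norm_pow, zpow_add₀ hL.norm_pos.ne', zpow_natCast]
    rw [h2] at h1 ⊢
    rw [zpow_le_one_iff_right_of_lt_one₀ hL.norm_pos hL.norm_lt_one] at h1
    have hi' := Finset.mem_range.1 hi
    have h3 : ((p ^ f - 1 : ℕ) : ℤ) * z + (i + 1 : ℕ) ≠ 0 := fun h => by
      have h4 : ((p ^ f - 1 : ℕ) : ℤ) ∣ (i + 1 : ℕ) := ⟨-z, by linear_combination h⟩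
      have h5 := Nat.le_of_dvd (by omega) (Int.natCast_dvd_natCast.1 h4)
      omega
    conv_rhs => rw [← zpow_one ‖π‖]
    exact zpow_le_zpow_right_of_le_one₀ hL.norm_pos hL.norm_lt_one.le (by omega)

theorem norm_lt_one_iff_residue_eq_zero (u : ringOfIntegers L) :
    ‖((u : L) : PadicAlgCl p)‖ < 1 ↔ IsLocalRing.residue (ringOfIntegers L) u = 0 := by
  rw [IsLocalRing.residue_eq_zero_iff, ValuationSubring.valuation_lt_one_iff]
  exact Valuation.isEquiv_iff_val_lt_one.1
    (Valuation.isEquiv_valuation_valuationSubring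
      ((Valued.v : Valuation (PadicAlgCl p) ℝ≥0).comap (algebraMap L (PadicAlgCl p))))

theorem IsLocalSetting.tameCharacter_eq (hL : IsLocalSetting L f e π) {g : absGal L}
    {u : ringOfIntegers L} (hu : ‖g π / π - ((u : L) : PadicAlgCl p)‖ < 1) :
    tameCharacter L π g = IsLocalRing.residue (ringOfIntegers L) u := by
  have h := hL.exists_residue g
  rw [tameCharacter, dif_pos h, ← sub_eq_zero, ← map_sub, ← norm_lt_one_iff_residue_eq_zero]
  have h1 := h.choose_spec
  rw [norm_sub_rev] at h1
  have h2 := (IsUltrametricDist.norm_add_le_max _ _).trans_lt (max_lt h1 hu)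
  rwa [sub_add_sub_cancel] at h2

theorem IsLocalSetting.tameCharacter_ne_zero (hL : IsLocalSetting L f e π) (g : absGal L) :
    tameCharacter L π g ≠ 0 := by
  obtain ⟨u, hu⟩ := hL.exists_residue g
  rw [hL.tameCharacter_eq hu, Ne, ← norm_lt_one_iff_residue_eq_zero]
  intro h
  have h1 := (IsUltrametricDist.norm_add_le_max _ _).trans_lt (max_lt hu h)
  rw [sub_add_cancel, norm_div, norm_absGal, div_self (norm_ne_zero_iff.2 hL.ne_zero)] at h1
  exact lt_irrefl _ h1

/-- The element u^N - 1 is the product of the u - ζ over the roots of unity ζ, so one factor must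
have norm below one. -/
theorem exists_pow_eq_one_norm_sub_lt {N : ℕ} (hN : 0 < N) {u : PadicAlgCl p}
    (hu : ‖u ^ N - 1‖ < 1) : ∃ ζ : PadicAlgCl p, ζ ^ N = 1 ∧ ‖ζ - u‖ < 1 := by
  have hmon : (X ^ N - C (1 : PadicAlgCl p)).Monic := monic_X_pow_sub_C _ hN.ne'
  have h1 := (IsAlgClosed.splits (X ^ N - C (1 : PadicAlgCl p))).eq_prod_roots_of_monic hmon
  have h2 := congrArg (eval u) h1
  rw [eval_multiset_prod] at h2
  simp only [eval_sub, eval_pow, eval_X, eval_C, Multiset.map_map, Function.comp_def] at h2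
  by_contra! h
  refine absurd hu (not_lt.2 ?_)
  rw [h2]
  refine Multiset.prod_induction (fun y => 1 ≤ ‖y‖) _ (fun a b ha hb => ?_) (by simp) fun y hy => ?_
  · rw [norm_mul]
    exact one_le_mul_of_one_le_of_one_le ha hb
  · obtain ⟨ζ, hζ, rfl⟩ := Multiset.mem_map.1 hy
    rw [mem_roots hmon.ne_zero] at hζ
    rw [norm_sub_rev]
    refine h ζ ?_
    simpa [IsRoot, sub_eq_zero] using hζ

/-- The tame character maps inertia onto the multiplicative group of the residue field. -/
theorem IsLocalSetting.exists_tameCharacter_eq [NeZero f] (hL : IsLocalSetting L f e π)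
    {x : residueField L} (hx : x ≠ 0) : ∃ g ∈ inertia L, tameCharacter L π g = x := by
  have hp : p.Prime := Fact.out
  have hq := IsLocalSetting.one_lt_card (p := p) (f := f)
  obtain ⟨u, rfl⟩ := IsLocalRing.residue_surjective x
  have hpow : ‖((u : L) : PadicAlgCl p) ^ (p ^ f - 1) - 1‖ < 1 := by
    have hfin : Finite (residueField L) := Nat.finite_of_card_ne_zero (by
      rw [hL.card_residueField]
      exact pow_ne_zero _ hp.ne_zero)
    have : Fintype (residueField L) := Fintype.ofFinite _
    have h1 := FiniteField.pow_card_sub_one_eq_one _ hx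
    rw [← Nat.card_eq_fintype_card, hL.card_residueField, ← map_pow, ← sub_eq_zero,
      ← map_one (IsLocalRing.residue (ringOfIntegers L)), ← map_sub,
      ← norm_lt_one_iff_residue_eq_zero] at h1
    exact h1
  obtain ⟨ζ, hζ, hζu⟩ := exists_pow_eq_one_norm_sub_lt (by omega) hpow
  have hconj : IsConjRoot L π (ζ * π) := by
    refine isConjRoot_of_aeval_eq_zero (Algebra.IsIntegral.isIntegral π) ?_
    rw [hL.minpoly_eq, map_sub, map_pow, aeval_X, aeval_C, mul_pow, hζ, one_mul]
    exact sub_self _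
  have : IsAlgClosure L (PadicAlgCl p) := ⟨inferInstance, inferInstance⟩
  have : IsGalois L (PadicAlgCl p) := inferInstance
  obtain ⟨h, hh⟩ := hconj.symm.exists_algEquiv
  -- The map h with h π = ζ π may act nontrivially on the residue field of the closure. As L(π) has
  -- the residue field of L, the action of h there is also induced by an automorphism fixing L(π);
  -- composing with its inverse yields an element of inertia that still sends π to ζ π.
  let M : IntermediateField ℚ_[p] (PadicAlgCl p) := L⟮π⟯.restrictScalars ℚ_[p]
  have hLM : ∀ y ∈ L, y ∈ M := fun y hy => (L⟮π⟯).algebraMap_mem ⟨y, hy⟩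
  obtain ⟨g, hg⟩ := exists_absGal_norm_sub_lt M (h.restrictScalars ℚ_[p]) fun y hy hy1 => by
    obtain ⟨z, hz, hz1, hzy⟩ := hL.exists_norm_sub_lt hy hy1
    have h1 : h y - y = h (y - z) + (z - y) := by
      rw [map_sub, show h z = z from h.commutes ⟨z, hz⟩]
      ring
    change ‖h y - y‖ < 1
    rw [h1]
    refine (IsUltrametricDist.norm_add_le_max _ _).trans_lt (max_lt ?_ ?_)
    · rwa [norm_absGal]
    · rwa [norm_sub_rev]
  let g' : absGal L := AlgEquiv.ofRingEquiv (f := g.toRingEquiv)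
    fun y => g.commutes ⟨y, hLM y y.2⟩
  have hg'π : g' π = π := g.commutes ⟨π, mem_adjoin_simple_self L π⟩
  have hπ : (h * g'⁻¹) π = ζ * π := by
    rw [AlgEquiv.mul_apply]
    have : g'⁻¹ π = π := by
      conv_lhs => rw [← hg'π]
      exact g'.symm_apply_apply π
    rw [this, ← hh]
  refine ⟨h * g'⁻¹, fun y hy => ?_, hL.tameCharacter_eq ?_⟩
  · have h1 := hg (g'⁻¹ y) (by rwa [norm_absGal])
    have h2 : g' (g'⁻¹ y) = y := g'.apply_symm_apply y
    have h3 : ‖g' (g'⁻¹ y) - h (g'⁻¹ y)‖ < 1 := h1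
    rwa [h2, norm_sub_rev] at h3
  · rw [hπ, mul_div_cancel_right₀ _ hL.ne_zero]
    exact hζu

theorem IsLocalSetting.ramification_pos (hL : IsLocalSetting L f e π) : 0 < e := by
  rcases Nat.eq_zero_or_pos e with rfl | h
  · have h1 := hL.ramification
    rw [pow_zero, ← PadicAlgCl.valuation_coe, PadicAlgCl.valuation_p] at h1
    have h2 := (Fact.out : p.Prime).one_lt
    have h3 : (1 : ℝ) < p := by exact_mod_cast h2
    rw [NNReal.coe_div, NNReal.coe_one, NNReal.coe_natCast, eq_div_iff (by positivity)] at h1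
    linarith
  · exact h

end Tame

end SerreWeights
end

noncomputable section
namespace SerreWeights

/-! ### From characters of inertia to congruences -/

section Inertia

variable {p : ℕ} [Fact p.Prime] {L : IntermediateField ℚ_[p] (PadicAlgCl p)} {f e : ℕ} [NeZero f]
  {π : PadicAlgCl p} (hL : IsLocalSetting L f e π) {F : Type*} [Field F]
  {σ : ZMod f → residueField L →+* F} (hσ : ∀ i x, σ (i + 1) x ^ p = σ i x)

include hL hσ

/-- The exponents of a character on inertia are well defined up to congruence. -/
theorem EqOnInertia.iff_expCong {χ : absGal L →* Fˣ} {s t : ZMod f → ℤ}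
    (h : EqOnInertia σ π χ t) : EqOnInertia σ π χ s ↔ ExpCong p s t := by
  rw [ExpCong, ← prod_embedding_eq_iff hσ hL.card_residueField]
  constructor
  · intro h' x hx
    obtain ⟨g, hg, rfl⟩ := hL.exists_tameCharacter_eq hx
    rw [← h' g hg, h g hg]
  · intro h' g hg
    rw [h g hg, h' _ (hL.tameCharacter_ne_zero g)]

/-- Writing χ₂ = χ₁ · (χ₁⁻¹ χ₂) gives exponents for χ₂ on inertia, after which both conditions
defining W' become congruences. -/
theorem setW'_eq_predictedSet {χ₁ χ₂ : absGal L →* Fˣ} {b c : ZMod f → ℤ}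
    (hgen : EqOnInertia σ π (χ₁⁻¹ * χ₂) (fun i => b i + e)) (hc : EqOnInertia σ π χ₁ c) :
    setW' σ e π χ₁ χ₂ = predictedSet σ p e b c := by
  have h2 : EqOnInertia σ π χ₂ (fun i => c i + (b i + e)) := fun g hg => by
    have h3 : χ₂ g = χ₁ g * (χ₁⁻¹ * χ₂) g := by simp
    rw [h3, Units.val_mul, hc g hg, hgen g hg, ← Finset.prod_mul_distrib]
    exact Finset.prod_congr rfl fun i _ =>
      (zpow_add₀ ((map_ne_zero _).2 (hL.tameCharacter_ne_zero g)) _ _).symm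
  unfold setW' predictedSet
  simp only [h2.iff_expCong hL hσ, hc.iff_expCong hL hσ]

end Inertia

end SerreWeights
end

open SerreWeights in
theorem proposition3p3
    (p : ℕ) [Fact p.Prime] (hp : p ≠ 2)
    (L : IntermediateField ℚ_[p] (PadicAlgCl p)) [FiniteDimensional ℚ_[p] L]
    (f e : ℕ) [NeZero f] (π : PadicAlgCl p) (hL : IsLocalSetting L f e π)
    (F : Type*) [Field F] [Finite F] [TopologicalSpace F] [DiscreteTopology F]
    (σ : ZMod f → residueField L →+* F) (hσ : ∀ i x, σ (i + 1) x ^ p = σ i x)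
    (ρ : absGal L →* GL (Fin 2) F) (hρ : Continuous ρ)
    (χ₁ χ₂ : absGal L →* Fˣ)
    (hχ : ∃ P : GL (Fin 2) F, ∀ g, ∃ u : F,
      (P * ρ g * P⁻¹).1 = !![(χ₂ g : F), u; 0, (χ₁ g : F)])
    (b c : ZMod f → ℤ)
    (hb : ∀ i, (e : ℤ) ≤ b i + e ∧ b i + e ≤ p - 1 - e)
    (hgen : EqOnInertia σ π (χ₁⁻¹ * χ₂) (fun i => b i + e))
    (hc : EqOnInertia σ π χ₁ c) :
    (setW σ p e b c = ⋃ a ∈ setA f e, setWa σ e π χ₁ χ₂ b c a) ∧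
    (setA f e).PairwiseDisjoint (fun a => setWa σ e π χ₁ χ₂ b c a) ∧
    (setW' σ e π χ₁ χ₂ = ⋃ a ∈ setA f e, setWa' σ e π χ₁ χ₂ b c a) ∧
    (setA f e).PairwiseDisjoint (fun a => setWa' σ e π χ₁ χ₂ b c a) ∧
    (∀ a ∈ setA f e, (setWa σ e π χ₁ χ₂ b c a).ncard = 2 ^ (f - delta e a)) ∧
    (∀ a ∈ setA f e, ∀ J d, Admissible e J d →
      muJd σ p b c J d ∈ setWa' σ e π χ₁ χ₂ b c a → ∑ i, a i = ∑ i, d i) ∧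
    (∀ a ∈ setA f e, ∀ J d, Exceptional p e b J d →
      muPrimeJd σ p e c J ∈ setWa' σ e π χ₁ χ₂ b c a → ∑ i, a i = ∑ i, d i) := by
  have h1 := setW'_eq_predictedSet hL hσ hgen hc
  have h2 : ∀ a, setWa σ e π χ₁ χ₂ b c a = predictedSet σ p e b c ∩ thetaSet σ p b c a :=
    fun a => by rw [← h1]; rfl
  have h3 : ∀ a, setWa' σ e π χ₁ χ₂ b c a = predictedSet σ p e b c ∩ thetaSet' σ p b c a :=
    fun a => by rw [← h1]; rfl
  simp only [h1, h2, h3]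
  exact predictedSet_decomposition hσ hL.card_residueField hp hL.ramification_pos hb c
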